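/- Let $w_{\ell k}$ ($\ell,k\ge 0$) be non-negative real numbers, non-decreasing in $k$ for each fixed $\ell$, with generating functions $$G_k(z)=\frac{R_k(z)}{S_k(z)}=\sum_{\ell\ge 0}w_{\ell k}z^\ell\qquad(k\ge 0),$$ $$R_k(z)=r_0(z)+r_1\Big(z,\Big(\frac z{a_1}\Big)^k,\dots,\Big(\frac z{a_m}\Big)^k\Big),$$ $$S_k(z)=(1-z)s_0(z)+\Big(\frac z{a_1}\Big)^k s_1(z)+s_2\Big(z,\Big(\frac z{a_1}\Big)^k,\dots,\Big(\frac z{a_m}\Big)^k\Big),$$ where $S_k\not\equiv 0$, $m\ge 2$, the numbers $a_1,\dots,a_m$ are real with $1<a:=a_1<|a_2|\le|a_3|\le\dots\le|a_m|$, $r_0,s_0,s_1$ are real polynomials in $z$ not depending on $k$, and $r_1(z,y_1,\dots,y_m)$, $s_2(z,y_1,\dots,y_m)$ are real polynomials not depending on $k$ such that each summand of $r_1$ is divisible by one of $y_1,\dots,y_m$ and each summand of $s_2$ is divisible by one of $y_1^2,y_2,\dots,y_m$. Put $$\delta:=\frac{s_1(1)}{s_0(1)},\qquad \rho:=\min\Big(\frac{\log|a_2|}{\log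 a_1},2\Big)-1,$$ and assume that $r_0(1)\ne 0$, that $s_0$ has no zero in $\{z\in\mathbb C:|z|\le 1\}$, and that $\delta>0$. Let $G(z):=\frac{r_0(z)}{(1-z)s_0(z)}$. Then the following hold. 1. $\lim_{k\to\infty}G_k(z)=G(z)$ for every complex $z$ with $|z|<a$ and $(1-z)s_0(z)\neq0$ (where $G_k=R_k/S_k$ is the rational function), and there are real numbers $w_\ell$ with $G(z)=\sum_{\ell\ge 0}w_\ell z^\ell$ for $|z|<1$ and $w_\ell=w_{\ell k}$ for all $k>\ell$. There is an $\ell_0$ with $w_\ell\ne 0$ for all $\ell\ge\ell_0$. 2. For $\ell\ge\ell_0$ there is a random variable $X_\ell$ with values in $\mathbb N_0$ whose law is given by $\mathbb P(X_\ell\le k)=w_{\ell k}/w_\ell$ for all $k\ge0$. 3. As $\ell\to\infty$, $$\frac{w_{\ell k}}{w_\ell}=\exp(-\delta\ell/a^k)(1+o(1))\qquad\text{for }k=\log_a\ell+O(1),$$ i.e. for every $K$ the $o(1)$ is uniform over all integers $k\ge 0$ with $|k-\log_a\ell|\le K$. 4. For every $\theta$ there is a probability measure $\mu_\theta$ on $\mathbb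 R$ such that $X_\ell-\log_a\ell$ converges weakly to $\mu_\theta$ whenever $\ell$ tends to infinity through an infinite set of positive integers along which the fractional part $\{\log_a\ell\}$ converges to $\theta$. 5. $X_\ell$ has finite second moment for $\ell\ge\ell_0$, and with $x_\ell:=\log_a\ell+\log_a\delta$ and $\gamma$ the Euler--Mascheroni constant, $$\mathbb E X_\ell=x_\ell+\frac{\gamma}{\log a}+\frac12+\Psi_0(x_\ell)+O\Big(\frac{\log^{\rho+3}\ell}{\ell^\rho}\Big),$$ $$\mathbb V X_\ell=\frac{\pi^2}{6\log^2a}+\frac1{12}+\Psi_1(x_\ell)-\frac{2\gamma}{\log a}\Psi_0(x_\ell)-\Psi_0(x_\ell)^2+O\Big(\frac{\log^{\rho+4}\ell}{\ell^\rho}\Big)$$ as $\ell\to\infty$. Here $\Psi_0,\Psi_1:\mathbb R\to\mathbb R$ are continuous periodic functions with period $1$ and mean value $0$, given by the (absolutely convergent) Fourier expansions $$\Psi_0(x)=-\frac1{\log a}\sum_{n\in\mathbb Z,\,n\ne0}\Gamma\Big(-\frac{2n\pi i}{\log a}\Big)e^{2n\pi ix},\qquad \Psi_1(x)=\frac2{\log^2a}\sum_{n\in\mathbb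 Z,\,n\ne0}\Gamma'\Big(-\frac{2n\pi i}{\log a}\Big)e^{2n\pi ix}.$$ -/

import Mathlib

open Polynomial Filter Topology MeasureTheory ProbabilityTheory Asymptotics

noncomputable section

namespace CarryGF

/-- The polynomials `(z / a_j) ^ k` in `z`. -/
def perturb {m : ℕ} (a : Fin m → ℝ) (k : ℕ) (j : Fin m) : ℝ[X] :=
  (C (a j)⁻¹ * X) ^ k

/-- The numerator `R_k(z) = r₀(z) + r₁(z, (z/a₁)^k, …, (z/a_m)^k)`. A real polynomial in `z` and
further variables `y_1, …, y_m` is written as a polynomial in the `y_j` over `ℝ[z]`. -/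
def numer {m : ℕ} (a : Fin m → ℝ) (r₀ : ℝ[X]) (r₁ : MvPolynomial (Fin m) ℝ[X]) (k : ℕ) : ℝ[X] :=
  r₀ + MvPolynomial.eval (perturb a k) r₁

/-- The denominator
`S_k(z) = (1 - z) s₀(z) + (z/a₁)^k s₁(z) + s₂(z, (z/a₁)^k, …, (z/a_m)^k)`, where `m = n + 2` and
the numbers `a₁, a₂, …` are `a 0, a 1, …`. -/
def denom {n : ℕ} (a : Fin (n + 2) → ℝ) (s₀ s₁ : ℝ[X])
    (s₂ : MvPolynomial (Fin (n + 2)) ℝ[X]) (k : ℕ) : ℝ[X] :=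
  (1 - X) * s₀ + perturb a k 0 * s₁ + MvPolynomial.eval (perturb a k) s₂

/-- Every summand is divisible by one of `y_1, …, y_m`. -/
def SummandsDivisible₁ {m : ℕ} (p : MvPolynomial (Fin m) ℝ[X]) : Prop :=
  ∀ d ∈ p.support, ∃ j, 1 ≤ d j

/-- Every summand is divisible by one of `y_1 ^ 2, y_2, …, y_m`. -/
def SummandsDivisible₂ {n : ℕ} (p : MvPolynomial (Fin (n + 2)) ℝ[X]) : Prop :=
  ∀ d ∈ p.support, 2 ≤ d 0 ∨ ∃ j, j ≠ 0 ∧ 1 ≤ d j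

/-- The constant `δ = s₁(1) / s₀(1)`. -/
def delta (s₀ s₁ : ℝ[X]) : ℝ := s₁.eval 1 / s₀.eval 1

/-- The exponent `ρ = min (log |a₂| / log a₁, 2) - 1`. -/
def rho {n : ℕ} (a : Fin (n + 2) → ℝ) : ℝ :=
  min (Real.log |a 1| / Real.log (a 0)) 2 - 1

/-- The limit `G(z) = r₀(z) / ((1 - z) s₀(z))`, as a function on `ℂ`. -/
def limitGF (r₀ s₀ : ℝ[X]) (z : ℂ) : ℂ := aeval z r₀ / ((1 - z) * aeval z s₀)

/-- The law of `X - c`, when the `ℕ`-valued random variable `X` has law `P`. -/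
def shiftedLaw (P : ProbabilityMeasure ℕ) (c : ℝ) : ProbabilityMeasure ℝ :=
  P.map (f := fun n : ℕ => (n : ℝ) - c) (measurable_of_countable _).aemeasurable

/-- The point `-2nπi / log a`. -/
def fourierPoint (a : ℝ) (n : ℤ) : ℂ :=
  -(2 * n * Real.pi * Complex.I) / (Real.log a : ℂ)

/-- The `n`-th term of the Fourier expansion of `Ψ₀`. -/
def psi₀Term (a x : ℝ) (n : ℤ) : ℂ :=
  -(1 / (Real.log a : ℂ)) *
    (Complex.Gamma (fourierPoint a n) * Complex.exp (2 * n * Real.pi * Complex.I * x))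

/-- The `n`-th term of the Fourier expansion of `Ψ₁`. -/
def psi₁Term (a x : ℝ) (n : ℤ) : ℂ :=
  2 / (Real.log a : ℂ) ^ 2 *
    (deriv Complex.Gamma (fourierPoint a n) * Complex.exp (2 * n * Real.pi * Complex.I * x))

/-- `Ψ` is continuous, has period `1` and mean value `0`, and is the sum of the terms `t x n` over
all integers `n ≠ 0`. -/
def IsFluctuation (t : ℝ → ℤ → ℂ) (Ψ : ℝ → ℝ) : Prop :=
  (∀ x, HasSum (fun n : {n : ℤ // n ≠ 0} => t x n) (Ψ x : ℂ)) ∧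
    Continuous Ψ ∧ Function.Periodic Ψ 1 ∧ ∫ x in (0 : ℝ)..1, Ψ x = 0

end CarryGF

end

/-! For large `k` the denominator `S_k` is a small perturbation of `(1 - z) s₀(z)`, so it has a real
zero `ζ_k = 1 + δ a^(-k) + O(k b^(-k))` near `1`, where `b = min(|a₂|, a²) = a^(1 + ρ)`. After this
zero is divided out, the quotient stays invertible on a fixed disc of radius `r > 1`. The dominant
pole therefore gives `w_{ℓk} = h_k ζ_k^(-(ℓ + 1)) + O(r^(-ℓ))` with `h_k` close to `c =
r₀(1)/s₀(1)`, and taking logarithms turns this into `c exp(-δℓ/a^k)` with an explicit error, uniform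
in `ℓ` (`exists_coeff_asymptotics`). Contour integrals are replaced by a weighted `ℓ¹`-norm on power
series: it is submultiplicative, dominates values on the disc, and behaves well under division by `X
- ζ` and by `1 - e` with `e` small (`WNormLE`, `exists_quotient`, `eventually_coeff_pole`).

Modulo `X^k` the series `G_k` and `G` agree, so `w_{ℓk} = w_ℓ` for `k > ℓ`, and `w_{ℓk}/w_ℓ` is a
finitely supported distribution function in `k`. Its distance to `exp(-δℓ/a^k)` is summed over `k`
with polynomial weights (`exists_error_sum_le`). The sum is cut where `a^k` is about `δℓ/log ℓ`:
above the cut the error bounds decay geometrically, below it both functions are tiny by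
monotonicity. The result, `CloseToGumbel`, is all that the probabilistic statements need.

With `x = log_a ℓ + log_a δ` the approximating function is `gumbel a (k - x)`, whose increments are
`mass a (k - x)`. Summation by parts replaces the moments of `X_ℓ` by sums of `k^j mass a (k - x)`
over all integers. Poisson summation expands these in Fourier series whose coefficients are values,
at the points `-2nπi/log a`, of derivatives of the Mellin transform of `e^(-t) - e^(-at)`, that is,
of `Γ(s)(1 - a^(-s))`. For `n ≠ 0` the second factor vanishes, which leaves `Γ` and `Γ'`
(`logMellin_fourierPoint`). For `n = 0` the Taylor expansion of `Γ` at `1` produces `γ` and `π²/6`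
(`logMellin_at_zero`).

For weak convergence, sums of bounded functions against the masses depend on `log_a ℓ` only through
its fractional part, and continuously so. The limit law consists of the masses `mass a (k - θ -
log_a δ)` at the points `k - θ`. -/

namespace CarryGF

/-! ### Weighted `ℓ¹`-norms of power series -/

open Finset in
/-- The power series `f` has weighted `ℓ¹`-norm `∑ ‖f_n‖ r ^ n` at most `M`. -/
def WNormLE {𝕜 : Type*} [NormedField 𝕜] (r : ℝ) (f : PowerSeries 𝕜) (M : ℝ) : Prop :=
  ∀ N, ∑ n ∈ range N, ‖PowerSeries.coeff n f‖ * r ^ n ≤ M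

namespace WNormLE

variable {𝕜 : Type*} [NormedField 𝕜] {r t M M' : ℝ} {f g : PowerSeries 𝕜}

theorem nonneg (hf : WNormLE r f M) : 0 ≤ M := by simpa using hf 0

theorem mono (hf : WNormLE r f M) (h : M ≤ M') : WNormLE r f M' := fun N => (hf N).trans h

theorem mono_radius (ht : 0 ≤ t) (htr : t ≤ r) (hf : WNormLE r f M) : WNormLE t f M := fun N =>
  (Finset.sum_le_sum fun n _ => by gcongr).trans (hf N)

theorem zero : WNormLE r (0 : PowerSeries 𝕜) 0 := fun N => by simp

theorem add (hr : 0 ≤ r) (hf : WNormLE r f M) (hg : WNormLE r g M') :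
    WNormLE r (f + g) (M + M') := fun N => by
  refine le_trans ?_ (add_le_add (hf N) (hg N))
  rw [← Finset.sum_add_distrib]
  refine Finset.sum_le_sum fun n _ => ?_
  rw [← add_mul, map_add]
  gcongr
  exact norm_add_le _ _

theorem neg (hf : WNormLE r f M) : WNormLE r (-f) M := fun N => by simpa using hf N

theorem sub (hr : 0 ≤ r) (hf : WNormLE r f M) (hg : WNormLE r g M') :
    WNormLE r (f - g) (M + M') := by
  simpa [sub_eq_add_neg] using hf.add hr hg.neg

/-- Pairs of exponents with sum below `N` lie in the square `range N × range N`. Working with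
truncations avoids assuming finite norms, so the division lemmas can apply this to a quotient not
yet known to have one. -/
theorem sum_mul_le (hr : 0 ≤ r) (f g : PowerSeries 𝕜) (N : ℕ) :
    ∑ n ∈ Finset.range N, ‖PowerSeries.coeff n (f * g)‖ * r ^ n ≤
      (∑ n ∈ Finset.range N, ‖PowerSeries.coeff n f‖ * r ^ n) *
        ∑ n ∈ Finset.range N, ‖PowerSeries.coeff n g‖ * r ^ n := by
  calc _ ≤ ∑ n ∈ Finset.range N, ∑ p ∈ Finset.HasAntidiagonal.antidiagonal n,
        (‖PowerSeries.coeff p.1 f‖ * r ^ p.1) * (‖PowerSeries.coeff p.2 g‖ * r ^ p.2) := by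
        refine Finset.sum_le_sum fun n _ => ?_
        rw [PowerSeries.coeff_mul]
        calc _ ≤ (∑ p ∈ Finset.HasAntidiagonal.antidiagonal n,
              ‖PowerSeries.coeff p.1 f * PowerSeries.coeff p.2 g‖) * r ^ n := by
              gcongr; exact norm_sum_le _ _
          _ = _ := by
              rw [Finset.sum_mul]
              refine Finset.sum_congr rfl fun p hp => ?_
              rw [← Finset.HasAntidiagonal.mem_antidiagonal.1 hp, norm_mul, pow_add]; ring
    _ ≤ _ := by
        rw [Finset.sum_mul_sum, ← Finset.sum_product', Finset.sum_sigma']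
        rw [← Finset.sum_image (s := (Finset.range N).sigma Finset.HasAntidiagonal.antidiagonal)
          (g := fun x : (_ : ℕ) × (ℕ × ℕ) => x.2)
          (f := fun p : ℕ × ℕ => (‖PowerSeries.coeff p.1 f‖ * r ^ p.1) *
            (‖PowerSeries.coeff p.2 g‖ * r ^ p.2))]
        · refine Finset.sum_le_sum_of_subset_of_nonneg ?_ fun p _ _ => by positivity
          rintro p hp
          simp only [Finset.mem_image, Finset.mem_sigma, Finset.mem_range,
            Finset.HasAntidiagonal.mem_antidiagonal] at hp
          obtain ⟨⟨n, q⟩, ⟨h1, h2⟩, rfl⟩ := hp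
          simp only [Finset.mem_product, Finset.mem_range] at h1 h2 ⊢
          omega
        · rintro ⟨n, p⟩ hp ⟨n', p'⟩ hp' (rfl : p = p')
          simp only [Finset.coe_sigma, Set.mem_sigma_iff, Finset.mem_coe,
            Finset.HasAntidiagonal.mem_antidiagonal] at hp hp'
          obtain rfl : n = n' := by omega
          rfl

theorem mul (hr : 0 ≤ r) (hf : WNormLE r f M) (hg : WNormLE r g M') :
    WNormLE r (f * g) (M * M') := fun N =>
  (sum_mul_le hr f g N).trans (mul_le_mul (hf N) (hg N)
    (Finset.sum_nonneg fun n _ => by positivity) hf.nonneg)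

theorem C (c : 𝕜) : WNormLE r (PowerSeries.C c) ‖c‖ := fun N => by
  rcases N with _ | N
  · simp
  · rw [Finset.sum_range_succ']
    simp [PowerSeries.coeff_C]

theorem one : WNormLE r (1 : PowerSeries 𝕜) 1 := by
  simpa using C (r := r) (1 : 𝕜)

theorem X (hr : 0 ≤ r) : WNormLE r (PowerSeries.X : PowerSeries 𝕜) r := fun N => by
  rcases N with _ | _ | N
  · simpa
  · simpa
  · rw [Finset.sum_range_succ', Finset.sum_range_succ']
    simp [PowerSeries.coeff_X]

theorem pow (hr : 0 ≤ r) (hf : WNormLE r f M) (k : ℕ) : WNormLE r (f ^ k) (M ^ k) := by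
  induction k with
  | zero => simpa using one
  | succ k ih => simpa [pow_succ] using ih.mul hr hf

theorem prod {ι : Type*} (hr : 0 ≤ r) (s : Finset ι) {F : ι → PowerSeries 𝕜} {B : ι → ℝ}
    (h : ∀ i ∈ s, WNormLE r (F i) (B i)) : WNormLE r (∏ i ∈ s, F i) (∏ i ∈ s, B i) := by
  classical
  induction s using Finset.induction_on with
  | empty => simpa using one
  | insert i s hi ih =>
    rw [Finset.prod_insert hi, Finset.prod_insert hi]
    exact (h i (by simp)).mul hr (ih fun j hj => h j (by simp [hj]))

theorem sum {ι : Type*} (hr : 0 ≤ r) (s : Finset ι) {F : ι → PowerSeries 𝕜} {B : ι → ℝ}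
    (h : ∀ i ∈ s, WNormLE r (F i) (B i)) : WNormLE r (∑ i ∈ s, F i) (∑ i ∈ s, B i) := by
  classical
  induction s using Finset.induction_on with
  | empty => simpa using zero
  | insert i s hi ih =>
    rw [Finset.sum_insert hi, Finset.sum_insert hi]
    exact (h i (by simp)).add hr (ih fun j hj => h j (by simp [hj]))

theorem exists_polynomial (hr : 0 ≤ r) (p : 𝕜[X]) : ∃ M, WNormLE r (p : PowerSeries 𝕜) M := by
  induction p using Polynomial.induction_on' with
  | add p q hp hq =>
    obtain ⟨M, hM⟩ := hp
    obtain ⟨M', hM'⟩ := hq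
    exact ⟨M + M', by simpa using hM.add hr hM'⟩
  | monomial n c =>
    refine ⟨‖c‖ * r ^ n, ?_⟩
    have := (C (r := r) c).mul hr ((X hr).pow hr n)
    rw [← Polynomial.C_mul_X_pow_eq_monomial]
    simpa using this

theorem summable (hr : 0 ≤ r) (hf : WNormLE r f M) :
    Summable fun n => ‖PowerSeries.coeff n f‖ * r ^ n :=
  summable_of_sum_range_le (fun n => by positivity) hf

theorem tsum_le (hr : 0 ≤ r) (hf : WNormLE r f M) :
    ∑' n, ‖PowerSeries.coeff n f‖ * r ^ n ≤ M :=
  Real.tsum_le_of_sum_range_le (fun n => by positivity) hf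

/-- Division by `X - ζ`, when `r < ‖ζ‖`. -/
theorem of_X_sub_C_mul {ζ : 𝕜} (hr : 0 ≤ r) (hζ : r < ‖ζ‖)
    (hf : WNormLE r ((PowerSeries.X - PowerSeries.C ζ) * f) M) : WNormLE r f (M / (‖ζ‖ - r)) := by
  intro N
  rw [le_div_iff₀ (by linarith)]
  -- Coefficientwise `ζ f = X f - (X - ζ) f`. After summation the `X f` term costs a factor `r <
  -- ‖ζ‖` and is absorbed on the left.
  have key : ∀ n, ‖ζ‖ * (‖PowerSeries.coeff n f‖ * r ^ n) ≤
      ‖PowerSeries.coeff n ((PowerSeries.X - PowerSeries.C ζ) * f)‖ * r ^ n +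
      ‖PowerSeries.coeff n (PowerSeries.X * f)‖ * r ^ n := fun n => by
    rw [← mul_assoc, ← norm_mul, ← add_mul]
    gcongr
    have : ζ * PowerSeries.coeff n f = PowerSeries.coeff n (PowerSeries.X * f) -
      PowerSeries.coeff n ((PowerSeries.X - PowerSeries.C ζ) * f) := by
      rw [sub_mul]; simp
    rw [this, add_comm]
    exact norm_sub_le _ _
  have h1 := Finset.sum_le_sum fun n (_ : n ∈ Finset.range N) => key n
  rw [← Finset.mul_sum, Finset.sum_add_distrib] at h1
  have h2 := sum_mul_le hr PowerSeries.X f N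
  have h3 := X (𝕜 := 𝕜) hr N
  have h4 := hf N
  have h5 : 0 ≤ ∑ n ∈ Finset.range N, ‖PowerSeries.coeff n f‖ * r ^ n :=
    Finset.sum_nonneg fun n _ => by positivity
  have h6 := mul_le_mul_of_nonneg_right h3 h5
  linarith

/-- Division by `X - ζ`, when `‖ζ‖ < r` and the quotient is known to have a finite norm. -/
theorem of_X_sub_C_mul' {ζ : 𝕜} (hr : 0 ≤ r) (hζ : ‖ζ‖ < r)
    (hf : WNormLE r ((PowerSeries.X - PowerSeries.C ζ) * f) M) (hf' : WNormLE r f M') :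
    WNormLE r f (M / (r - ‖ζ‖)) := by
  have key : ∀ N, r * ∑ n ∈ Finset.range N, ‖PowerSeries.coeff n f‖ * r ^ n ≤
      M + ‖ζ‖ * ∑' n, ‖PowerSeries.coeff n f‖ * r ^ n := fun N => by
    have h1 : r * ∑ n ∈ Finset.range N, ‖PowerSeries.coeff n f‖ * r ^ n =
        ∑ n ∈ Finset.range (N + 1), ‖PowerSeries.coeff n (PowerSeries.X * f)‖ * r ^ n := by
      rw [Finset.sum_range_succ', Finset.mul_sum]
      simp only [PowerSeries.coeff_succ_X_mul]
      simp [pow_succ]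
      exact Finset.sum_congr rfl fun _ _ => by ring
    have h2 : ∀ n, ‖PowerSeries.coeff n (PowerSeries.X * f)‖ * r ^ n ≤
      ‖PowerSeries.coeff n ((PowerSeries.X - PowerSeries.C ζ) * f)‖ * r ^ n +
        ‖ζ‖ * (‖PowerSeries.coeff n f‖ * r ^ n) := fun n => by
      rw [← mul_assoc, ← norm_mul, ← add_mul]
      gcongr
      have : PowerSeries.coeff n (PowerSeries.X * f) =
        PowerSeries.coeff n ((PowerSeries.X - PowerSeries.C ζ) * f) +
          ζ * PowerSeries.coeff n f := by
        rw [sub_mul]; simp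
      rw [this]
      exact norm_add_le _ _
    rw [h1]
    refine (Finset.sum_le_sum fun n _ => h2 n).trans ?_
    rw [Finset.sum_add_distrib, ← Finset.mul_sum]
    gcongr
    · exact hf _
    · exact (hf'.summable hr).sum_le_tsum _ fun n _ => by positivity
  intro N
  -- In the limit the full sum `S` satisfies `r S ≤ M + ‖ζ‖ S`. Here the a priori finiteness of `S`
  -- is needed to move `‖ζ‖ S` to the left.
  have h1 := le_of_tendsto' ((hf'.summable hr).hasSum.tendsto_sum_nat.const_mul r) key
  rw [le_div_iff₀ (by linarith)]
  have h2 := (hf'.summable hr).sum_le_tsum (Finset.range N) fun n _ => by positivity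
  nlinarith

/-- Division by `1 - e`, when `e` is small. -/
theorem of_one_sub_mul {e : PowerSeries 𝕜} (hr : 0 ≤ r) (he : WNormLE r e (1 / 2))
    (hf : WNormLE r (f * (1 - e)) M) : WNormLE r f (2 * M) := by
  intro N
  have h1 : ∀ n, ‖PowerSeries.coeff n f‖ * r ^ n ≤ ‖PowerSeries.coeff n (f * (1 - e))‖ * r ^ n +
      ‖PowerSeries.coeff n (f * e)‖ * r ^ n := fun n => by
    rw [← add_mul]
    gcongr
    have : PowerSeries.coeff n f =
        PowerSeries.coeff n (f * (1 - e)) + PowerSeries.coeff n (f * e) := by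
      rw [← map_add]; ring_nf
    rw [this]
    exact norm_add_le _ _
  have h2 := Finset.sum_le_sum fun n (_ : n ∈ Finset.range N) => h1 n
  rw [Finset.sum_add_distrib] at h2
  have h3 := sum_mul_le hr f e N
  have h5 : 0 ≤ ∑ n ∈ Finset.range N, ‖PowerSeries.coeff n f‖ * r ^ n :=
    Finset.sum_nonneg fun n _ => by positivity
  have h6 := mul_le_mul_of_nonneg_left (he N) h5
  have h7 := hf N
  linarith

end WNormLE

/-! ### Values of power series, simple poles and inverses of polynomials -/

/-- The value at `z` of a real power series. -/
noncomputable def psEval {𝕜 : Type*} [RCLike 𝕜] (f : PowerSeries ℝ) (z : 𝕜) : 𝕜 :=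
  ∑' n, algebraMap ℝ 𝕜 (PowerSeries.coeff n f) * z ^ n

section psEval

variable {𝕜 : Type*} [RCLike 𝕜] {r M M' : ℝ} {f g : PowerSeries ℝ} {z : 𝕜}

theorem WNormLE.summable_norm_eval (hf : WNormLE r f M) (hz : ‖z‖ ≤ r) :
    Summable fun n => ‖algebraMap ℝ 𝕜 (PowerSeries.coeff n f) * z ^ n‖ :=
  (hf.summable ((norm_nonneg z).trans hz)).of_nonneg_of_le (fun n => norm_nonneg _) fun n => by
    rw [norm_mul, norm_algebraMap', norm_pow]
    gcongr

theorem WNormLE.hasSum_psEval (hf : WNormLE r f M) (hz : ‖z‖ ≤ r) :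
    HasSum (fun n => algebraMap ℝ 𝕜 (PowerSeries.coeff n f) * z ^ n) (psEval f z) := by
  have h : Summable fun n => algebraMap ℝ 𝕜 (PowerSeries.coeff n f) * z ^ n :=
    Summable.of_norm (hf.summable_norm_eval hz)
  exact h.hasSum

theorem WNormLE.norm_psEval_le (hf : WNormLE r f M) (hz : ‖z‖ ≤ r) : ‖psEval f z‖ ≤ M := by
  have h := hf.summable_norm_eval (𝕜 := 𝕜) hz
  have hr := (norm_nonneg z).trans hz
  refine (norm_tsum_le_tsum_norm h).trans ((h.tsum_le_tsum (fun n => ?_)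
    (hf.summable hr)).trans (hf.tsum_le hr))
  rw [norm_mul, norm_algebraMap', norm_pow]
  gcongr

theorem WNormLE.psEval_mul (hf : WNormLE r f M) (hg : WNormLE r g M') (hz : ‖z‖ ≤ r) :
    psEval (f * g) z = psEval f z * psEval g z := by
  have h := tsum_mul_tsum_eq_tsum_sum_antidiagonal_of_summable_norm
    (hf.summable_norm_eval (𝕜 := 𝕜) hz) (hg.summable_norm_eval (𝕜 := 𝕜) hz)
  refine Eq.trans (tsum_congr fun n => ?_) h.symm
  rw [PowerSeries.coeff_mul, map_sum, Finset.sum_mul]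
  refine Finset.sum_congr rfl fun p hp => ?_
  rw [← Finset.HasAntidiagonal.mem_antidiagonal.1 hp, map_mul, pow_add]
  ring

theorem psEval_coe (p : ℝ[X]) (z : 𝕜) : psEval (p : PowerSeries ℝ) z = aeval z p := by
  unfold psEval
  rw [tsum_eq_sum (s := Finset.range (p.natDegree + 1)), aeval_eq_sum_range]
  · simp [Algebra.smul_def]
  · intro n hn
    rw [Polynomial.coeff_coe, Polynomial.coeff_eq_zero_of_natDegree_lt (by simpa using hn)]
    simp

theorem WNormLE.norm_aeval_le {p : ℝ[X]} (hp : WNormLE r (p : PowerSeries ℝ) M) (hz : ‖z‖ ≤ r) :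
    ‖aeval z p‖ ≤ M := psEval_coe p z ▸ hp.norm_psEval_le hz

theorem psEval_sub (hf : WNormLE r f M) (hg : WNormLE r g M') (hz : ‖z‖ ≤ r) :
    psEval (f - g) z = psEval f z - psEval g z := by
  refine HasSum.unique (hf.sub ((norm_nonneg z).trans hz) hg |>.hasSum_psEval hz) ?_
  convert! (hf.hasSum_psEval hz).sub (hg.hasSum_psEval hz) using 2 with n
  simp [sub_mul]

end psEval

/-- The coefficients of `H(z) / (ζ - z)`. -/
theorem abs_coeff_sub_le {G H : PowerSeries ℝ} {r M ζ : ℝ} (hζ : 0 < ζ) (hr : ζ ≤ r)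
    (h : G * (PowerSeries.C ζ - PowerSeries.X) = H) (hH : WNormLE r H M) (n : ℕ) :
    |PowerSeries.coeff n G - (ζ ^ (n + 1))⁻¹ * psEval H ζ| ≤ M * (r ^ (n + 1))⁻¹ := by
  have hr0 : 0 < r := hζ.trans_le hr
  have hz : ‖ζ‖ ≤ r := by rwa [Real.norm_of_nonneg hζ.le]
  -- The recursion `H_n = ζ G_n - G_(n-1)` telescopes, so each coefficient of `G` is a partial sum
  -- of `H(ζ)`. The error is the missing tail.
  have h1 : ∀ n, ζ ^ (n + 1) * PowerSeries.coeff n G =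
      ∑ j ∈ Finset.range (n + 1), PowerSeries.coeff j H * ζ ^ j := by
    intro n
    induction n with
    | zero => rw [← h]; simp [mul_sub, mul_comm]
    | succ n ih =>
      rw [Finset.sum_range_succ, ← ih, ← h]
      simp [mul_sub, PowerSeries.coeff_succ_mul_X]
      ring
  have h2 := hH.hasSum_psEval hz
  have h3 := h2.summable.sum_add_tsum_nat_add (n + 1)
  have h4 : PowerSeries.coeff n G - (ζ ^ (n + 1))⁻¹ * psEval H ζ =
      -((ζ ^ (n + 1))⁻¹ * ∑' j, PowerSeries.coeff (j + (n + 1)) H * ζ ^ (j + (n + 1))) := by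
    have h5 : psEval H ζ = ζ ^ (n + 1) * PowerSeries.coeff n G +
        ∑' j, PowerSeries.coeff (j + (n + 1)) H * ζ ^ (j + (n + 1)) := by
      rw [h1]; exact h3.symm
    rw [h5]; field_simp; ring
  rw [h4, abs_neg, abs_mul, abs_of_pos (by positivity : 0 < (ζ ^ (n + 1))⁻¹)]
  have hs := hH.summable hr0.le
  have hs' := (summable_nat_add_iff (n + 1)).2 hs
  -- All exponents in the tail are at least `n + 1`, so passing from radius `r` to `ζ` gains the
  -- factor `(ζ/r)^(n+1)`.
  have h6 : |∑' j, PowerSeries.coeff (j + (n + 1)) H * ζ ^ (j + (n + 1))| ≤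
      (ζ / r) ^ (n + 1) * M := by
    have hb : ∀ j, ‖PowerSeries.coeff (j + (n + 1)) H * ζ ^ (j + (n + 1))‖ ≤
        (ζ / r) ^ (n + 1) * (‖PowerSeries.coeff (j + (n + 1)) H‖ * r ^ (j + (n + 1))) := fun j => by
      rw [norm_mul, norm_pow, Real.norm_of_nonneg hζ.le, div_pow, pow_add, pow_add]
      have : ζ ^ j ≤ r ^ j := by gcongr
      calc _ = ‖PowerSeries.coeff (j + (n + 1)) H‖ * ζ ^ j * ζ ^ (n + 1) := by ring
        _ ≤ ‖PowerSeries.coeff (j + (n + 1)) H‖ * r ^ j * ζ ^ (n + 1) := by gcongr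
        _ = _ := by field_simp; ring
    refine (tsum_of_norm_bounded (hs'.mul_left _).hasSum hb).trans ?_
    rw [tsum_mul_left]
    gcongr
    refine le_trans ?_ (hH.tsum_le hr0.le)
    rw [← hs.sum_add_tsum_nat_add (n + 1)]
    exact le_add_of_nonneg_left (Finset.sum_nonneg fun i _ => by positivity)
  calc _ ≤ (ζ ^ (n + 1))⁻¹ * ((ζ / r) ^ (n + 1) * M) := by gcongr
    _ = _ := by rw [div_pow]; field_simp

/-- The inverse of a polynomial without zeros in the closed unit disc has finite norm
for some radius `> 1`. -/
theorem exists_inverse_wNormLE {s : ℝ[X]} (hs : ∀ z : ℂ, ‖z‖ ≤ 1 → aeval z s ≠ 0) :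
    ∃ u : PowerSeries ℝ, (s : PowerSeries ℝ) * u = 1 ∧ ∃ r > 1, ∃ U, WNormLE r u U := by
  have h0 : s.coeff 0 ≠ 0 := by
    have := hs 0 (by simp)
    rw [← Polynomial.coeff_zero_eq_aeval_zero'] at this
    simpa using this
  have hs0 : s ≠ 0 := by rintro rfl; simp at h0
  refine ⟨(s : PowerSeries ℝ)⁻¹, PowerSeries.mul_inv_cancel _ (by simpa using h0), ?_⟩
  set u := (s : PowerSeries ℝ)⁻¹
  have hu : (s : PowerSeries ℝ) * u = 1 := PowerSeries.mul_inv_cancel _ (by simpa using h0)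
  set q : ℂ[X] := s.map (algebraMap ℝ ℂ)
  have hq0 : q ≠ 0 := by
    simpa [q, Polynomial.map_eq_zero_iff (algebraMap ℝ ℂ).injective] using hs0
  obtain ⟨r, hr1, hr⟩ : ∃ r > (1 : ℝ), ∀ x ∈ q.roots, r < ‖x‖ := by
    have h1 : ∀ x ∈ q.roots.toFinset, (1 : ℝ) < ‖x‖ := by
      intro x hx
      by_contra! hx1
      apply hs x hx1
      have := (Polynomial.mem_roots hq0).1 (Multiset.mem_toFinset.1 hx)
      rw [Polynomial.IsRoot, Polynomial.eval_map_algebraMap] at this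
      exact this
    have : ∀ᶠ r in 𝓝[>] (1 : ℝ), ∀ x ∈ q.roots.toFinset, r < ‖x‖ := by
      rw [Filter.eventually_all_finset]
      exact fun x hx => nhdsWithin_le_nhds (eventually_lt_nhds (h1 x hx))
    obtain ⟨r, hr, hr'⟩ := (this.and self_mem_nhdsWithin).exists
    exact ⟨r, hr', fun x hx => hr x (Multiset.mem_toFinset.2 hx)⟩
  refine ⟨r, hr1, ?_⟩
  have hr0 : 0 ≤ r := by linarith
  -- Linear factors are stripped off one at a time; every root lies outside the disc of radius `r`,
  -- so each division preserves finiteness of the norm.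
  have main : ∀ S : Multiset ℂ, (∀ x ∈ S, r < ‖x‖) → ∀ f : PowerSeries ℂ, ∀ M,
      WNormLE r (((S.map fun x => X - C x).prod : ℂ[X]) * f : PowerSeries ℂ) M →
      ∃ U, WNormLE r f U := by
    intro S
    induction S using Multiset.induction_on with
    | empty => intro _ f M h; exact ⟨M, by simpa using h⟩
    | cons x S ih =>
      intro hS f M h
      have h' : WNormLE r ((PowerSeries.X - PowerSeries.C x) *
          ((((S.map fun x => X - C x).prod : ℂ[X]) : PowerSeries ℂ) * f)) M := by
        convert h using 1
        simp [mul_assoc]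
      exact ih (fun y hy => hS y (by simp [hy])) f _
        (h'.of_X_sub_C_mul hr0 (hS x (by simp)))
  have hqu : (q : PowerSeries ℂ) * PowerSeries.map (algebraMap ℝ ℂ) u = 1 := by
    have := congrArg (PowerSeries.map (algebraMap ℝ ℂ)) hu
    rw [map_mul, map_one] at this
    rw [← this]
    congr 1
    ext n
    simp [q]
  have hfac := (IsAlgClosed.splits q).eq_prod_roots
  have hlead : q.leadingCoeff ≠ 0 := by simpa using hq0
  obtain ⟨U, hU⟩ := main q.roots hr (PowerSeries.map (algebraMap ℝ ℂ) u) ‖q.leadingCoeff⁻¹‖ (by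
    convert WNormLE.C (r := r) q.leadingCoeff⁻¹ using 1
    have h1 : (q : PowerSeries ℂ) = PowerSeries.C q.leadingCoeff *
        ((q.roots.map fun x => X - C x).prod : ℂ[X]) := by
      conv_lhs => rw [hfac]
      simp
    rw [h1] at hqu
    calc _ = PowerSeries.C q.leadingCoeff⁻¹ * (PowerSeries.C q.leadingCoeff *
        ((q.roots.map fun x => X - C x).prod : ℂ[X]) * PowerSeries.map (algebraMap ℝ ℂ) u) := by
          rw [← mul_assoc, ← mul_assoc, ← map_mul, inv_mul_cancel₀ hlead]; simp
      _ = _ := by rw [hqu, mul_one])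
  refine ⟨U, fun N => ?_⟩
  simpa using hU N

/-! ### Size of the perturbing terms -/

section perturb

variable {n : ℕ} {a : Fin (n + 2) → ℝ}

theorem wNormLE_perturb {m : ℕ} {t : ℝ} (ht : 0 ≤ t) (a : Fin m → ℝ) (k : ℕ) (j : Fin m) :
    WNormLE t (perturb a k j : PowerSeries ℝ) ((t / |a j|) ^ k) := by
  have := (((WNormLE.C (r := t) (a j)⁻¹).mul ht (WNormLE.X ht)).pow ht k)
  rw [norm_inv, Real.norm_eq_abs, inv_mul_eq_div] at this
  simpa [perturb] using this

/-- A bound for a polynomial in the `(z / a_j) ^ k` by a bound for its monomials. -/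
theorem exists_wNormLE_eval_perturb {m : ℕ} {r : ℝ} (hr : 0 ≤ r) (a : Fin m → ℝ)
    (p : MvPolynomial (Fin m) ℝ[X]) :
    ∃ A, 0 ≤ A ∧ ∀ t, 0 ≤ t → t ≤ r → ∀ k (B : ℝ),
      (∀ d ∈ p.support, ∏ j, ((t / |a j|) ^ k) ^ d j ≤ B) →
      WNormLE t (MvPolynomial.eval (perturb a k) p : PowerSeries ℝ) (A * B) := by
  choose N hN using fun q : ℝ[X] => WNormLE.exists_polynomial hr q
  refine ⟨∑ d ∈ p.support, N (p.coeff d), Finset.sum_nonneg fun d _ => (hN _).nonneg,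
    fun t ht htr k B hB => ?_⟩
  rw [MvPolynomial.eval_eq, Finset.sum_mul,
    ← Polynomial.coeToPowerSeries.ringHom_apply, map_sum]
  refine WNormLE.sum ht _ fun d hd => ?_
  rw [map_mul, map_prod]
  refine (((hN (p.coeff d)).mono_radius ht htr).mul ht (WNormLE.prod ht _ fun j _ => ?_)).mono
    (mul_le_mul_of_nonneg_left ((Finset.prod_subset (Finset.subset_univ d.support) ?_).trans_le
      (hB d hd)) (hN _).nonneg)
  · rw [map_pow]
    exact (wNormLE_perturb ht a k j).pow ht _
  · intro j _ hj
    rw [Finsupp.notMem_support_iff.1 hj, pow_zero]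

theorem SummandsDivisible₂.summandsDivisible₁ {p : MvPolynomial (Fin (n + 2)) ℝ[X]}
    (hp : SummandsDivisible₂ p) : SummandsDivisible₁ p := fun d hd => by
  rcases hp d hd with h | ⟨j, -, h⟩
  · exact ⟨0, by omega⟩
  · exact ⟨j, h⟩

theorem prod_pow_le_of_factor {m : ℕ} {y : Fin m → ℝ} (h0 : ∀ j, 0 ≤ y j) (h1 : ∀ j, y j ≤ 1)
    {d : Fin m → ℕ} {e : ℕ} {j : Fin m} (hj : e ≤ d j) : ∏ i, y i ^ d i ≤ y j ^ e := by
  classical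
  rw [← Finset.mul_prod_erase _ _ (Finset.mem_univ j)]
  calc _ ≤ y j ^ d j * 1 := by
        refine mul_le_mul_of_nonneg_left (Finset.prod_le_one (fun i _ => pow_nonneg (h0 i) _)
          fun i _ => pow_le_one₀ (h0 i) (h1 i)) (pow_nonneg (h0 j) _)
    _ ≤ _ := by rw [mul_one]; exact pow_le_pow_of_le_one (h0 j) (h1 j) hj

theorem le_abs_of_mono (ha_lt : a 0 < |a 1|)
    (ha_mono : ∀ i j, 1 ≤ i → i ≤ j → |a i| ≤ |a j|) (j : Fin (n + 2)) :
    a 0 ≤ |a j| ∧ (j ≠ 0 → |a 1| ≤ |a j|) := by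
  have h : j ≠ 0 → |a 1| ≤ |a j| := fun hj =>
    ha_mono 1 j le_rfl (by
      have := Fin.pos_iff_ne_zero.2 hj
      rw [Fin.lt_def] at this
      rw [Fin.le_def]
      exact this)
  refine ⟨?_, h⟩
  by_cases hj : j = 0
  · rw [hj]; exact le_abs_self _
  · exact ha_lt.le.trans (h hj)

theorem exists_wNormLE_of_summandsDivisible₁ {r : ℝ} (hr : 0 ≤ r) (ha : 0 < a 0) (hra : r ≤ a 0)
    (haj : ∀ j, a 0 ≤ |a j|) {p : MvPolynomial (Fin (n + 2)) ℝ[X]} (hp : SummandsDivisible₁ p) :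
    ∃ A, 0 ≤ A ∧ ∀ t, 0 ≤ t → t ≤ r → ∀ k,
      WNormLE t (MvPolynomial.eval (perturb a k) p : PowerSeries ℝ) (A * (t / a 0) ^ k) := by
  obtain ⟨A, hA, h⟩ := exists_wNormLE_eval_perturb hr a p
  refine ⟨A, hA, fun t ht htr k => h t ht htr k _ fun d hd => ?_⟩
  obtain ⟨j, hj⟩ := hp d hd
  have hj0 : ∀ j, 0 < |a j| := fun j => ha.trans_le (haj j)
  refine (prod_pow_le_of_factor (fun j => by positivity) (fun j => pow_le_one₀ (by positivity)
    ((div_le_one (hj0 j)).2 ((htr.trans hra).trans (haj j)))) hj).trans ?_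
  rw [pow_one]
  gcongr
  exact haj j

/-- A factor `y₁²` contributes `(t²/a²)^k`, and a factor `y_j` with `j ≠ 1` contributes
`(t/|a_j|)^k`, which is at most `(t²/|a₂|)^k` because `t ≥ 1`. One base covers both cases. -/
theorem exists_wNormLE_of_summandsDivisible₂ {r : ℝ} (hr : 0 ≤ r) (ha : 0 < a 0) (hra : r ≤ a 0)
    (haj : ∀ j, a 0 ≤ |a j|) (haj' : ∀ j, j ≠ 0 → |a 1| ≤ |a j|)
    {p : MvPolynomial (Fin (n + 2)) ℝ[X]} (hp : SummandsDivisible₂ p) :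
    ∃ A, 0 ≤ A ∧ ∀ t, 1 ≤ t → t ≤ r → ∀ k,
      WNormLE t (MvPolynomial.eval (perturb a k) p : PowerSeries ℝ)
        (A * (t ^ 2 / min |a 1| (a 0 ^ 2)) ^ k) := by
  obtain ⟨A, hA, h⟩ := exists_wNormLE_eval_perturb hr a p
  have hj0 : ∀ j, 0 < |a j| := fun j => ha.trans_le (haj j)
  have hb : 0 < min |a 1| (a 0 ^ 2) := lt_min (hj0 1) (by positivity)
  refine ⟨A, hA, fun t ht htr k => h t (by linarith) htr k _ fun d hd => ?_⟩
  have ht0 : 0 ≤ t := by linarith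
  have key : ∀ {j e}, e ≤ d j → ∏ i, ((t / |a i|) ^ k) ^ d i ≤ ((t / |a j|) ^ k) ^ e :=
    fun {j e} hj => prod_pow_le_of_factor (fun j => by positivity) (fun j => pow_le_one₀
      (by positivity) ((div_le_one (hj0 j)).2 ((htr.trans hra).trans (haj j)))) hj
  rcases hp d hd with hj | ⟨j, hj, hj1⟩
  · refine (key hj).trans ?_
    rw [← pow_mul, mul_comm, pow_mul, abs_of_pos ha, div_pow]
    gcongr
    exact min_le_right _ _
  · refine (key hj1).trans ?_
    rw [pow_one]
    gcongr
    · nlinarith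
    · exact (min_le_left _ _).trans (haj' j hj)

end perturb

/-! ### The zero of the denominator near `1` and its contribution -/

theorem exists_abs_eval_le (p : ℝ[X]) : ∃ Q, 0 ≤ Q ∧ ∀ x ∈ Set.Icc (0 : ℝ) 2, |p.eval x| ≤ Q := by
  obtain ⟨Q, hQ⟩ := isCompact_Icc.exists_bound_of_continuousOn (s := Set.Icc (0 : ℝ) 2)
    p.continuous.continuousOn
  exact ⟨Q, (abs_nonneg _).trans (hQ 0 (by simp)), hQ⟩

theorem exists_abs_eval_le_of_root {p : ℝ[X]} (hp : p.eval 1 = 0) :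
    ∃ Q, 0 ≤ Q ∧ ∀ x ∈ Set.Icc (0 : ℝ) 2, |p.eval x| ≤ Q * |x - 1| := by
  obtain ⟨q, rfl⟩ := Polynomial.dvd_iff_isRoot.2 (show p.IsRoot 1 from hp)
  obtain ⟨Q, hQ0, hQ⟩ := exists_abs_eval_le q
  refine ⟨Q, hQ0, fun x hx => ?_⟩
  rw [eval_mul, abs_mul, mul_comm]
  have := hQ x hx
  simp only [eval_sub, eval_X, eval_C]
  gcongr

/-- The radius `1 + 1/k` is a compromise: `t^k` stays bounded, so perturbations keep their size
`a^(-k)` or `b^(-k)` there, while a gap of order `1/k` remains for dividing by `X - ζ`. -/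
theorem one_add_inv_pow_le (k : ℕ) : (1 + 1 / (k : ℝ)) ^ k ≤ 3 := by
  rcases Nat.eq_zero_or_pos k with rfl | hk
  · norm_num
  have hk' : (0 : ℝ) < k := by exact_mod_cast hk
  calc (1 + 1 / (k : ℝ)) ^ k ≤ Real.exp (1 / k) ^ k := by
        gcongr; rw [add_comm]; exact Real.add_one_le_exp _
    _ = Real.exp 1 := by rw [← Real.exp_nat_mul]; congr 1; field_simp
    _ ≤ 3 := Real.exp_one_lt_three.le

theorem tendsto_const_div_pow {a : ℝ} (ha : 1 < a) (A : ℝ) :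
    Tendsto (fun k : ℕ => A / a ^ k) atTop (𝓝 0) :=
  tendsto_const_nhds.div_atTop (tendsto_pow_atTop_atTop_of_one_lt ha)

theorem eventually_const_div_pow_le {a : ℝ} (ha : 1 < a) (A : ℝ) :
    ∀ᶠ k : ℕ in atTop, A / a ^ k ≤ 1 / (2 * k) := by
  have h : Tendsto (fun k : ℕ => (2 * A) * ((k : ℝ) ^ 1 / a ^ k)) atTop (𝓝 ((2 * A) * 0)) :=
    (tendsto_pow_const_div_const_pow_of_one_lt 1 ha).const_mul _
  rw [mul_zero] at h
  filter_upwards [h.eventually_le_const one_pos, eventually_gt_atTop 0] with k hk hk0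
  have hk' : (0 : ℝ) < k := by exact_mod_cast hk0
  rw [le_div_iff₀ (by positivity)]
  convert hk using 1
  ring

/-- The zero of the denominator near `1`. -/
theorem exists_root_near_one {a r C : ℝ} (ha : 1 < a) (hr : 1 < r) (s : ℝ[X]) (hs : s.eval 1 ≠ 0)
    (D : ℕ → ℝ[X]) (hC : 0 ≤ C)
    (hD : ∀ t, 1 ≤ t → t ≤ r → ∀ k, WNormLE t (D k : PowerSeries ℝ) (C * (t / a) ^ k)) :
    ∃ A, 0 < A ∧ ∀ᶠ k : ℕ in atTop, ∃ ζ : ℝ, |ζ - 1| ≤ A / a ^ k ∧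
      ((1 - X) * s + D k).eval ζ = 0 := by
  set m := |s.eval 1| with hm
  have hm0 : 0 < m := abs_pos.2 hs
  refine ⟨6 * C / m + 1, by positivity, ?_⟩
  -- `6C/m` makes the main term `η m²/2` at the endpoints `1 ± η` dominate the perturbation
  -- `3Cm/a^k`; the summand `1` keeps `A` positive when `C = 0`.
  set A := 6 * C / m + 1 with hA
  have hA0 : 0 < A := by positivity
  have h1 : ∀ᶠ x in 𝓝 (1 : ℝ), m ^ 2 / 2 < s.eval 1 * s.eval x := by
    have hc : Tendsto (fun x => s.eval 1 * s.eval x) (𝓝 1) (𝓝 (s.eval 1 * s.eval 1)) :=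
      (s.continuous.tendsto 1).const_mul _
    refine hc.eventually_const_lt ?_
    rw [hm, sq_abs]
    have := sq_pos_of_ne_zero hs
    nlinarith
  obtain ⟨ε, hε, h1⟩ := Metric.eventually_nhds_iff.1 h1
  have h2 : ∀ᶠ k : ℕ in atTop, 1 / (k : ℝ) < r - 1 :=
    tendsto_one_div_atTop_nhds_zero_nat.eventually_lt_const (by linarith)
  filter_upwards [eventually_const_div_pow_le ha A,
    (tendsto_const_div_pow ha A).eventually_lt_const hε, h2, eventually_gt_atTop 0]
    with k hk1 hk2 hk3 hk0
  have hk0' : (1 : ℝ) ≤ k := by exact_mod_cast hk0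
  set η := A / a ^ k with hη
  have ha0 : 0 < a := by linarith
  have hη0 : 0 < η := by positivity
  have hη1 : η ≤ 1 / k := hk1.trans (by gcongr; linarith)
  have hη2 : η ≤ 1 := hη1.trans (by rw [div_le_one (by linarith)]; exact hk0')
  have hDx : ∀ x, 0 ≤ x → x ≤ 1 + η → |(D k).eval x| ≤ 3 * C / a ^ k := fun x hx0 hx => by
    have ht : (1 : ℝ) ≤ 1 + 1 / k := by have := hη0.trans_le hη1; linarith
    have := (hD (1 + 1 / k) ht (by linarith) k).norm_aeval_le (z := x)
      (by rw [Real.norm_of_nonneg hx0]; linarith)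
    rw [Polynomial.coe_aeval_eq_eval, Real.norm_eq_abs] at this
    refine this.trans ?_
    rw [div_pow, mul_div_assoc']
    rw [mul_comm 3 C]
    gcongr
    exact one_add_inv_pow_le k
  have hbig : m * (3 * C / a ^ k) ≤ η * (m ^ 2 / 2) := by
    rw [hη, hA]
    have : (6 * C / m + 1) / a ^ k * (m ^ 2 / 2) = m * (3 * C / a ^ k) + m ^ 2 / 2 / a ^ k := by
      field_simp; ring
    rw [this]
    have : 0 ≤ m ^ 2 / 2 / a ^ k := by positivity
    linarith
  have hmD : ∀ x, 0 ≤ x → x ≤ 1 + η → |s.eval 1 * (D k).eval x| ≤ m * (3 * C / a ^ k) :=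
    fun x h0 h => by rw [abs_mul]; gcongr; exact hDx x h0 h
  -- Multiplying by `s(1)` makes the factor `s(1) s(x)` positive near `1`, so the sign change for
  -- the intermediate value theorem does not depend on the sign of `s(1)`.
  set g : ℝ → ℝ := fun x => s.eval 1 * ((1 - X) * s + D k).eval x with hg
  have hgc : ContinuousOn g (Set.Icc (1 - η) (1 + η)) :=
    (continuous_const.mul (Polynomial.continuous _)).continuousOn
  have hgx : ∀ x, g x = (1 - x) * (s.eval 1 * s.eval x) + s.eval 1 * (D k).eval x := fun x => by
    simp [hg]; ring
  have hleft : 0 ≤ g (1 - η) := by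
    rw [hgx]
    have h3 := h1 (y := 1 - η) (by rw [Real.dist_eq]; simpa [abs_of_pos hη0] using hk2)
    have h4 := (abs_le.1 (hmD (1 - η) (by linarith) (by linarith))).1
    have := mul_le_mul_of_nonneg_left h3.le hη0.le
    nlinarith
  have hright : g (1 + η) ≤ 0 := by
    rw [hgx]
    have h3 := h1 (y := 1 + η) (by rw [Real.dist_eq]; simpa [abs_of_pos hη0] using hk2)
    have h4 := (abs_le.1 (hmD (1 + η) (by linarith) (by linarith))).2
    have := mul_le_mul_of_nonneg_left h3.le hη0.le
    nlinarith
  obtain ⟨ζ, hζ, hζ0⟩ := intermediate_value_Icc' (by linarith : 1 - η ≤ 1 + η) hgc ⟨hright, hleft⟩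
  refine ⟨ζ, abs_le.2 ⟨by linarith [hζ.1], by linarith [hζ.2]⟩, ?_⟩
  exact (mul_eq_zero.1 hζ0).resolve_left hs

/-- Splitting off the zero `ζ` of the denominator `(1 - X) s + D`. -/
theorem exists_quotient {r U ζ : ℝ} {s D : ℝ[X]} {u : PowerSeries ℝ}
    (hu : (s : PowerSeries ℝ) * u = 1) (hU : WNormLE r u U)
    (hζ : ((1 - X) * s + D).eval ζ = 0) :
    ∃ e : PowerSeries ℝ,
      (((1 - X) * s + D : ℝ[X]) : PowerSeries ℝ) * u =
        (PowerSeries.X - PowerSeries.C ζ) * (e - 1) ∧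
      ∀ t B, |ζ| < t → t ≤ r → WNormLE t (D : PowerSeries ℝ) B →
        WNormLE t e ((B * U + |1 - ζ|) / (t - |ζ|)) := by
  obtain ⟨T, hT⟩ := Polynomial.dvd_iff_isRoot.2 hζ
  have hT' : (((1 - X) * s + D : ℝ[X]) : PowerSeries ℝ) =
      (PowerSeries.X - PowerSeries.C ζ) * (T : PowerSeries ℝ) := by
    rw [hT]; simp
  refine ⟨T * u + 1, by rw [hT']; ring, fun t B htζ htr hB => ?_⟩
  have ht : 0 ≤ t := (abs_nonneg _).trans htζ.le
  have hUt := hU.mono_radius ht htr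
  obtain ⟨N, hN⟩ := WNormLE.exists_polynomial ht T
  refine WNormLE.of_X_sub_C_mul' ht htζ ?_ ((hN.mul ht hUt).add ht WNormLE.one)
  -- Without the perturbation, with `ζ = 1`, the quotient times `u` would be exactly `-1`. Hence the
  -- deviation `e = T u + 1`, multiplied by `X - ζ`, consists only of the small terms `D u` and `1 -
  -- ζ`.
  have hcalc : (PowerSeries.X - PowerSeries.C ζ) * ((T : PowerSeries ℝ) * u + 1) =
      (D : PowerSeries ℝ) * u + PowerSeries.C (1 - ζ) := by
    have h1 : (((1 - X) * s + D : ℝ[X]) : PowerSeries ℝ) =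
        (1 - PowerSeries.X) * (s : PowerSeries ℝ) + (D : PowerSeries ℝ) := by simp
    rw [h1] at hT'
    rw [mul_add, ← mul_assoc, ← hT', map_sub, map_one]
    linear_combination (1 - PowerSeries.X) * hu
  rw [hcalc]
  exact (hB.mul ht hUt).add ht (WNormLE.C _)

set_option maxHeartbeats 1600000 in
/-- Contribution of the dominant pole to the coefficients of `G_k`. -/
theorem eventually_coeff_pole {a b r U C C₃ : ℝ} (ha : 1 < a) (hr : 1 < r) (hra : r < a)
    (hb : 1 < b) (hba : b ≤ a ^ 2) {r₀ s₀ s₁ : ℝ[X]} {u : PowerSeries ℝ}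
    (hu : (s₀ : PowerSeries ℝ) * u = 1) (hU : WNormLE r u U) (hs₀ : s₀.eval 1 ≠ 0)
    (D N E : ℕ → ℝ[X]) (hC : 0 ≤ C) (hC₃ : 0 ≤ C₃)
    (hD : ∀ t, 1 ≤ t → t ≤ r → ∀ k, WNormLE t (D k : PowerSeries ℝ) (C * (t / a) ^ k))
    (hN : ∀ t, 1 ≤ t → t ≤ r → ∀ k, WNormLE t (N k : PowerSeries ℝ) (C * (t / a) ^ k))
    (hE : ∀ t, 1 ≤ t → t ≤ r → ∀ k, WNormLE t (E k : PowerSeries ℝ) (C₃ * (t ^ 2 / b) ^ k))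
    (hDE : ∀ k x, (D k).eval x = (x / a) ^ k * s₁.eval x + (E k).eval x)
    (G : ℕ → PowerSeries ℝ)
    (hG : ∀ k, G k * (((1 - X) * s₀ + D k : ℝ[X]) : PowerSeries ℝ) =
      ((r₀ + N k : ℝ[X]) : PowerSeries ℝ)) :
    ∃ A, 0 ≤ A ∧ ∀ᶠ k : ℕ in atTop, ∃ ζ h : ℝ, |ζ - 1| ≤ A / a ^ k ∧
      |ζ - 1 - s₁.eval 1 / s₀.eval 1 / a ^ k| ≤ A * k / b ^ k ∧
      |h - r₀.eval 1 / s₀.eval 1| ≤ A * k / a ^ k ∧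
      ∀ ℓ, |PowerSeries.coeff ℓ (G k) - (ζ ^ (ℓ + 1))⁻¹ * h| ≤ A * (r ^ (ℓ + 1))⁻¹ := by
  have ha0 : 0 < a := by linarith
  have hr0 : 0 ≤ r := by linarith
  have hb0 : 0 < b := by linarith
  have hU0 := hU.nonneg
  set c := r₀.eval 1 / s₀.eval 1 with hc
  set δ := s₁.eval 1 / s₀.eval 1 with hδ
  set m := |s₀.eval 1| / 2 with hm
  have hm0 : 0 < m := by have := abs_pos.2 hs₀; positivity
  obtain ⟨A, hA0, hroot⟩ := exists_root_near_one ha hr s₀ hs₀ D hC hD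
  obtain ⟨M₀, hM₀⟩ := WNormLE.exists_polynomial hr0 r₀
  obtain ⟨Ms, hMs⟩ := WNormLE.exists_polynomial hr0 s₀
  obtain ⟨B₀, hB₀, hs₀B⟩ := exists_abs_eval_le s₀
  obtain ⟨B₁, hB₁, hs₁B⟩ := exists_abs_eval_le s₁
  obtain ⟨Q₁, hQ₁, hQ₁'⟩ := exists_abs_eval_le_of_root (p := r₀ - Polynomial.C c * s₀)
    (by simp [hc, hs₀])
  obtain ⟨Q₂, hQ₂, hQ₂'⟩ := exists_abs_eval_le_of_root (p := s₁ - Polynomial.C δ * s₀)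
    (by simp [hδ, hs₀])
  have hM₀0 := hM₀.nonneg
  set M := (M₀ + C) * U with hM
  have hMn : 0 ≤ M := by positivity
  set A₁ := (3 * A * B₁ + Q₂ * A + 9 * C₃) / m with hA₁
  set A₂ := (3 * C + Q₁ * A + 2 * M * ((3 * C * U + A) * 2) * B₀) / m with hA₂
  have hA₁0 : 0 ≤ A₁ := by positivity
  have hA₂0 : 0 ≤ A₂ := by positivity
  refine ⟨A + A₁ + A₂ + 2 * M, by positivity, ?_⟩
  have hsm : ∀ᶠ x in 𝓝 (1 : ℝ), m < |s₀.eval x| :=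
    ((s₀.continuous.abs).tendsto 1).eventually_const_lt (by
      have := abs_pos.2 hs₀; rw [hm]; linarith)
  obtain ⟨ε, hε, hsm⟩ := Metric.eventually_nhds_iff.1 hsm
  have hsmall : ∀ᶠ k : ℕ in atTop, C * (r / a) ^ k * U + A / a ^ k < (r - 1) / 4 := by
    have h1 : Tendsto (fun k : ℕ => C * (r / a) ^ k * U + A / a ^ k) atTop (𝓝 (C * 0 * U + 0)) :=
      (((tendsto_pow_atTop_nhds_zero_of_lt_one (by positivity)
        ((div_lt_one ha0).2 hra)).const_mul C).mul_const U).add (tendsto_const_div_pow ha A)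
    exact h1.eventually_lt_const (by simp; linarith)
  filter_upwards [hroot, hsmall, eventually_const_div_pow_le ha A,
    (tendsto_const_div_pow ha A).eventually_lt_const hε,
    (tendsto_const_div_pow ha A).eventually_lt_const (by linarith : 0 < (r - 1) / 2),
    tendsto_one_div_atTop_nhds_zero_nat.eventually_lt_const (by linarith : 0 < r - 1),
    eventually_gt_atTop 0] with k hζ hk1 hk2 hk3 hk4 hk5 hk0
  obtain ⟨ζ, hζ1, hζ0⟩ := hζ
  have hk0' : (1 : ℝ) ≤ k := by exact_mod_cast hk0
  have hkpos : (0 : ℝ) < k := by linarith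
  -- Two radii are in play: on the fixed radius `r`, `e` only needs norm at most `1/2`; on `t`,
  -- close to `1`, it has the sharp size `O(k/a^k)`.
  set t : ℝ := 1 + 1 / k with ht
  have hhalf : 1 / (2 * (k : ℝ)) = 1 / k / 2 := by field_simp
  have hk1le : 1 / (k : ℝ) ≤ 1 := (div_le_one hkpos).2 hk0'
  have hkinv : 0 < 1 / (k : ℝ) := by positivity
  have hζub : ζ ≤ 1 + 1 / k / 2 := by linarith [(abs_le.1 hζ1).2]
  have hζlb : 1 / 2 ≤ ζ := by linarith [(abs_le.1 hζ1).1]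
  have hζpos : 0 < ζ := by linarith
  have habs : |ζ| = ζ := abs_of_pos hζpos
  have hζ2 : ζ ∈ Set.Icc (0 : ℝ) 2 := ⟨hζpos.le, by linarith⟩
  have ht1 : 1 ≤ t := by linarith
  have htr : t ≤ r := by linarith
  have hζt : ζ ≤ t := by linarith
  have hζr : ζ ≤ r := hζt.trans htr
  have htk : t ^ k ≤ 3 := one_add_inv_pow_le k
  have hak : 0 < a ^ k := by positivity
  have hbk : 0 < b ^ k := by positivity
  have htak : (t / a) ^ k ≤ 3 / a ^ k := by rw [div_pow]; gcongr
  have hnζt : ‖ζ‖ ≤ t := by rwa [Real.norm_eq_abs, habs]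
  have hnζr : ‖ζ‖ ≤ r := hnζt.trans htr
  have hsζ : m ≤ |s₀.eval ζ| := (hsm (by rw [Real.dist_eq]; linarith)).le
  obtain ⟨e, he, hebound⟩ := exists_quotient hu hU hζ0
  rw [habs] at hebound
  have her : WNormLE r e (1 / 2) := (hebound r _ (by linarith) le_rfl (hD r hr.le le_rfl k)).mono (by
    rw [div_le_iff₀ (by linarith), abs_sub_comm]
    linarith)
  -- Since `ζ ≤ 1 + 1/(2k)`, the gap `t - ζ` is at least `1/(2k)`; this is the source of the factor
  -- `2k`.
  have het : WNormLE t e ((3 * C * U + A) * 2 * k / a ^ k) :=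
    (hebound t _ (by linarith) htr (hD t ht1 htr k)).mono (by
      have h1 : 1 / k / 2 ≤ t - ζ := by linarith
      calc _ ≤ (C * (3 / a ^ k) * U + A / a ^ k) / (1 / k / 2) := by
            rw [abs_sub_comm]
            gcongr
        _ = _ := by field_simp)
  -- Removing the pole leaves `H = (r₀ + N_k) u / (1 - e)`, whose norm on radius `r` is bounded
  -- independently of `k`. No count of the other zeros of the denominator is required.
  set H := G k * (PowerSeries.C ζ - PowerSeries.X) with hH
  have hHe : H * (1 - e) = ((r₀ + N k : ℝ[X]) : PowerSeries ℝ) * u := by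
    linear_combination (-(G k)) * he + u * hG k
  have hRu : WNormLE r (((r₀ + N k : ℝ[X]) : PowerSeries ℝ) * u) M := by
    refine WNormLE.mul hr0 ?_ hU
    rw [Polynomial.coe_add]
    refine (hM₀.add hr0 (hN r hr.le le_rfl k)).mono ?_
    have : (r / a) ^ k ≤ 1 := pow_le_one₀ (by positivity) ((div_le_one ha0).2 hra.le)
    nlinarith
  have hHr : WNormLE r H (2 * M) := WNormLE.of_one_sub_mul hr0 her (hHe ▸ hRu)
  have hhle : |psEval H ζ| ≤ 2 * M := hHr.norm_psEval_le hnζr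
  have hele : |psEval e ζ| ≤ (3 * C * U + A) * 2 * k / a ^ k := het.norm_psEval_le hnζt
  have hval : psEval H ζ * (1 - psEval e ζ) * s₀.eval ζ = r₀.eval ζ + (N k).eval ζ := by
    have h1 : H * (1 - e) * (s₀ : PowerSeries ℝ) = ((r₀ + N k : ℝ[X]) : PowerSeries ℝ) := by
      rw [hHe, mul_assoc, mul_comm u, hu, mul_one]
    have h2 : psEval (H * (1 - e) * (s₀ : PowerSeries ℝ)) ζ = _ := congrArg (psEval · ζ) h1
    rw [(hHe ▸ hRu : WNormLE r (H * (1 - e)) M).psEval_mul hMs hnζr,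
      hHr.psEval_mul (WNormLE.one.sub hr0 her) hnζr, psEval_sub WNormLE.one her hnζr,
      psEval_coe, psEval_coe, ← Polynomial.coe_one, psEval_coe] at h2
    simpa [Polynomial.coe_aeval_eq_eval] using h2
  refine ⟨ζ, psEval H ζ, hζ1.trans (by gcongr; linarith), ?_, ?_, fun ℓ => ?_⟩
  · have hEζ : |(E k).eval ζ| ≤ 9 * C₃ / b ^ k := by
      have := (hE t ht1 htr k).norm_aeval_le hnζt
      rw [Polynomial.coe_aeval_eq_eval, Real.norm_eq_abs] at this
      refine this.trans ?_
      rw [div_pow, ← pow_mul, mul_comm 2 k, pow_mul, mul_div_assoc', mul_comm 9]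
      gcongr
      nlinarith [pow_nonneg (by linarith : 0 ≤ t) k]
    have hpow : |ζ ^ k - 1| ≤ 3 * k * (A / a ^ k) := by
      have := abs_pow_sub_pow_le ζ 1 k
      rw [one_pow, abs_one, habs] at this
      refine this.trans ?_
      have h1 : max ζ 1 ^ (k - 1) ≤ 3 := by
        refine le_trans ?_ htk
        calc _ ≤ t ^ (k - 1) := by gcongr; exact max_le hζt ht1
          _ ≤ t ^ k := pow_le_pow_right₀ ht1 (Nat.sub_le _ _)
      calc _ ≤ (A / a ^ k) * k * 3 := by gcongr
        _ = _ := by ring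
    -- This is the equation for `ζ` rearranged so that each term on the right is of second order:
    -- `ζ^k - 1 = O(k/a^k)`, `s₁ - δ s₀` vanishes at `1`, and `E_k(ζ) = O(b^(-k))`. The bound `b ≤
    -- a²` merges the orders.
    have hroot' : (ζ - 1 - δ / a ^ k) * s₀.eval ζ =
        ((ζ ^ k - 1) * s₁.eval ζ + (s₁ - Polynomial.C δ * s₀).eval ζ) / a ^ k +
          (E k).eval ζ := by
      have h1 := hζ0
      simp only [eval_add, eval_mul, eval_sub, eval_one, eval_X, hDE, div_pow] at h1
      simp only [eval_sub, eval_mul, eval_C]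
      field_simp at h1 ⊢
      linarith
    have h2 : |ζ - 1 - δ / a ^ k| * m ≤ (3 * A * B₁ + Q₂ * A + 9 * C₃) * k / b ^ k := by
      calc _ ≤ |ζ - 1 - δ / a ^ k| * |s₀.eval ζ| := by gcongr
        _ ≤ (3 * k * (A / a ^ k) * B₁ + Q₂ * (A / a ^ k)) / a ^ k + 9 * C₃ / b ^ k := by
            rw [← abs_mul, hroot']
            refine (abs_add_le _ _).trans (add_le_add ?_ hEζ)
            rw [abs_div, abs_of_pos hak]
            gcongr
            refine (abs_add_le _ _).trans (add_le_add ?_ ?_)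
            · rw [abs_mul]
              gcongr
              exact hs₁B ζ hζ2
            · exact (hQ₂' ζ hζ2).trans (by gcongr)
        _ = (3 * A * B₁ * k + Q₂ * A) * (1 / (a ^ k * a ^ k)) + 9 * C₃ / b ^ k := by
            field_simp
        _ ≤ (3 * A * B₁ * k + Q₂ * A * k) * (1 / b ^ k) + 9 * C₃ * k / b ^ k := by
            have h3 : b ^ k ≤ a ^ k * a ^ k := by
              rw [← mul_pow, ← sq]; gcongr
            gcongr (3 * A * B₁ * k + ?_) * ?_ + ?_ / b ^ k
            · exact le_mul_of_one_le_right (by positivity) hk0'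
            · exact one_div_le_one_div_of_le hbk h3
            · exact le_mul_of_one_le_right (by positivity) hk0'
        _ = _ := by ring
    rw [← le_div_iff₀ hm0] at h2
    refine h2.trans ?_
    calc _ = A₁ * k / b ^ k := by rw [hA₁]; field_simp
      _ ≤ _ := by gcongr; linarith
  · have hNζ : |(N k).eval ζ| ≤ 3 * C / a ^ k := by
      have := (hN t ht1 htr k).norm_aeval_le hnζt
      rw [Polynomial.coe_aeval_eq_eval, Real.norm_eq_abs] at this
      refine this.trans ?_
      calc _ ≤ C * (3 / a ^ k) := by gcongr
        _ = _ := by ring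
    -- Evaluating `H (1 - e) s₀ = r₀ + N_k` at `ζ` and subtracting `c s₀(ζ)` leaves three small
    -- terms; `r₀ - c s₀` vanishes at `1`.
    have h1 : (psEval H ζ - c) * s₀.eval ζ = (N k).eval ζ + (r₀ - Polynomial.C c * s₀).eval ζ +
        psEval H ζ * psEval e ζ * s₀.eval ζ := by
      simp only [eval_sub, eval_mul, eval_C]
      linear_combination hval
    have h2 : |psEval H ζ - c| * m ≤
        (3 * C + Q₁ * A + 2 * M * ((3 * C * U + A) * 2) * B₀) * k / a ^ k := by
      calc _ ≤ |psEval H ζ - c| * |s₀.eval ζ| := by gcongr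
        _ ≤ 3 * C / a ^ k + Q₁ * (A / a ^ k) +
            2 * M * ((3 * C * U + A) * 2 * k / a ^ k) * B₀ := by
            rw [← abs_mul, h1]
            refine (abs_add_three _ _ _).trans (add_le_add_three hNζ ?_ ?_)
            · exact (hQ₁' ζ hζ2).trans (by gcongr)
            · rw [abs_mul, abs_mul]
              gcongr
              exact hs₀B ζ hζ2
        _ = (3 * C + Q₁ * A + 2 * M * ((3 * C * U + A) * 2) * B₀ * k) * (1 / a ^ k) := by ring
        _ ≤ (3 * C * k + Q₁ * A * k + 2 * M * ((3 * C * U + A) * 2) * B₀ * k) * (1 / a ^ k) := by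
            gcongr (?_ + ?_ + 2 * M * ((3 * C * U + A) * 2) * B₀ * k) * (1 / a ^ k)
            · exact le_mul_of_one_le_right (by positivity) hk0'
            · exact le_mul_of_one_le_right (by positivity) hk0'
        _ = _ := by ring
    rw [← le_div_iff₀ hm0] at h2
    refine h2.trans ?_
    calc _ = A₂ * k / a ^ k := by rw [hA₂]; field_simp
      _ ≤ _ := by gcongr; linarith
  · refine (abs_coeff_sub_le hζpos hζr rfl hHr ℓ).trans ?_
    gcongr
    linarith

/-! ### From the pole to the double exponential -/

theorem abs_exp_neg_sub_exp_neg_le {x y : ℝ} (hx : 0 ≤ x) (hy : 0 ≤ y) :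
    |Real.exp (-x) - Real.exp (-y)| ≤ |x - y| := by
  wlog h : x ≤ y generalizing x y
  · rw [abs_sub_comm, abs_sub_comm x]; exact this hy hx (le_of_not_ge h)
  rw [abs_of_nonneg (by simpa using h), abs_sub_comm, abs_of_nonneg (by linarith)]
  have h1 : Real.exp (-y) = Real.exp (-x) * Real.exp (-(y - x)) := by
    rw [← Real.exp_add]; ring_nf
  have h2 := Real.add_one_le_exp (-(y - x))
  have h3 : Real.exp (-x) ≤ 1 := Real.exp_le_one_iff.2 (by linarith)
  have h4 := Real.exp_pos (-x)
  rw [h1]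
  nlinarith

theorem abs_log_sub_le {x : ℝ} (hx : 1 ≤ x) : |Real.log x - (x - 1)| ≤ (x - 1) ^ 2 := by
  have h0 : 0 < x := by linarith
  have h1 := Real.log_le_sub_one_of_pos h0
  have h2 := Real.one_sub_inv_le_log_of_pos h0
  have h3 : x - 1 - (x - 1) ^ 2 ≤ 1 - x⁻¹ := by
    have : 1 - x⁻¹ - (x - 1 - (x - 1) ^ 2) = (x - 1) ^ 3 / x := by field_simp; ring
    have : 0 ≤ (x - 1) ^ 3 / x := by have := sub_nonneg.2 hx; positivity
    linarith
  rw [abs_le]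
  constructor <;> nlinarith [sq_nonneg (x - 1)]

/-- Since `log ζ = δ/a^k + O(k/b^k)`, the exponents `(ℓ + 1) log ζ` and `δℓ/a^k` differ by `O((ℓ +
1) k/b^k + k/a^k)`. Having `ζ ≥ 1` keeps both exponents on the side where `x ↦ exp(-x)` is
`1`-Lipschitz and gives `ζ^(-(ℓ + 1)) ≤ 1`. -/
theorem abs_pole_sub_exp_le {a b r A c δ ζ h g : ℝ} {k : ℕ} (ha : 1 < a) (hb : 0 < b)
    (hba : b ≤ a ^ 2) (hr : 1 < r) (hA : 0 ≤ A) (hδ : 0 ≤ δ) (hk : 1 ≤ k) (hζ1 : 1 ≤ ζ)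
    (hζ : |ζ - 1| ≤ A / a ^ k) (hζ' : |ζ - 1 - δ / a ^ k| ≤ A * k / b ^ k)
    (hh : |h - c| ≤ A * k / a ^ k) (ℓ : ℕ)
    (hg : |g - (ζ ^ (ℓ + 1))⁻¹ * h| ≤ A * (r ^ (ℓ + 1))⁻¹) :
    |g - c * Real.exp (-(δ * ℓ / a ^ k))| ≤ (2 * A + |c| * (A ^ 2 + A + δ)) *
      ((ℓ + 1) * (k / b ^ k) + k / a ^ k + (r ^ ℓ)⁻¹) := by
  have ha0 : 0 < a := by linarith
  have hak : 0 < a ^ k := by positivity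
  have hbk : 0 < b ^ k := by positivity
  have hk' : (1 : ℝ) ≤ k := by exact_mod_cast hk
  have hζ0 : 0 < ζ := by linarith
  have hlog : |Real.log ζ - δ / a ^ k| ≤ (A ^ 2 + A) * (k / b ^ k) := by
    have h1 := abs_log_sub_le hζ1
    have h2 : (ζ - 1) ^ 2 ≤ A ^ 2 * (k / b ^ k) := by
      rw [← sq_abs]
      calc |ζ - 1| ^ 2 ≤ (A / a ^ k) ^ 2 := by gcongr
        _ = A ^ 2 * (1 / (a ^ 2) ^ k) := by rw [div_pow, ← pow_mul, ← pow_mul, mul_comm 2]; ring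
        _ ≤ A ^ 2 * (k / b ^ k) := by gcongr
    calc _ = |(Real.log ζ - (ζ - 1)) + (ζ - 1 - δ / a ^ k)| := by ring_nf
      _ ≤ A ^ 2 * (k / b ^ k) + A * k / b ^ k := (abs_add_le _ _).trans
          (add_le_add (h1.trans h2) hζ')
      _ = _ := by ring
  have hpow : (ζ ^ (ℓ + 1))⁻¹ = Real.exp (-((ℓ + 1) * Real.log ζ)) := by
    rw [Real.exp_neg, ← Nat.cast_add_one, Real.exp_nat_mul, Real.exp_log hζ0]
  have hexp : |(ζ ^ (ℓ + 1))⁻¹ - Real.exp (-(δ * ℓ / a ^ k))| ≤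
      (A ^ 2 + A) * ((ℓ + 1) * (k / b ^ k)) + δ * (k / a ^ k) := by
    rw [hpow]
    refine (abs_exp_neg_sub_exp_neg_le (mul_nonneg (by positivity) (Real.log_nonneg hζ1))
      (by positivity)).trans ?_
    calc _ = |(ℓ + 1) * (Real.log ζ - δ / a ^ k) + δ / a ^ k| := by congr 1; ring
      _ ≤ (ℓ + 1) * ((A ^ 2 + A) * (k / b ^ k)) + δ / a ^ k := by
          refine (abs_add_le _ _).trans (add_le_add ?_ ?_)
          · rw [abs_mul, abs_of_nonneg (by positivity : (0 : ℝ) ≤ ℓ + 1)]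
            gcongr
          · rw [abs_of_nonneg (by positivity)]
      _ ≤ _ := by
          have : δ / a ^ k ≤ δ * (k / a ^ k) := by
            rw [mul_div_assoc']; gcongr; nlinarith
          linarith
  have hζinv : (ζ ^ (ℓ + 1))⁻¹ ≤ 1 := inv_le_one_of_one_le₀ (one_le_pow₀ hζ1)
  have hζinv0 : 0 ≤ (ζ ^ (ℓ + 1))⁻¹ := by positivity
  have hrr : (r ^ (ℓ + 1))⁻¹ ≤ (r ^ ℓ)⁻¹ := by
    gcongr
    · exact hr.le
    · omega
  have t1 : |(ζ ^ (ℓ + 1))⁻¹ * (h - c)| ≤ A * k / a ^ k := by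
    rw [abs_mul, abs_of_nonneg hζinv0]
    exact (mul_le_of_le_one_left (abs_nonneg _) hζinv).trans hh
  have t2 : |c * ((ζ ^ (ℓ + 1))⁻¹ - Real.exp (-(δ * ℓ / a ^ k)))| ≤
      |c| * ((A ^ 2 + A) * ((ℓ + 1) * (k / b ^ k)) + δ * (k / a ^ k)) := by
    rw [abs_mul]; gcongr
  have h1 : (0 : ℝ) ≤ (ℓ + 1) * (k / b ^ k) := by positivity
  have h2 : (0 : ℝ) ≤ k / a ^ k := by positivity
  have h3 : (0 : ℝ) ≤ (r ^ ℓ)⁻¹ := by positivity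
  calc |g - c * Real.exp (-(δ * ℓ / a ^ k))| = |(g - (ζ ^ (ℓ + 1))⁻¹ * h) +
        (ζ ^ (ℓ + 1))⁻¹ * (h - c) +
        c * ((ζ ^ (ℓ + 1))⁻¹ - Real.exp (-(δ * ℓ / a ^ k)))| := by congr 1; ring
    _ ≤ A * (r ^ ℓ)⁻¹ + A * k / a ^ k +
        |c| * ((A ^ 2 + A) * ((ℓ + 1) * (k / b ^ k)) + δ * (k / a ^ k)) :=
        (abs_add_three _ _ _).trans (add_le_add_three (hg.trans (by gcongr)) t1 t2)
    _ ≤ _ := by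
        rw [mul_div_assoc]
        have hc := abs_nonneg c
        have e1 : 0 ≤ |c| * (A ^ 2 + A) := by positivity
        have e2 : 0 ≤ |c| * δ := by positivity
        nlinarith [mul_nonneg e1 h2, mul_nonneg e1 h3, mul_nonneg e2 h1, mul_nonneg e2 h3,
          mul_nonneg hA h1, mul_nonneg hA h2, mul_nonneg hA h3]

/-! ### The limit series and the asymptotics of the coefficients -/

section limit

variable {r₀ s₀ : ℝ[X]} {u : PowerSeries ℝ}

/-- The power series of `r₀ / ((1 - X) s₀)`, where `u` is the inverse of `s₀`. -/
noncomputable def limitSeries (r₀ : ℝ[X]) (u : PowerSeries ℝ) : PowerSeries ℝ :=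
  (r₀ : PowerSeries ℝ) * u * PowerSeries.mk 1

theorem limitSeries_mul (hu : (s₀ : PowerSeries ℝ) * u = 1) :
    limitSeries r₀ u * (((1 - X) * s₀ : ℝ[X]) : PowerSeries ℝ) = r₀ := by
  have h := PowerSeries.mk_one_mul_one_sub_eq_one ℝ
  rw [limitSeries, Polynomial.coe_mul, Polynomial.coe_sub, Polynomial.coe_one, Polynomial.coe_X]
  linear_combination ((r₀ : PowerSeries ℝ) * u * s₀) * h + (r₀ : PowerSeries ℝ) * hu

theorem wNormLE_mk_one {t : ℝ} (ht0 : 0 ≤ t) (ht : t < 1) :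
    WNormLE t (PowerSeries.mk 1 : PowerSeries ℝ) (1 - t)⁻¹ := fun N => by
  have := (hasSum_geometric_of_lt_one ht0 ht)
  simpa using sum_le_hasSum (Finset.range N) (fun i _ => by positivity) this

theorem hasSum_limitSeries {r U : ℝ} (hr : 1 < r) (hU : WNormLE r u U)
    (hu : (s₀ : PowerSeries ℝ) * u = 1) (hs₀ : ∀ z : ℂ, ‖z‖ ≤ 1 → aeval z s₀ ≠ 0)
    {z : ℂ} (hz : ‖z‖ < 1) :
    HasSum (fun ℓ => ((PowerSeries.coeff ℓ (limitSeries r₀ u) : ℝ) : ℂ) * z ^ ℓ) (limitGF r₀ s₀ z) := by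
  have hz0 := norm_nonneg z
  obtain ⟨M, hM⟩ := WNormLE.exists_polynomial hz0 r₀
  obtain ⟨M', hM'⟩ := WNormLE.exists_polynomial hz0 ((1 - X) * s₀)
  have hV : WNormLE ‖z‖ (limitSeries r₀ u) _ :=
    (hM.mul hz0 (hU.mono_radius hz0 (hz.le.trans hr.le))).mul hz0 (wNormLE_mk_one hz0 hz)
  have h1 := hV.hasSum_psEval (le_refl ‖z‖)
  have h2 := hV.psEval_mul hM' (le_refl ‖z‖)
  rw [limitSeries_mul hu, psEval_coe, psEval_coe] at h2
  have h3 : (1 - z) * aeval z s₀ ≠ 0 := by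
    refine mul_ne_zero (fun h => ?_) (hs₀ z hz.le)
    rw [← sub_eq_zero.1 h] at hz
    simp at hz
  have h4 : psEval (limitSeries r₀ u) z = limitGF r₀ s₀ z := by
    rw [limitGF, eq_div_iff h3, h2]
    simp
  rw [← h4]
  exact h1

/-- The pole of `G` sits exactly at `1` and `r₀ u` has finite norm beyond it, so `abs_coeff_sub_le`
applies with `ζ = 1`; the residue is the value of `r₀ u` at `1`. -/
theorem exists_abs_coeff_limitSeries_sub_le {r U : ℝ} (hr : 1 < r) (hU : WNormLE r u U)
    (hu : (s₀ : PowerSeries ℝ) * u = 1) (hs₀ : s₀.eval 1 ≠ 0) :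
    ∃ A, 0 ≤ A ∧ ∀ ℓ, |PowerSeries.coeff ℓ (limitSeries r₀ u) - r₀.eval 1 / s₀.eval 1| ≤
      A * (r ^ ℓ)⁻¹ := by
  have hr0 : 0 ≤ r := by linarith
  obtain ⟨M, hM⟩ := WNormLE.exists_polynomial hr0 r₀
  obtain ⟨M', hM'⟩ := WNormLE.exists_polynomial hr0 s₀
  have hH := hM.mul hr0 hU
  have h1r : ‖(1 : ℝ)‖ ≤ r := by simpa using hr.le
  have hval : psEval ((r₀ : PowerSeries ℝ) * u) (1 : ℝ) = r₀.eval 1 / s₀.eval 1 := by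
    have h1 := hM'.psEval_mul hU h1r
    rw [hu, ← Polynomial.coe_one, psEval_coe, psEval_coe] at h1
    rw [hM.psEval_mul hU h1r, psEval_coe]
    simp only [Polynomial.coe_aeval_eq_eval, eval_one] at h1 ⊢
    field_simp
    linear_combination (-eval 1 r₀) * h1
  refine ⟨M * U, hH.nonneg, fun ℓ => ?_⟩
  have h := abs_coeff_sub_le (G := limitSeries r₀ u) one_pos hr.le (H := (r₀ : PowerSeries ℝ) * u)
    (by
      rw [map_one, limitSeries, mul_assoc, PowerSeries.mk_one_mul_one_sub_eq_one, mul_one]) hH ℓ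
  rw [hval, one_pow, inv_one, one_mul] at h
  refine h.trans ?_
  have hMU := hH.nonneg
  gcongr
  · exact hr.le
  · omega

end limit

theorem X_pow_dvd_perturb {m : ℕ} (a : Fin m → ℝ) (k : ℕ) (j : Fin m) :
    (X : ℝ[X]) ^ k ∣ perturb a k j := by
  rw [perturb, mul_pow]; exact Dvd.intro_left _ rfl

theorem X_pow_dvd_eval_perturb {m : ℕ} {a : Fin m → ℝ} {p : MvPolynomial (Fin m) ℝ[X]}
    (hp : SummandsDivisible₁ p) (k : ℕ) : (X : ℝ[X]) ^ k ∣ MvPolynomial.eval (perturb a k) p := by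
  rw [MvPolynomial.eval_eq]
  refine Finset.dvd_sum fun d hd => ?_
  obtain ⟨j, hj⟩ := hp d hd
  refine Dvd.dvd.mul_left (((X_pow_dvd_perturb a k j).trans (dvd_pow_self _ (by omega))).trans
    (Finset.dvd_prod_of_mem (fun i => perturb a k i ^ d i) ?_)) _
  rw [Finsupp.mem_support_iff]; omega

/-- The coefficients of `G_k` agree with those of the limit up to order `k`. -/
theorem coeff_eq_of_lt {n : ℕ} {a : Fin (n + 2) → ℝ} {r₀ s₀ s₁ : ℝ[X]}
    {r₁ s₂ : MvPolynomial (Fin (n + 2)) ℝ[X]} {u G : PowerSeries ℝ}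
    (hr₁ : SummandsDivisible₁ r₁) (hs₂ : SummandsDivisible₂ s₂)
    (hu : (s₀ : PowerSeries ℝ) * u = 1) {k : ℕ}
    (hG : G * (denom a s₀ s₁ s₂ k : PowerSeries ℝ) = (numer a r₀ r₁ k : PowerSeries ℝ))
    {ℓ : ℕ} (hℓ : ℓ < k) :
    PowerSeries.coeff ℓ G = PowerSeries.coeff ℓ (limitSeries r₀ u) := by
  obtain ⟨p, hp⟩ := X_pow_dvd_eval_perturb (a := a) hr₁ k
  obtain ⟨q, hq⟩ : (X : ℝ[X]) ^ k ∣ perturb a k 0 * s₁ + MvPolynomial.eval (perturb a k) s₂ :=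
    dvd_add ((X_pow_dvd_perturb a k 0).mul_right _)
      (X_pow_dvd_eval_perturb hs₂.summandsDivisible₁ k)
  rw [numer, denom, hp, add_assoc, hq, Polynomial.coe_add, Polynomial.coe_add, Polynomial.coe_mul,
    Polynomial.coe_mul (X ^ k), Polynomial.coe_mul (X ^ k), Polynomial.coe_sub, Polynomial.coe_one,
    Polynomial.coe_pow, Polynomial.coe_X] at hG
  have h1 := PowerSeries.mk_one_mul_one_sub_eq_one ℝ
  -- Every perturbing term carries a factor `X^k`, so both fractions satisfy the same equation
  -- modulo `X^k`, and `(1 - X) s₀` is invertible as a power series.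
  have h2 : PowerSeries.X ^ k ∣ G - limitSeries r₀ u := by
    refine ⟨((p : PowerSeries ℝ) - G * (q : PowerSeries ℝ)) * u * PowerSeries.mk 1, ?_⟩
    rw [limitSeries]
    linear_combination (u * PowerSeries.mk 1) * hG - (G * (s₀ : PowerSeries ℝ) * u) * h1 - G * hu
  have h3 := PowerSeries.X_pow_dvd_iff.1 h2 ℓ hℓ
  rwa [map_sub, sub_eq_zero] at h3

/-- Asymptotics of the coefficients `w_{ℓk}`. -/
theorem exists_coeff_asymptotics {n : ℕ} {a : Fin (n + 2) → ℝ} {r₀ s₀ s₁ : ℝ[X]}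
    {r₁ s₂ : MvPolynomial (Fin (n + 2)) ℝ[X]} {u : PowerSeries ℝ}
    (ha_one : 1 < a 0) (ha_lt : a 0 < |a 1|)
    (ha_mono : ∀ i j, 1 ≤ i → i ≤ j → |a i| ≤ |a j|)
    (hr₁ : SummandsDivisible₁ r₁) (hs₂ : SummandsDivisible₂ s₂)
    (hu : (s₀ : PowerSeries ℝ) * u = 1) {R U : ℝ} (hR : 1 < R) (hU : WNormLE R u U)
    (hs₀ : s₀.eval 1 ≠ 0) (hδ : 0 < delta s₀ s₁) (G : ℕ → PowerSeries ℝ)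
    (hG : ∀ k, G k * (denom a s₀ s₁ s₂ k : PowerSeries ℝ) =
      (numer a r₀ r₁ k : PowerSeries ℝ)) :
    ∃ r > 1, ∃ A, 0 ≤ A ∧ ∀ᶠ k : ℕ in atTop, ∀ ℓ : ℕ, |PowerSeries.coeff ℓ (G k) -
        r₀.eval 1 / s₀.eval 1 * Real.exp (-(delta s₀ s₁ * ℓ / a 0 ^ k))| ≤
      A * ((ℓ + 1) * (k / (min |a 1| (a 0 ^ 2)) ^ k) + k / a 0 ^ k + (r ^ ℓ)⁻¹) := by
  set b := min |a 1| (a 0 ^ 2) with hb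
  have ha0 : 0 < a 0 := by linarith
  have hab : a 0 < b := lt_min ha_lt (by nlinarith)
  have hb0 : 0 < b := by linarith
  have haj := fun j => (le_abs_of_mono ha_lt ha_mono j).1
  have haj' := fun j => (le_abs_of_mono ha_lt ha_mono j).2
  obtain ⟨r, hr1, hr⟩ := exists_between (lt_min hR ha_one)
  have hrR : r ≤ R := hr.le.trans (min_le_left _ _)
  have hra : r < a 0 := hr.trans_le (min_le_right _ _)
  have hr0 : 0 ≤ r := by linarith
  obtain ⟨C₁, hC₁, hN⟩ := exists_wNormLE_of_summandsDivisible₁ hr0 ha0 hra.le haj hr₁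
  obtain ⟨C₂, hC₂, hE₁⟩ :=
    exists_wNormLE_of_summandsDivisible₁ hr0 ha0 hra.le haj hs₂.summandsDivisible₁
  obtain ⟨C₃, hC₃, hE⟩ := exists_wNormLE_of_summandsDivisible₂ hr0 ha0 hra.le haj haj' hs₂
  obtain ⟨M₁, hM₁⟩ := WNormLE.exists_polynomial hr0 s₁
  have hM₁0 := hM₁.nonneg
  obtain ⟨A, hA, h⟩ := eventually_coeff_pole (C := C₁ + (M₁ + C₂)) (a := a 0) (b := b) (s₁ := s₁)
    (r₀ := r₀) ha_one hr1 hra (by linarith)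
    (min_le_right _ _) hu (hU.mono_radius hr0 hrR) hs₀
    (fun k => perturb a k 0 * s₁ + MvPolynomial.eval (perturb a k) s₂)
    (fun k => MvPolynomial.eval (perturb a k) r₁) (fun k => MvPolynomial.eval (perturb a k) s₂)
    (by positivity) hC₃ (fun t ht1 htr k => by
      have ht0 : 0 ≤ t := by linarith
      rw [Polynomial.coe_add, Polynomial.coe_mul]
      refine (((wNormLE_perturb ht0 a k 0).mul ht0 (hM₁.mono_radius ht0 htr)).add ht0
        (hE₁ t ht0 htr k)).mono ?_
      rw [abs_of_pos ha0]
      have : 0 ≤ C₁ * (t / a 0) ^ k := by positivity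
      linarith)
    (fun t ht1 htr k => (hN t (by linarith) htr k).mono (by gcongr; linarith))
    hE
    (fun k x => by simp [perturb, div_eq_inv_mul]) G (fun k => by
      rw [← add_assoc]; exact hG k)
  have hδ' := hδ.le
  refine ⟨r, hr1, 2 * A + |r₀.eval 1 / s₀.eval 1| * (A ^ 2 + A + delta s₀ s₁), by positivity, ?_⟩
  -- Positivity of `δ` and `b > a` make `δ/a^k` dominate the error in `ζ`, so `ζ ≥ 1` for large `k`.
  have hev : ∀ᶠ k : ℕ in atTop, A * k / b ^ k ≤ delta s₀ s₁ / a 0 ^ k := by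
    have h1 : Tendsto (fun k : ℕ => A * ((k : ℝ) ^ 1 / (b / a 0) ^ k)) atTop (𝓝 (A * 0)) :=
      (tendsto_pow_const_div_const_pow_of_one_lt 1 ((one_lt_div ha0).2 hab)).const_mul _
    rw [mul_zero] at h1
    filter_upwards [h1.eventually_le_const hδ] with k hk
    rw [div_pow, pow_one] at hk
    rw [le_div_iff₀ (by positivity)]
    refine le_trans (le_of_eq ?_) hk
    field_simp
  filter_upwards [h, hev, eventually_ge_atTop 1] with k hk hk2 hk1 ℓ
  obtain ⟨ζ, g, h1, h2, h3, h4⟩ := hk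
  refine abs_pole_sub_exp_le ha_one hb0 (min_le_right _ _) hr1 hA hδ.le hk1 ?_ h1 h2 h3 ℓ (h4 ℓ)
  have := (abs_le.1 h2).1
  rw [delta] at hk2
  linarith

/-! ### Summing the error over `k` -/

/-- The inequality `k₀ + i + 1 ≤ (k₀ + 1)(i + 1)` separates `k₀` from `i`, so a geometric tail has
the size of its first term with a constant independent of `k₀`. -/
theorem exists_tsum_poly_geometric_le {x : ℝ} (hx : 1 < x) (p : ℕ) :
    ∃ S, 0 ≤ S ∧ ∀ k₀ : ℕ, Summable (fun i : ℕ => ((k₀ + i : ℕ) + 1 : ℝ) ^ p / x ^ (k₀ + i)) ∧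
      ∑' i : ℕ, ((k₀ + i : ℕ) + 1 : ℝ) ^ p / x ^ (k₀ + i) ≤ S * ((k₀ + 1 : ℝ) ^ p / x ^ k₀) := by
  have hx0 : 0 < x := by linarith
  have hs : Summable fun i : ℕ => ((i : ℝ) + 1) ^ p / x ^ i := by
    have h1 : Summable fun n : ℕ => (n : ℝ) ^ p * x⁻¹ ^ n :=
      summable_pow_mul_geometric_of_norm_lt_one p
        (by rw [Real.norm_of_nonneg (by positivity)]; exact inv_lt_one_of_one_lt₀ hx)
    have h2 := ((summable_nat_add_iff 1).2 h1).mul_left x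
    refine h2.congr fun i => ?_
    push_cast
    rw [inv_pow, pow_succ]
    field_simp
  refine ⟨∑' i : ℕ, ((i : ℝ) + 1) ^ p / x ^ i, tsum_nonneg fun i => by positivity, fun k₀ => ?_⟩
  have hle : ∀ i : ℕ, ((k₀ + i : ℕ) + 1 : ℝ) ^ p / x ^ (k₀ + i) ≤
      (((i : ℝ) + 1) ^ p / x ^ i) * ((k₀ + 1 : ℝ) ^ p / x ^ k₀) := fun i => by
    rw [div_mul_div_comm, ← mul_pow, ← pow_add, add_comm i k₀]
    gcongr
    push_cast
    nlinarith [(Nat.cast_nonneg i : (0 : ℝ) ≤ i), (Nat.cast_nonneg k₀ : (0 : ℝ) ≤ k₀)]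
  have hs2 := hs.mul_right ((k₀ + 1 : ℝ) ^ p / x ^ k₀)
  have hs3 := hs2.of_nonneg_of_le (fun i => by positivity) hle
  exact ⟨hs3, (hs3.tsum_le_tsum hle hs2).trans_eq tsum_mul_right⟩

/-- The sum is split at `k₀`: a uniform bound serves the finitely many earlier terms, geometric
decay the later ones. The constant depends only on the bases and `j`, so `k₀` may later vary with
`ℓ`. -/
theorem exists_weighted_tsum_le {a b s : ℝ} (ha : 1 < a) (hb : 1 < b) (hs : 1 < s) (j : ℕ) :
    ∃ S, 0 ≤ S ∧ ∀ (d : ℕ → ℝ) (k₀ : ℕ) (x y z e₀ : ℝ), (∀ k, 0 ≤ d k) → 0 ≤ x → 0 ≤ y → 0 ≤ z → 0 ≤ e₀ →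
      (∀ k, k₀ ≤ k → d k ≤ (k + 1) * (x / b ^ k + y / a ^ k + z / s ^ k)) →
      (∀ k, k < k₀ → d k ≤ e₀) →
      Summable (fun k : ℕ => (k + 1 : ℝ) ^ j * d k) ∧
      ∑' k : ℕ, (k + 1 : ℝ) ^ j * d k ≤ (k₀ + 1) ^ (j + 1) * e₀ +
        S * ((k₀ + 1) ^ (j + 1) * (x / b ^ k₀ + y / a ^ k₀ + z / s ^ k₀)) := by
  obtain ⟨Sa, hSa, ha'⟩ := exists_tsum_poly_geometric_le ha (j + 1)
  obtain ⟨Sb, hSb, hb'⟩ := exists_tsum_poly_geometric_le hb (j + 1)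
  obtain ⟨Ss, hSs, hs'⟩ := exists_tsum_poly_geometric_le hs (j + 1)
  refine ⟨Sa + Sb + Ss, by positivity, fun d k₀ x y z e₀ hd hx hy hz he hk hk' => ?_⟩
  have ha0 : 0 < a := by linarith
  have hb0 : 0 < b := by linarith
  have hs0 : 0 < s := by linarith
  have hsum := (((hb' k₀).1.mul_left x).add ((ha' k₀).1.mul_left y)).add ((hs' k₀).1.mul_left z)
  have hle : ∀ i : ℕ, ((k₀ + i : ℕ) + 1 : ℝ) ^ j * d (k₀ + i) ≤
      x * (((k₀ + i : ℕ) + 1 : ℝ) ^ (j + 1) / b ^ (k₀ + i)) +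
      y * (((k₀ + i : ℕ) + 1 : ℝ) ^ (j + 1) / a ^ (k₀ + i)) +
      z * (((k₀ + i : ℕ) + 1 : ℝ) ^ (j + 1) / s ^ (k₀ + i)) := fun i => by
    calc _ ≤ ((k₀ + i : ℕ) + 1 : ℝ) ^ j * (((k₀ + i : ℕ) + 1) *
          (x / b ^ (k₀ + i) + y / a ^ (k₀ + i) + z / s ^ (k₀ + i))) := by
          gcongr
          exact hk (k₀ + i) (Nat.le_add_right _ _)
      _ = _ := by ring
  have hs1 : Summable fun i : ℕ => ((k₀ + i : ℕ) + 1 : ℝ) ^ j * d (k₀ + i) :=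
    hsum.of_nonneg_of_le (fun i => mul_nonneg (by positivity) (hd _)) hle
  have hS : Summable (fun k : ℕ => (k + 1 : ℝ) ^ j * d k) := by
    rw [← summable_nat_add_iff k₀]
    refine hs1.congr fun i => ?_
    rw [add_comm k₀ i]
  refine ⟨hS, ?_⟩
  rw [← hS.sum_add_tsum_nat_add k₀]
  refine add_le_add ?_ ?_
  · calc ∑ i ∈ Finset.range k₀, (i + 1 : ℝ) ^ j * d i
        ≤ ∑ i ∈ Finset.range k₀, (k₀ + 1 : ℝ) ^ j * e₀ := by
          refine Finset.sum_le_sum fun i hi => ?_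
          have hi' := Finset.mem_range.1 hi
          have : (i : ℝ) ≤ k₀ := by exact_mod_cast hi'.le
          gcongr
          · exact hd i
          · exact hk' i hi'
      _ = k₀ * ((k₀ + 1 : ℝ) ^ j * e₀) := by simp
      _ ≤ (k₀ + 1) * ((k₀ + 1 : ℝ) ^ j * e₀) := by
          gcongr
          linarith
      _ = _ := by ring
  · have h1 : ∑' i : ℕ, ((i + k₀ : ℕ) + 1 : ℝ) ^ j * d (i + k₀) ≤
        x * (Sb * ((k₀ + 1 : ℝ) ^ (j + 1) / b ^ k₀)) +
        y * (Sa * ((k₀ + 1 : ℝ) ^ (j + 1) / a ^ k₀)) +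
        z * (Ss * ((k₀ + 1 : ℝ) ^ (j + 1) / s ^ k₀)) := by
      simp_rw [add_comm _ k₀]
      refine (hs1.tsum_le_tsum hle hsum).trans ?_
      rw [Summable.tsum_add (((hb' k₀).1.mul_left x).add ((ha' k₀).1.mul_left y))
        ((hs' k₀).1.mul_left z), Summable.tsum_add ((hb' k₀).1.mul_left x)
        ((ha' k₀).1.mul_left y), tsum_mul_left, tsum_mul_left, tsum_mul_left]
      gcongr
      · exact (hb' k₀).2
      · exact (ha' k₀).2
      · exact (hs' k₀).2
    refine h1.trans ?_
    have e1 : 0 ≤ (k₀ + 1 : ℝ) ^ (j + 1) * (x / b ^ k₀) := by positivity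
    have e2 : 0 ≤ (k₀ + 1 : ℝ) ^ (j + 1) * (y / a ^ k₀) := by positivity
    have e3 : 0 ≤ (k₀ + 1 : ℝ) ^ (j + 1) * (z / s ^ k₀) := by positivity
    calc _ = Sb * ((k₀ + 1 : ℝ) ^ (j + 1) * (x / b ^ k₀)) +
          Sa * ((k₀ + 1 : ℝ) ^ (j + 1) * (y / a ^ k₀)) +
          Ss * ((k₀ + 1 : ℝ) ^ (j + 1) * (z / s ^ k₀)) := by ring
      _ ≤ _ := by nlinarith [mul_nonneg hSa e1, mul_nonneg hSa e3, mul_nonneg hSb e2,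
          mul_nonneg hSb e3, mul_nonneg hSs e1, mul_nonneg hSs e2]

/-- The error of the approximation of `F ℓ k`, in a form that is summable over `k`. -/
theorem abs_sub_exp_le_summable {a b δ r C : ℝ} (ha : 1 < a) (hb : 1 < b) (hδ : 0 < δ)
    (hr : 1 < r) (hC : 0 ≤ C) :
    ∃ s > 1, ∀ (ℓ k : ℕ) (y : ℝ), y ≤ 1 → (ℓ < k → y = 1) →
      |y - Real.exp (-(δ * ℓ / a ^ k))| ≤ C * ((ℓ + 1) * (k / b ^ k) + k / a ^ k + (r ^ ℓ)⁻¹) →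
      |y - Real.exp (-(δ * ℓ / a ^ k))| ≤ (k + 1) * ((C * (ℓ + 1)) / b ^ k + C / a ^ k +
        ((C + δ) * (ℓ + 1) / s ^ ℓ) / s ^ k) := by
  have ha0 : 0 < a := by linarith
  have hr0 : 0 < r := by linarith
  have hb0 : 0 < b := by linarith
  -- The bound `r^(-ℓ)` does not decay in `k`. With this `s`, `s^(ℓ + k)` is at most `r^ℓ` when `k ≤
  -- ℓ` and at most `a^k` when `k > ℓ`; in the second range `y = 1` and the error is at most
  -- `δℓ/a^k`.
  set s := √(min r a) with hs
  have hs2 : s ^ 2 = min r a := Real.sq_sqrt (by positivity)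
  have hs1 : 1 < s := by
    rw [hs, Real.lt_sqrt (by norm_num)]
    simpa using ⟨hr, ha⟩
  have hs0 : 0 < s := by linarith
  refine ⟨s, hs1, fun ℓ k y _ hy1 h => ?_⟩
  have hℓ : (0 : ℝ) ≤ ℓ := by positivity
  have hk : (0 : ℝ) ≤ k := by positivity
  rcases le_or_gt k ℓ with hkl | hkl
  · refine h.trans ?_
    have h1 : (r ^ ℓ)⁻¹ ≤ 1 / s ^ ℓ / s ^ k := by
      rw [div_div, ← one_div]
      gcongr
      calc s ^ ℓ * s ^ k ≤ s ^ ℓ * s ^ ℓ := by gcongr; exact hs1.le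
        _ = (s ^ 2) ^ ℓ := by rw [← pow_mul, two_mul, pow_add]
        _ ≤ r ^ ℓ := by gcongr; rw [hs2]; exact min_le_left _ _
    have h2 : (r ^ ℓ)⁻¹ * C ≤ (k + 1) * (((C + δ) * (ℓ + 1) / s ^ ℓ) / s ^ k) := by
      calc _ ≤ 1 / s ^ ℓ / s ^ k * C := by gcongr
        _ ≤ 1 / s ^ ℓ / s ^ k * ((k + 1) * (ℓ + 1) * (C + δ)) := by
            gcongr
            have : (1 : ℝ) ≤ (k + 1) * (ℓ + 1) := by nlinarith
            nlinarith
        _ = _ := by ring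
    have h3 : C * ((ℓ + 1) * (k / b ^ k)) ≤ (k + 1) * ((C * (ℓ + 1)) / b ^ k) := by
      have : 0 ≤ (C * (ℓ + 1)) / b ^ k := by positivity
      calc _ = k * ((C * (ℓ + 1)) / b ^ k) := by ring
        _ ≤ _ := by gcongr; linarith
    have h4 : C * (k / a ^ k) ≤ (k + 1) * (C / a ^ k) := by
      calc _ = k * (C / a ^ k) := by ring
        _ ≤ _ := by gcongr; linarith
    linarith
  · rw [hy1 hkl]
    have h1 : |1 - Real.exp (-(δ * ℓ / a ^ k))| ≤ δ * ℓ / a ^ k := by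
      have := abs_exp_neg_sub_exp_neg_le le_rfl (by positivity : 0 ≤ δ * ℓ / a ^ k)
      simpa [abs_of_nonneg (by positivity : 0 ≤ δ * ℓ / a ^ k)] using this
    refine h1.trans ?_
    have h2 : 1 / a ^ k ≤ 1 / s ^ ℓ / s ^ k := by
      rw [div_div]
      gcongr
      calc s ^ ℓ * s ^ k ≤ s ^ k * s ^ k := by gcongr; exact hs1.le
        _ = (s ^ 2) ^ k := by rw [← pow_mul, two_mul, pow_add]
        _ ≤ a ^ k := by gcongr; rw [hs2]; exact min_le_right _ _
    calc δ * ℓ / a ^ k = (δ * ℓ) * (1 / a ^ k) := by ring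
      _ ≤ ((C + δ) * (ℓ + 1)) * (1 / s ^ ℓ / s ^ k) := by gcongr <;> linarith
      _ = 1 * ((C + δ) * (ℓ + 1) / s ^ ℓ / s ^ k) := by ring
      _ ≤ (k + 1) * ((C * (ℓ + 1)) / b ^ k + C / a ^ k +
        ((C + δ) * (ℓ + 1) / s ^ ℓ) / s ^ k) := by
          have e1 : 0 ≤ (C * (ℓ + 1)) / b ^ k := by positivity
          have e2 : 0 ≤ C / a ^ k := by positivity
          have e3 : 0 ≤ (C + δ) * (ℓ + 1) / s ^ ℓ / s ^ k := by positivity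
          gcongr <;> linarith

set_option maxHeartbeats 1000000 in
-- At the cut `a^(k₀) ≍ ℓ/log ℓ` the term `ℓ/b^(k₀)` has size `log^(1+ρ) ℓ / ℓ^ρ`, because `b =
-- a^(1+ρ)`. The remaining powers of `log ℓ` count the indices below the cut and the polynomial
-- weights.
theorem exists_error_sum_le {a b ρ δ r C : ℝ} (ha : 1 < a) (hρ : 0 < ρ) (hρ1 : ρ ≤ 1)
    (hb : b = a ^ (1 + ρ)) (hδ : 0 < δ) (hr : 1 < r) (hC : 0 ≤ C) {F : ℕ → ℕ → ℝ} {ℓ₀ : ℕ}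
    (hmono : ∀ ℓ, ℓ₀ ≤ ℓ → Monotone (F ℓ)) (hnn : ∀ ℓ, ℓ₀ ≤ ℓ → ∀ k, 0 ≤ F ℓ k)
    (hone : ∀ ℓ, ℓ₀ ≤ ℓ → ∀ k, ℓ < k → F ℓ k = 1)
    (hF : ∀ᶠ k : ℕ in atTop, ∀ ℓ : ℕ, ℓ₀ ≤ ℓ → |F ℓ k - Real.exp (-(δ * ℓ / a ^ k))| ≤
      C * ((ℓ + 1) * (k / b ^ k) + k / a ^ k + (r ^ ℓ)⁻¹)) (j : ℕ) :
    ∃ B, 0 ≤ B ∧ ∀ᶠ ℓ : ℕ in atTop,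
      Summable (fun k : ℕ => (k + 1 : ℝ) ^ j * |F ℓ k - Real.exp (-(δ * ℓ / a ^ k))|) ∧
      ∑' k : ℕ, (k + 1 : ℝ) ^ j * |F ℓ k - Real.exp (-(δ * ℓ / a ^ k))| ≤
        B * (Real.log ℓ ^ (ρ + 3 + j) / (ℓ : ℝ) ^ ρ) := by
  have ha0 : 0 < a := by linarith
  have hb1 : 1 < b := hb ▸ Real.one_lt_rpow ha (by linarith)
  have hb0 : 0 < b := by linarith
  obtain ⟨s, hs1, hsum⟩ := abs_sub_exp_le_summable ha hb1 hδ hr hC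
  obtain ⟨S, hS, hsum'⟩ := exists_weighted_tsum_le ha hb1 hs1 j
  obtain ⟨K, hK⟩ := eventually_atTop.1 hF
  have hs0 : 0 < s := by linarith
  have hloga : 0 < Real.log a := Real.log_pos ha
  set Ck := (|Real.log δ| + 1) / Real.log a + 1 with hCk
  have hCk0 : 0 ≤ Ck := by positivity
  set B₁ := 2 * C * (a / δ) ^ (1 + ρ) + C * (a / δ) + 2 * (C + δ) with hB₁
  have hB₁0 : 0 ≤ B₁ := by positivity
  refine ⟨Ck ^ (j + 2) * (2 + (1 + S) * B₁), by positivity, ?_⟩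
  have hcast : Tendsto (fun ℓ : ℕ => (ℓ : ℝ)) atTop atTop := tendsto_natCast_atTop_atTop
  -- This pushes the cut beyond `K`, from where on the coefficient asymptotics are available.
  have ev1 : ∀ᶠ ℓ : ℕ in atTop, Real.log ℓ ≤ δ / a ^ K * ℓ := by
    have h1 := (Real.isLittleO_log_id_atTop.comp_tendsto hcast).def
      (by positivity : 0 < δ / a ^ K)
    filter_upwards [h1] with ℓ hℓ
    simp only [Function.comp_apply, id, Real.norm_eq_abs] at hℓ
    rw [abs_of_nonneg (Nat.cast_nonneg ℓ : (0 : ℝ) ≤ ℓ)] at hℓ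
    exact (le_abs_self _).trans hℓ
  have ev2 : ∀ᶠ ℓ : ℕ in atTop, (1 : ℝ) ≤ Real.log ℓ :=
    (Real.tendsto_log_atTop.comp hcast).eventually_ge_atTop 1
  have ev3 : ∀ᶠ ℓ : ℕ in atTop, (ℓ : ℝ) ^ 2 / s ^ ℓ ≤ 1 :=
    (tendsto_pow_const_div_const_pow_of_one_lt 2 hs1).eventually_le_const one_pos
  filter_upwards [ev1, ev2, ev3, eventually_ge_atTop ℓ₀, eventually_ge_atTop 1]
    with ℓ h1 hlg h3 hℓ₀ hℓ1
  set g := Real.log ℓ with hg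
  have hg0 : 0 < g := by linarith
  have hℓ : (1 : ℝ) ≤ ℓ := by exact_mod_cast hℓ1
  have hℓ0 : (0 : ℝ) < ℓ := by linarith
  -- Chosen so that `a^k ≤ q` forces `exp(-δℓ/a^k) ≤ 1/ℓ`; `k₀` is the largest such exponent.
  set q := δ * ℓ / g with hq
  have hq0 : 0 < q := by positivity
  have hqK : a ^ K ≤ q := by
    rw [hq, le_div_iff₀ hg0]
    calc a ^ K * g ≤ a ^ K * (δ / a ^ K * ℓ) := by gcongr
      _ = _ := by field_simp
  have hlogq : (K : ℝ) ≤ Real.logb a q := by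
    rw [Real.le_logb_iff_rpow_le ha hq0, Real.rpow_natCast]; exact hqK
  have hlogq0 : 0 ≤ Real.logb a q := (Nat.cast_nonneg K).trans hlogq
  set k₀ := ⌊Real.logb a q⌋₊ with hk₀
  have hk₀K : K ≤ k₀ := Nat.le_floor hlogq
  have hk₀le : (k₀ : ℝ) ≤ Real.logb a q := Nat.floor_le hlogq0
  have hak₀ : a ^ k₀ ≤ q := by
    rw [Real.le_logb_iff_rpow_le ha hq0, Real.rpow_natCast] at hk₀le; exact hk₀le
  have hak₁ : q < a ^ k₀ * a := by
    have := Nat.lt_floor_add_one (Real.logb a q)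
    rw [Real.logb_lt_iff_lt_rpow ha hq0, ← Nat.cast_add_one, Real.rpow_natCast, pow_succ] at this
    exact this
  have hk₀C : (k₀ : ℝ) + 1 ≤ Ck * g := by
    have h2 : Real.logb a q ≤ (|Real.log δ| + 1) / Real.log a * g := by
      rw [Real.logb, div_mul_eq_mul_div]
      gcongr
      calc Real.log q ≤ Real.log (δ * ℓ) := by
            apply Real.log_le_log hq0
            rw [hq]; exact div_le_self (by positivity) hlg
        _ = Real.log δ + g := by rw [Real.log_mul hδ.ne' hℓ0.ne']
        _ ≤ |Real.log δ| * g + g := by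
            have := le_abs_self (Real.log δ)
            nlinarith [abs_nonneg (Real.log δ)]
        _ = _ := by ring
    rw [hCk, add_mul]
    linarith
  have hφ : Real.exp (-(δ * ℓ / a ^ k₀)) ≤ 1 / ℓ := by
    rw [one_div, ← Real.exp_log (inv_pos.2 hℓ0), Real.log_inv]
    apply Real.exp_le_exp.2
    rw [neg_le_neg_iff, le_div_iff₀ (by positivity)]
    calc g * a ^ k₀ ≤ g * q := by gcongr
      _ = δ * ℓ := by rw [hq]; field_simp
  set T := g ^ (1 + ρ) / (ℓ : ℝ) ^ ρ with hT
  have hgρ : g ≤ g ^ (1 + ρ) := Real.self_le_rpow_of_one_le hlg (by linarith)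
  have hℓρ : (ℓ : ℝ) ^ ρ ≤ ℓ := Real.rpow_le_self_of_one_le hℓ hρ1
  have hℓρ0 : 0 < (ℓ : ℝ) ^ ρ := by positivity
  have hT1 : g / ℓ ≤ T := by rw [hT]; gcongr
  have hT2 : 1 / ℓ ≤ T := le_trans (by gcongr) hT1
  have hT0 : 0 ≤ T := by positivity
  have hainv : 1 / a ^ k₀ ≤ a / δ * (g / ℓ) := by
    rw [div_le_iff₀ (by positivity)]
    have h4 : a / δ * (g / ℓ) * q = a := by rw [hq]; field_simp
    have h5 : 0 < a / δ * (g / ℓ) := by positivity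
    nlinarith
  set x := C * ((ℓ : ℝ) + 1) with hx
  set z := (C + δ) * ((ℓ : ℝ) + 1) / s ^ ℓ with hz
  set d : ℕ → ℝ := fun k => |F ℓ k - Real.exp (-(δ * ℓ / a ^ k))| with hd
  have hFle : ∀ k, F ℓ k ≤ 1 := fun k =>
    (hmono ℓ hℓ₀ (le_max_left k (ℓ + 1))).trans_eq
      (hone ℓ hℓ₀ _ (lt_of_lt_of_le (Nat.lt_succ_self ℓ) (le_max_right _ _)))
  have hdk : ∀ k, K ≤ k → d k ≤ (k + 1) * (x / b ^ k + C / a ^ k + z / s ^ k) := fun k hk =>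
    hsum ℓ k _ (hFle k) (hone ℓ hℓ₀ k) (hK k hk ℓ hℓ₀)
  set W := x / b ^ k₀ + C / a ^ k₀ + z / s ^ k₀ with hW
  have hx0 : 0 ≤ x := by positivity
  have hz0 : 0 ≤ z := by positivity
  have hW0 : 0 ≤ W := by positivity
  have hWT : W ≤ B₁ * T := by
    have e1 : x / b ^ k₀ ≤ 2 * C * (a / δ) ^ (1 + ρ) * T := by
      have hbk : 1 / b ^ k₀ ≤ (a / δ) ^ (1 + ρ) * (g / ℓ) ^ (1 + ρ) := by
        rw [← Real.mul_rpow (by positivity) (by positivity)]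
        have : 1 / b ^ k₀ = (1 / a ^ k₀) ^ (1 + ρ) := by
          rw [Real.div_rpow zero_le_one (by positivity), Real.one_rpow, hb,
            ← Real.rpow_natCast, ← Real.rpow_natCast, ← Real.rpow_mul ha0.le,
            ← Real.rpow_mul ha0.le, mul_comm]
        rw [this]
        gcongr
      have hℓT : ℓ * (g / ℓ) ^ (1 + ρ) = T := by
        rw [hT, Real.div_rpow hg0.le hℓ0.le, Real.rpow_add hℓ0, Real.rpow_one]
        field_simp
      calc x / b ^ k₀ = x * (1 / b ^ k₀) := by ring
        _ ≤ (C * (2 * ℓ)) * ((a / δ) ^ (1 + ρ) * (g / ℓ) ^ (1 + ρ)) := by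
            rw [hx]; gcongr; linarith
        _ = 2 * C * (a / δ) ^ (1 + ρ) * (ℓ * (g / ℓ) ^ (1 + ρ)) := by ring
        _ = _ := by rw [hℓT]
    have e2 : C / a ^ k₀ ≤ C * (a / δ) * T := by
      calc C / a ^ k₀ = C * (1 / a ^ k₀) := by ring
        _ ≤ C * (a / δ * (g / ℓ)) := by gcongr
        _ = C * (a / δ) * (g / ℓ) := by ring
        _ ≤ _ := by gcongr
    have e3 : z / s ^ k₀ ≤ 2 * (C + δ) * T := by
      calc z / s ^ k₀ ≤ z := div_le_self hz0 (one_le_pow₀ hs1.le)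
        _ ≤ (C + δ) * (2 * ℓ) / s ^ ℓ := by rw [hz]; gcongr; linarith
        _ = 2 * (C + δ) * ((ℓ : ℝ) ^ 2 / s ^ ℓ * (1 / ℓ)) := by field_simp
        _ ≤ 2 * (C + δ) * (1 * T) := by gcongr
        _ = _ := by ring
    rw [hW, hB₁, add_mul, add_mul]
    exact add_le_add_three e1 e2 e3
  -- The pointwise error estimate is too weak below the cut. Both functions increase in `k`, so they
  -- are bounded by their values at `k₀`, where the estimate still holds.
  have hdk' : ∀ k, k < k₀ → d k ≤ 2 / ℓ + (k₀ + 1) * W := fun k hk => by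
    have f1 : F ℓ k ≤ F ℓ k₀ := hmono ℓ hℓ₀ hk.le
    have f2 : Real.exp (-(δ * ℓ / a ^ k)) ≤ Real.exp (-(δ * ℓ / a ^ k₀)) := by
      apply Real.exp_le_exp.2
      rw [neg_le_neg_iff]
      gcongr
      exact ha.le
    have f3 := hdk k₀ hk₀K
    have f4 : F ℓ k₀ - Real.exp (-(δ * ℓ / a ^ k₀)) ≤ d k₀ := le_abs_self _
    have f5 := hnn ℓ hℓ₀ k
    have f6 := Real.exp_pos (-(δ * ℓ / a ^ k))
    have f7 : 2 / (ℓ : ℝ) = 1 / ℓ + 1 / ℓ := by ring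
    have f8 : 0 ≤ d k₀ := abs_nonneg _
    have f9 := Real.exp_pos (-(δ * ℓ / a ^ k₀))
    have f10 := hnn ℓ hℓ₀ k₀
    rw [hd]
    simp only
    rw [abs_le]
    constructor <;> linarith
  obtain ⟨g1, g2⟩ := hsum' d k₀ x C z (2 / ℓ + (k₀ + 1) * W) (fun k => abs_nonneg _) hx0 hC hz0
    (by positivity) (fun k hk => hdk k (hk₀K.trans hk)) hdk'
  refine ⟨g1, g2.trans ?_⟩
  -- The exponent is `1 + ρ` from `T` plus `j + 2`: weight `j`, one for the linear factor in the
  -- error, and one for the number of terms below the cut.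
  have hlast : g ^ (ρ + 3 + j) / (ℓ : ℝ) ^ ρ = g ^ (j + 2) * T := by
    rw [hT, mul_div_assoc', ← Real.rpow_natCast g, ← Real.rpow_add hg0]
    congr 2
    push_cast
    ring
  have hk1 : (1 : ℝ) ≤ k₀ + 1 := by linarith [(Nat.cast_nonneg k₀ : (0 : ℝ) ≤ k₀)]
  calc _ ≤ (k₀ + 1 : ℝ) ^ (j + 2) * (2 / ℓ + (1 + S) * W) := by
        have e1 : (k₀ + 1 : ℝ) ^ (j + 1) * (2 / ℓ) ≤ (k₀ + 1 : ℝ) ^ (j + 2) * (2 / ℓ) := by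
          have := pow_le_pow_right₀ hk1 (by omega : j + 1 ≤ j + 2)
          gcongr
        have e2 : S * ((k₀ + 1 : ℝ) ^ (j + 1) * W) ≤ S * ((k₀ + 1 : ℝ) ^ (j + 2) * W) := by
          have := pow_le_pow_right₀ hk1 (by omega : j + 1 ≤ j + 2)
          gcongr
        have e3 : (k₀ + 1 : ℝ) ^ (j + 2) = (k₀ + 1 : ℝ) ^ (j + 1) * (k₀ + 1) := pow_succ _ _
        rw [← hW]
        nlinarith
    _ ≤ (Ck * g) ^ (j + 2) * (2 * T + (1 + S) * (B₁ * T)) := by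
        have : 2 / (ℓ : ℝ) ≤ 2 * T := by
          calc 2 / (ℓ : ℝ) = 2 * (1 / ℓ) := by ring
            _ ≤ _ := by gcongr
        gcongr
    _ = _ := by rw [hlast, mul_pow]; ring

/-! ### The Gamma function and the Mellin transform of `e^(-t) - e^(-at)` -/

section Gamma

open Complex

theorem norm_Gamma_le_Gamma_re {s : ℂ} (hs : 0 < s.re) : ‖Complex.Gamma s‖ ≤ Real.Gamma s.re := by
  rw [Complex.Gamma_eq_integral hs, Real.Gamma_eq_integral hs, Complex.GammaIntegral]
  refine (norm_integral_le_integral_norm _).trans_eq ?_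
  refine setIntegral_congr_fun measurableSet_Ioi fun t ht => ?_
  rw [norm_mul, Complex.norm_real, Complex.norm_cpow_eq_rpow_re_of_pos ht,
    Real.norm_of_nonneg (Real.exp_pos _).le]
  simp

theorem exists_norm_Gamma_le : ∃ M, 0 ≤ M ∧ ∀ s : ℂ, 1 ≤ s.re → s.re ≤ 3 → ‖Complex.Gamma s‖ ≤ M := by
  have hc : ContinuousOn Real.Gamma (Set.Icc 1 3) :=
    Real.differentiableOn_Gamma_Ioi.continuousOn.mono fun x hx => lt_of_lt_of_le one_pos hx.1
  obtain ⟨M, hM⟩ := isCompact_Icc.exists_bound_of_continuousOn hc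
  refine ⟨M, (norm_nonneg _).trans (hM 1 (by norm_num)), fun s h1 h3 =>
    (norm_Gamma_le_Gamma_re (by linarith)).trans ((le_abs_self _).trans (hM _ ⟨h1, h3⟩))⟩

theorem differentiableAt_Gamma_of_re_pos {s : ℂ} (hs : 0 < s.re) :
    DifferentiableAt ℂ Complex.Gamma s :=
  Complex.differentiableAt_Gamma s fun m h => by
    have := congrArg Complex.re h
    simp at this
    linarith [(Nat.cast_nonneg m : (0 : ℝ) ≤ m)]

theorem ne_neg_nat_of_im_ne_zero {s : ℂ} (hs : s.im ≠ 0) (m : ℕ) : s ≠ -m := fun h => by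
  rw [h] at hs; simp at hs

/-- The decay of `Γ` and `Γ'` on the imaginary axis. -/
theorem exists_norm_Gamma_imaginary_le {t₀ : ℝ} (ht₀ : 0 < t₀) :
    ∃ M, 0 ≤ M ∧ ∀ t : ℝ, t₀ ≤ |t| → ‖Complex.Gamma (t * I)‖ ≤ M / t ^ 2 ∧
      ‖deriv Complex.Gamma (t * I)‖ ≤ M / t ^ 2 := by
  obtain ⟨M, hM0, hM⟩ := exists_norm_Gamma_le
  refine ⟨M + M * (2 / t₀ + 1 / t₀ ^ 2), by positivity, fun t ht => ?_⟩
  set s : ℂ := t * I with hs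
  have ht0 : 0 < |t| := ht₀.trans_le ht
  have htne : t ≠ 0 := abs_pos.1 ht0
  have hs0 : s ≠ 0 := by simp [hs, htne]
  have hs1 : s + 1 ≠ 0 := fun h => by
    have := congrArg Complex.re h
    simp [hs] at this
  have hnorm : ‖s‖ = |t| := by simp [hs]
  have hnorm1 : |t| ≤ ‖s + 1‖ := by
    have := Complex.abs_im_le_norm (s + 1)
    simpa [hs] using this
  have hre : (s + 1 + 1).re = 2 := by simp [hs]; norm_num
  -- Two steps of the functional equation move the imaginary axis to the line of real part `2`,
  -- where `Γ` is bounded; dividing back by `s (s + 1)` gives quadratic decay.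
  have hΓ : Complex.Gamma (s + 1 + 1) = (s + 1) * (s * Complex.Gamma s) := by
    rw [Complex.Gamma_add_one _ hs1, Complex.Gamma_add_one _ hs0]
  have hdiff : ∀ w : ℂ, w.im ≠ 0 → DifferentiableAt ℂ Complex.Gamma w := fun w hw =>
    Complex.differentiableAt_Gamma w (ne_neg_nat_of_im_ne_zero hw)
  have hΓ' : deriv Complex.Gamma (s + 1 + 1) = s * Complex.Gamma s +
      (s + 1) * (Complex.Gamma s + s * deriv Complex.Gamma s) := by
    rw [Complex.deriv_Gamma_add_one _ hs1, Complex.deriv_Gamma_add_one _ hs0,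
      Complex.Gamma_add_one _ hs0]
  have hb : ‖Complex.Gamma (s + 1 + 1)‖ ≤ M := hM _ (by rw [hre]; norm_num) (by rw [hre]; norm_num)
  -- Cauchy's estimate on the unit circle around `s + 2`, which stays in the strip of real parts `1`
  -- to `3`.
  have hb' : ‖deriv Complex.Gamma (s + 1 + 1)‖ ≤ M := by
    have h1 : ∀ z ∈ Metric.closedBall (s + 1 + 1) 1, 1 ≤ z.re ∧ z.re ≤ 3 := fun z hz => by
      have h2 := (Complex.abs_re_le_norm (z - (s + 1 + 1))).trans (mem_closedBall_iff_norm.1 hz)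
      rw [Complex.sub_re, hre, abs_le] at h2
      constructor <;> linarith
    have := Complex.norm_deriv_le_of_forall_mem_sphere_norm_le (f := Complex.Gamma)
      (c := s + 1 + 1) (C := M) one_pos
      (DifferentiableOn.diffContOnCl (by
        rw [closure_ball _ one_ne_zero]
        exact fun z hz => (differentiableAt_Gamma_of_re_pos
          (lt_of_lt_of_le one_pos (h1 z hz).1)).differentiableWithinAt))
      (fun z hz => hM z (h1 z (Metric.sphere_subset_closedBall hz)).1
        (h1 z (Metric.sphere_subset_closedBall hz)).2)
    simpa using this
  have hG : ‖Complex.Gamma s‖ ≤ M / t ^ 2 := by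
    rw [le_div_iff₀ (by positivity), ← sq_abs]
    calc ‖Complex.Gamma s‖ * |t| ^ 2 = |t| * (|t| * ‖Complex.Gamma s‖) := by ring
      _ ≤ ‖s + 1‖ * (‖s‖ * ‖Complex.Gamma s‖) := by rw [hnorm]; gcongr
      _ ≤ M := by rw [← norm_mul, ← norm_mul, ← hΓ]; exact hb
  constructor
  · refine hG.trans ?_
    gcongr
    have : 0 ≤ M * (2 / t₀ + 1 / t₀ ^ 2) := by positivity
    linarith
  · have h1 : (s + 1) * (s * deriv Complex.Gamma s) =
        deriv Complex.Gamma (s + 1 + 1) - (2 * s + 1) * Complex.Gamma s := by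
      rw [hΓ']; ring
    rw [le_div_iff₀ (by positivity), ← sq_abs]
    calc ‖deriv Complex.Gamma s‖ * |t| ^ 2 = |t| * (|t| * ‖deriv Complex.Gamma s‖) := by ring
      _ ≤ ‖s + 1‖ * (‖s‖ * ‖deriv Complex.Gamma s‖) := by rw [hnorm]; gcongr
      _ = ‖deriv Complex.Gamma (s + 1 + 1) - (2 * s + 1) * Complex.Gamma s‖ := by
          rw [← norm_mul, ← norm_mul, h1]
      _ ≤ M + (2 * |t| + 1) * (M / |t| ^ 2) := by
          refine (norm_sub_le _ _).trans (add_le_add hb' ?_)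
          rw [norm_mul, sq_abs]
          gcongr
          refine (norm_add_le _ _).trans ?_
          rw [norm_mul, hnorm]; simp
      _ = M + M * (2 / |t| + 1 / |t| ^ 2) := by field_simp
      _ ≤ _ := by gcongr

theorem contDiffAt_Gamma_one_add {n : ℕ∞} :
    ContDiffAt ℂ n (fun z : ℂ => Complex.Gamma (1 + z)) 0 := by
  have h : AnalyticAt ℂ Complex.Gamma 1 := by
    rw [Complex.analyticAt_iff_eventually_differentiableAt]
    have : ∀ᶠ z : ℂ in 𝓝 1, 0 < z.re :=
      Complex.continuous_re.continuousAt.eventually_const_lt (by simp)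
    exact this.mono fun z hz => differentiableAt_Gamma_of_re_pos hz
  have h2 : AnalyticAt ℂ (fun z : ℂ => Complex.Gamma (1 + z)) 0 :=
    AnalyticAt.fun_comp (by simpa using h) (by fun_prop)
  exact h2.contDiffAt.of_le (by exact_mod_cast le_top)

/-- The reflection formula reads `Γ(1 + z) Γ(1 - z) sin(πz) = πz` near `0`. Comparing third
derivatives at `0` and inserting `Γ'(1) = -γ` determines `Γ''(1)`. -/
theorem iteratedDeriv_two_Gamma_one :
    iteratedDeriv 2 Complex.Gamma 1 =
      (Real.eulerMascheroniConstant : ℂ) ^ 2 + (Real.pi : ℂ) ^ 2 / 6 := by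
  set f : ℂ → ℂ := fun z => Complex.Gamma (1 + z) with hf
  set g : ℂ → ℂ := fun z => Complex.Gamma (1 - z) with hg
  have hf3 : ContDiffAt ℂ (3 : ℕ) f 0 := contDiffAt_Gamma_one_add (n := 3)
  have hg3 : ContDiffAt ℂ (3 : ℕ) g 0 := by
    have : g = f ∘ Neg.neg := by ext z; simp [hf, hg, sub_eq_add_neg]
    rw [this]
    exact ContDiffAt.comp _ (by simpa using hf3) contDiff_neg.contDiffAt
  have hs : ContDiffAt ℂ (3 : ℕ) (fun z : ℂ => Complex.sin (Real.pi * z)) 0 := by fun_prop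
  have hid : (fun z : ℂ => f z * g z * Complex.sin (Real.pi * z)) =ᶠ[𝓝 0]
      fun z => (Real.pi : ℂ) * z := by
    have : ∀ᶠ z : ℂ in 𝓝 0, ‖z‖ < 1 := by
      filter_upwards [Metric.ball_mem_nhds (0 : ℂ) one_pos] with z hz
      simpa using hz
    filter_upwards [this] with z hz
    rcases eq_or_ne z 0 with rfl | hz0
    · simp
    · simp only [hf, hg]
      have hne : Complex.sin (Real.pi * z) ≠ 0 := by
        rw [Complex.sin_ne_zero_iff]
        intro k hk
        have hpi : (Real.pi : ℂ) ≠ 0 := by exact_mod_cast Real.pi_ne_zero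
        have hzk : z = k := mul_left_cancel₀ hpi (by rw [hk]; ring)
        rw [hzk, Complex.norm_intCast] at hz
        have hk0 : k ≠ 0 := by rintro rfl; simp [hzk] at hz0
        have : (1 : ℝ) ≤ |(k : ℝ)| := by exact_mod_cast Int.one_le_abs hk0
        linarith
      rw [add_comm, Complex.Gamma_add_one z hz0, mul_assoc z, Complex.Gamma_mul_Gamma_one_sub,
        mul_assoc, div_mul_cancel₀ _ hne, mul_comm]
  have hfg : ContDiffAt ℂ (3 : ℕ) (fun z => f z * g z) 0 := hf3.mul hg3
  have h3 := hid.iteratedDeriv_eq 3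
  have hF : ∀ k, iteratedDeriv k f 0 = iteratedDeriv k Complex.Gamma 1 := fun k => by
    rw [hf, iteratedDeriv_comp_const_add]; simp
  have hG : ∀ k, iteratedDeriv k g 0 = (-1) ^ k * iteratedDeriv k Complex.Gamma 1 := fun k => by
    rw [hg, iteratedDeriv_comp_const_sub]; simp
  have hS : ∀ k, iteratedDeriv k (fun z : ℂ => Complex.sin (Real.pi * z)) 0 =
      (Real.pi : ℂ) ^ k * iteratedDeriv k Complex.sin 0 := fun k => by
    rw [iteratedDeriv_comp_const_mul Complex.contDiff_sin]; simp
  have hS1 : iteratedDeriv 1 Complex.sin 0 = 1 := by simp [iteratedDeriv_one]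
  have hS2 : iteratedDeriv 2 Complex.sin 0 = 0 := by
    simp [iteratedDeriv_succ, Complex.deriv_sin, Complex.deriv_cos']
  have hS3 : iteratedDeriv 3 Complex.sin 0 = -1 := by
    simp [iteratedDeriv_succ, Complex.deriv_sin, Complex.deriv_cos']
  rw [iteratedDeriv_fun_mul hfg hs, iteratedDeriv_const_mul_field] at h3
  simp only [Finset.sum_range_succ, Finset.sum_range_zero] at h3
  rw [iteratedDeriv_fun_mul (hf3.of_le (by norm_num)) (hg3.of_le (by norm_num)),
    iteratedDeriv_fun_mul (hf3.of_le (by norm_num)) (hg3.of_le (by norm_num)),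
    iteratedDeriv_fun_mul (hf3.of_le (by norm_num)) (hg3.of_le (by norm_num))] at h3
  simp only [Finset.sum_range_succ, Finset.sum_range_zero, hF, hG, hS, hS1, hS2, hS3] at h3
  simp [iteratedDeriv_one, Complex.hasDerivAt_Gamma_one.deriv, iteratedDeriv_fun_id] at h3
  have hpi : (Real.pi : ℂ) ≠ 0 := by exact_mod_cast Real.pi_ne_zero
  refine mul_left_cancel₀ (mul_ne_zero (by norm_num : (6 : ℂ) ≠ 0) hpi) ?_
  linear_combination h3

/-- The kernel `e ^ (-t) - e ^ (-at)`. -/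
noncomputable def expDiff (a t : ℝ) : ℝ := Real.exp (-t) - Real.exp (-(a * t))

/-- The Mellin transform of `(log t) ^ j (e ^ (-t) - e ^ (-at))`. -/
noncomputable def logMellin (a : ℝ) (j : ℕ) : ℂ → ℂ :=
  mellin fun t => ((Real.log t ^ j * expDiff a t : ℝ) : ℂ)

theorem expDiff_nonneg {a t : ℝ} (ha : 1 ≤ a) (ht : 0 ≤ t) : 0 ≤ expDiff a t := by
  rw [expDiff, sub_nonneg]
  apply Real.exp_le_exp.2
  nlinarith

/-- Linear vanishing at `0` is what extends convergence of the Mellin integral to `re s > -1`, a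
half-plane containing the imaginary axis with all the Fourier points. -/
theorem expDiff_le_mul {a t : ℝ} (ha : 1 ≤ a) (ht : 0 ≤ t) : expDiff a t ≤ (a - 1) * t := by
  have h := abs_of_nonneg (expDiff_nonneg ha ht)
  rw [← h, expDiff]
  have h1 : Real.exp (-(a * t)) = Real.exp (-t) * Real.exp (-((a - 1) * t)) := by
    rw [← Real.exp_add]; ring_nf
  have h2 := Real.add_one_le_exp (-((a - 1) * t))
  have h3 : Real.exp (-t) ≤ 1 := Real.exp_le_one_iff.2 (by linarith)
  have h4 := Real.exp_pos (-t)
  have h5 : Real.exp (-((a - 1) * t)) ≤ 1 := Real.exp_le_one_iff.2 (by nlinarith)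
  rw [h1, abs_of_nonneg (by nlinarith)]
  nlinarith

theorem expDiff_le_exp (a t : ℝ) : expDiff a t ≤ Real.exp (-t) := by
  rw [expDiff]; linarith [Real.exp_pos (-(a * t))]

theorem expDiff_isBigO_top {a : ℝ} (ha : 1 ≤ a) (c : ℝ) (j : ℕ) :
    (fun t => ((Real.log t ^ j * expDiff a t : ℝ) : ℂ)) =O[atTop] (· ^ (-c) : ℝ → ℝ) := by
  induction j generalizing c with
  | zero =>
    have h1 : (fun t => ((Real.log t ^ 0 * expDiff a t : ℝ) : ℂ)) =O[atTop]
        fun t => Real.exp (-1 * t) := by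
      refine IsBigO.of_bound 1 ?_
      filter_upwards [eventually_ge_atTop 0] with t ht
      rw [Complex.norm_real, pow_zero, one_mul, Real.norm_of_nonneg (expDiff_nonneg ha ht),
        Real.norm_of_nonneg (Real.exp_pos _).le, one_mul, neg_one_mul]
      exact expDiff_le_exp a t
    exact h1.trans (isLittleO_exp_neg_mul_rpow_atTop one_pos _).isBigO
  | succ j ih =>
    refine (isBigO_rpow_top_log_smul (by linarith : c < c + 1) (ih (c + 1))).congr_left fun t => ?_
    rw [Complex.real_smul]; push_cast; ring

theorem expDiff_isBigO_zero {a : ℝ} (ha : 1 ≤ a) {c : ℝ} (hc : -1 < c) (j : ℕ) :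
    (fun t => ((Real.log t ^ j * expDiff a t : ℝ) : ℂ)) =O[𝓝[>] 0] (· ^ (-c) : ℝ → ℝ) := by
  induction j generalizing c with
  | zero =>
    refine IsBigO.of_bound (a - 1) ?_
    filter_upwards [Ioo_mem_nhdsGT (zero_lt_one (α := ℝ))] with t ht
    rw [Complex.norm_real, pow_zero, one_mul, Real.norm_of_nonneg (expDiff_nonneg ha ht.1.le),
      Real.norm_of_nonneg (Real.rpow_nonneg ht.1.le _)]
    refine (expDiff_le_mul ha ht.1.le).trans ?_
    have : t ≤ t ^ (-c) := Real.self_le_rpow_of_le_one ht.1.le ht.2.le (by linarith)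
    have h0 : 0 ≤ a - 1 := by linarith
    gcongr
  | succ j ih =>
    obtain ⟨c', h1, h2⟩ := exists_between hc
    refine (isBigO_rpow_zero_log_smul h2 (ih h1)).congr_left fun t => ?_
    rw [Complex.real_smul]; push_cast; ring

theorem hasDerivAt_logMellin {a : ℝ} (ha : 1 ≤ a) (j : ℕ) {s : ℂ} (hs : -1 < s.re) :
    HasDerivAt (logMellin a j) (logMellin a (j + 1) s) s := by
  obtain ⟨c, h1, h2⟩ := exists_between hs
  have hcont : ContinuousOn (fun t => ((Real.log t ^ j * expDiff a t : ℝ) : ℂ)) (Set.Ioi 0) := by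
    refine Complex.continuous_ofReal.comp_continuousOn (ContinuousOn.mul ?_ ?_)
    · exact (Real.continuousOn_log.mono fun t (ht : 0 < t) => ht.ne').pow j
    · unfold expDiff; fun_prop
  have h := (mellin_hasDerivAt_of_isBigO_rpow (s := s)
    (hcont.locallyIntegrableOn measurableSet_Ioi) (expDiff_isBigO_top ha (s.re + 1) j)
    (by linarith) (expDiff_isBigO_zero ha h1 j) h2).2
  convert! h using 2
  rw [logMellin]
  congr 1
  ext t
  rw [Complex.real_smul]; push_cast; ring

theorem logMellin_zero_of_re_pos {a : ℝ} (ha : 0 < a) {s : ℂ} (hs : 0 < s.re) :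
    logMellin a 0 s = Complex.Gamma s * (1 - Complex.exp (-(Real.log a) * s)) := by
  have ha' : (a : ℂ) ≠ 0 := by exact_mod_cast ha.ne'
  have e1 : ∀ c : ℝ, 0 < c → MellinConvergent (fun t : ℝ => ((Real.exp (-(c * t)) : ℝ) : ℂ)) s ∧
      mellin (fun t : ℝ => ((Real.exp (-(c * t)) : ℝ) : ℂ)) s =
        Complex.exp (-(Real.log c) * s) * Complex.Gamma s := fun c hc => by
    have h0 : MellinConvergent (fun t : ℝ => ((Real.exp (-t) : ℝ) : ℂ)) s := by
      have := Complex.GammaIntegral_convergent hs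
      refine this.congr_fun (fun t _ => ?_) measurableSet_Ioi
      simp [mul_comm]
    refine ⟨(MellinConvergent.comp_mul_left
      (f := fun t : ℝ => ((Real.exp (-t) : ℝ) : ℂ)) hc).2 h0, ?_⟩
    have := mellin_comp_mul_left (fun t : ℝ => ((Real.exp (-t) : ℝ) : ℂ)) s hc
    rw [this, ← Complex.GammaIntegral_eq_mellin, ← Complex.Gamma_eq_integral hs,
      Complex.cpow_def_of_ne_zero (by exact_mod_cast hc.ne'), ← Complex.ofReal_log hc.le, smul_eq_mul]
    ring_nf
  have h := hasMellin_sub (e1 1 one_pos).1 (e1 a ha).1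
  have h2 := h.2
  rw [(e1 1 one_pos).2, (e1 a ha).2] at h2
  rw [logMellin]
  convert! h2 using 1
  · congr 1; ext t; simp [expDiff]
  · simp; ring

/-- `s K(s) = Γ(s + 1) (1 - a ^ (-s))` for the Mellin transform `K` of `expDiff a`. -/
theorem mul_logMellin_zero {a : ℝ} (ha : 1 ≤ a) {s : ℂ} (hs : -1 < s.re) :
    s * logMellin a 0 s = Complex.Gamma (1 + s) * (1 - Complex.exp (-(Real.log a) * s)) := by
  have hopen : IsOpen {s : ℂ | -1 < s.re} := isOpen_lt continuous_const Complex.continuous_re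
  have hconv : Convex ℝ {s : ℂ | -1 < s.re} := convex_halfSpace_re_gt (-1)
  have hf : AnalyticOnNhd ℂ (fun s => s * logMellin a 0 s) {s : ℂ | -1 < s.re} := by
    refine DifferentiableOn.analyticOnNhd (fun z hz => ?_) hopen
    exact (differentiableAt_id.mul
      (hasDerivAt_logMellin ha 0 hz).differentiableAt).differentiableWithinAt
  have hg : AnalyticOnNhd ℂ (fun s => Complex.Gamma (1 + s) *
      (1 - Complex.exp (-(Real.log a) * s))) {s : ℂ | -1 < s.re} := by
    refine DifferentiableOn.analyticOnNhd (fun z hz => ?_) hopen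
    have h1 : DifferentiableAt ℂ (fun s => Complex.Gamma (1 + s)) z := by
      have h2 := differentiableAt_Gamma_of_re_pos (s := 1 + z)
        (by simp only [Set.mem_ofPred_eq] at hz; simp; linarith)
      exact h2.comp z (by fun_prop : DifferentiableAt ℂ (fun s => 1 + s) z)
    exact (h1.mul (by fun_prop)).differentiableWithinAt
  -- For `re s > 0` the two exponentials can be integrated separately. Multiplying by `s` removes
  -- the pole of `Γ`, and the identity theorem carries the formula to `re s > -1`.
  refine hf.eqOn_of_preconnected_of_eventuallyEq hg hconv.isPreconnected
    (show (1 : ℂ) ∈ {s : ℂ | -1 < s.re} by simp) ?_ hs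
  have : ∀ᶠ z : ℂ in 𝓝 1, 0 < z.re :=
    Complex.continuous_re.continuousAt.eventually_const_lt (by simp)
  filter_upwards [this] with z hz
  have hz0 : z ≠ 0 := by rintro rfl; simp at hz
  rw [logMellin_zero_of_re_pos (by linarith) hz, add_comm 1 z, Complex.Gamma_add_one z hz0]
  ring

theorem iteratedDeriv_one_sub_cexp (c s : ℂ) (n : ℕ) :
    iteratedDeriv (n + 1) (fun s => 1 - Complex.exp (-c * s)) s =
      -((-c) ^ (n + 1) * Complex.exp (-c * s)) := by
  rw [iteratedDeriv_const_sub (Nat.succ_pos n), iteratedDeriv_neg, iteratedDeriv_cexp_const_mul]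

theorem iteratedDeriv_logMellin {a : ℝ} (ha : 1 ≤ a) {s : ℂ} (hs : -1 < s.re) (k : ℕ) :
    iteratedDeriv k (logMellin a 0) s = logMellin a k s := by
  induction k generalizing s with
  | zero => simp
  | succ k ih =>
    rw [iteratedDeriv_succ]
    have : iteratedDeriv k (logMellin a 0) =ᶠ[𝓝 s] logMellin a k := by
      filter_upwards [(isOpen_lt continuous_const Complex.continuous_re).mem_nhds hs] with z hz
      exact ih hz
    rw [this.deriv_eq, (hasDerivAt_logMellin ha k hs).deriv]

theorem contDiffAt_logMellin {a : ℝ} (ha : 1 ≤ a) {s : ℂ} (hs : -1 < s.re) (n : ℕ) :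
    ContDiffAt ℂ n (logMellin a 0) s := by
  have : AnalyticAt ℂ (logMellin a 0) s := by
    rw [Complex.analyticAt_iff_eventually_differentiableAt]
    filter_upwards [(isOpen_lt continuous_const Complex.continuous_re).mem_nhds hs] with z hz
    exact (hasDerivAt_logMellin ha 0 hz).differentiableAt
  exact this.contDiffAt.of_le (by exact_mod_cast le_top)

/-- At `s = 0` the `n`-th derivative of `s K(s)` is `n K^(n-1)(0)`. Leibniz' rule for `Γ(1 + s)(1 -
a^(-s))` with `n = 1, 2, 3` therefore yields the three values. -/
theorem logMellin_at_zero {a : ℝ} (ha : 1 ≤ a) :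
    logMellin a 0 0 = Real.log a ∧
    logMellin a 1 0 = -(Real.eulerMascheroniConstant * Real.log a) - (Real.log a : ℂ) ^ 2 / 2 ∧
    logMellin a 2 0 = Real.log a * ((Real.eulerMascheroniConstant : ℂ) ^ 2 +
      (Real.pi : ℂ) ^ 2 / 6) + Real.eulerMascheroniConstant * (Real.log a : ℂ) ^ 2 +
      (Real.log a : ℂ) ^ 3 / 3 := by
  have h0 : (-1 : ℝ) < (0 : ℂ).re := by simp
  set E : ℂ → ℂ := fun s => 1 - Complex.exp (-(Real.log a) * s) with hE
  have hid : (fun s => s * logMellin a 0 s) =ᶠ[𝓝 0] fun s => Complex.Gamma (1 + s) * E s := by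
    filter_upwards [(isOpen_lt continuous_const Complex.continuous_re).mem_nhds h0] with z hz
    exact mul_logMellin_zero ha hz
  have hEc : ∀ n : ℕ, ContDiffAt ℂ n E 0 := fun n => by fun_prop
  have hG : ∀ k, iteratedDeriv k (fun s => Complex.Gamma (1 + s)) 0 =
      iteratedDeriv k Complex.Gamma 1 := fun k => by
    rw [iteratedDeriv_comp_const_add]; simp
  have key : ∀ n, _ := fun n : ℕ => hid.iteratedDeriv_eq n
  have hL := fun n : ℕ => iteratedDeriv_fun_mul (n := n) (f := fun z : ℂ => z)
    contDiffAt_id (contDiffAt_logMellin ha h0 n)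
  have hR := fun n : ℕ => iteratedDeriv_fun_mul (n := n)
    (contDiffAt_Gamma_one_add (n := n)) (hEc n)
  have k1 := key 1
  have k2 := key 2
  have k3 := key 3
  rw [hL, hR] at k1 k2 k3
  simp only [Finset.sum_range_succ, Finset.sum_range_zero, hG, iteratedDeriv_fun_id,
    iteratedDeriv_logMellin ha h0, hE, iteratedDeriv_one_sub_cexp,
    iteratedDeriv_two_Gamma_one] at k1 k2 k3
  simp [iteratedDeriv_one, Complex.hasDerivAt_Gamma_one.deriv] at k1 k2 k3
  exact ⟨k1, by linear_combination k2 / 2, by linear_combination k3 / 3⟩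

/-- Away from the real axis `K = Γ · (1 - a^(-s))`. Where `a^(-s) = 1`, Leibniz' rule keeps only
terms in which the second factor is differentiated, so `K''` involves no derivative of `Γ` beyond
the first. -/
theorem logMellin_of_im_ne_zero {a : ℝ} (ha : 1 ≤ a) {s : ℂ} (hs : -1 < s.re) (hs' : s.im ≠ 0)
    (he : Complex.exp (-(Real.log a) * s) = 1) :
    logMellin a 0 s = 0 ∧ logMellin a 1 s = Real.log a * Complex.Gamma s ∧
    logMellin a 2 s = 2 * Real.log a * deriv Complex.Gamma s -
      (Real.log a : ℂ) ^ 2 * Complex.Gamma s := by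
  set E : ℂ → ℂ := fun s => 1 - Complex.exp (-(Real.log a) * s) with hE
  have himn : ∀ᶠ z : ℂ in 𝓝 s, z.im ≠ 0 :=
    Complex.continuous_im.continuousAt.eventually_ne hs'
  have hid : logMellin a 0 =ᶠ[𝓝 s] fun s => Complex.Gamma s * E s := by
    filter_upwards [(isOpen_lt continuous_const Complex.continuous_re).mem_nhds hs, himn]
      with z hz hz'
    have hz0 : z ≠ 0 := by rintro rfl; simp at hz'
    have h := mul_logMellin_zero ha hz
    rw [add_comm 1 z, Complex.Gamma_add_one z hz0, mul_assoc] at h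
    exact mul_left_cancel₀ hz0 h
  have hΓ : ContDiffAt ℂ (2 : ℕ) Complex.Gamma s := by
    have : AnalyticAt ℂ Complex.Gamma s := by
      rw [Complex.analyticAt_iff_eventually_differentiableAt]
      exact himn.mono fun z hz => Complex.differentiableAt_Gamma z (ne_neg_nat_of_im_ne_zero hz)
    exact this.contDiffAt.of_le (by exact_mod_cast le_top)
  have hEc : ContDiffAt ℂ (2 : ℕ) E s := by fun_prop
  have k0 := hid.eq_of_nhds
  have k1 := hid.iteratedDeriv_eq 1
  have k2 := hid.iteratedDeriv_eq 2
  rw [iteratedDeriv_fun_mul (hΓ.of_le (by norm_num)) (hEc.of_le (by norm_num)),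
    iteratedDeriv_logMellin ha hs] at k1
  rw [iteratedDeriv_fun_mul hΓ hEc, iteratedDeriv_logMellin ha hs] at k2
  simp only [Finset.sum_range_succ, Finset.sum_range_zero, hE, iteratedDeriv_one_sub_cexp,
    he] at k0 k1 k2
  rw [neg_mul] at he
  simp [iteratedDeriv_one, he] at k0 k1 k2
  refine ⟨k0, by rw [k1, mul_comm], by rw [k2]; ring⟩

end Gamma

/-! ### Masses of the limit law, Poisson summation and the fluctuations -/

/-- The mass `exp (-a ^ (-u)) - exp (-a ^ (1 - u))`. -/
noncomputable def mass (a u : ℝ) : ℝ := expDiff a (Real.exp (-(Real.log a * u)))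

theorem mass_nonneg {a : ℝ} (ha : 1 ≤ a) (u : ℝ) : 0 ≤ mass a u :=
  expDiff_nonneg ha (Real.exp_pos _).le

theorem continuous_mass (a : ℝ) : Continuous (mass a) := by
  unfold mass expDiff; fun_prop

theorem mass_le {a : ℝ} (ha : 1 < a) (u : ℝ) : mass a u ≤ a * Real.exp (-(Real.log a * |u|)) := by
  rcases le_total 0 u with hu | hu
  · rw [abs_of_nonneg hu]
    refine (expDiff_le_mul ha.le (Real.exp_pos _).le).trans ?_
    gcongr
    linarith
  · rw [abs_of_nonpos hu, mass, mul_neg, neg_neg]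
    have h1 : Real.exp (-Real.exp (-(Real.log a * u))) ≤ Real.exp (Real.log a * u) := by
      apply Real.exp_le_exp.2
      have := Real.add_one_le_exp (-(Real.log a * u))
      linarith
    refine (expDiff_le_exp _ _).trans (h1.trans ?_)
    exact le_mul_of_one_le_left (Real.exp_pos _).le ha.le

theorem exists_pow_mul_mass_le {a : ℝ} (ha : 1 < a) (m : ℕ) :
    ∃ C, 0 ≤ C ∧ ∀ u, |u| ^ m * mass a u ≤ C := by
  have hL : 0 < Real.log a := Real.log_pos ha
  refine ⟨a * (m.factorial / Real.log a ^ m), by positivity, fun u => ?_⟩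
  have h1 := Real.pow_div_factorial_le_exp _ (mul_nonneg hL.le (abs_nonneg u)) m
  rw [div_le_iff₀ (by positivity), mul_pow] at h1
  calc |u| ^ m * mass a u ≤ |u| ^ m * (a * Real.exp (-(Real.log a * |u|))) := by
        gcongr; exact mass_le ha u
    _ = a * (Real.log a ^ m * |u| ^ m / Real.exp (Real.log a * |u|) / Real.log a ^ m) := by
        rw [Real.exp_neg]; field_simp
    _ ≤ _ := by
        gcongr
        rw [div_le_iff₀ (Real.exp_pos _), mul_comm]
        linarith

theorem exists_abs_pow_mul_mass_le {a : ℝ} (ha : 1 < a) (j : ℕ) :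
    ∃ C, 0 ≤ C ∧ ∀ u, |u ^ j * mass a u| ≤ C / (1 + u ^ 2) := by
  obtain ⟨C, hC, h⟩ := exists_pow_mul_mass_le ha j
  obtain ⟨C', hC', h'⟩ := exists_pow_mul_mass_le ha (j + 2)
  refine ⟨C + C', by positivity, fun u => ?_⟩
  rw [le_div_iff₀ (by positivity), abs_mul, abs_pow, abs_of_nonneg (mass_nonneg ha.le u)]
  have h1 := h u
  have h2 := h' u
  rw [pow_add, sq_abs] at h2
  linarith

theorem summable_one_div_one_add_sq : Summable fun k : ℤ => 1 / (1 + (k : ℝ) ^ 2) := by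
  refine Summable.of_norm_bounded_eventually (Real.summable_one_div_int_pow.2 one_lt_two) ?_
  have : ∀ᶠ k : ℤ in cofinite, k ≠ 0 := (Set.finite_singleton 0).compl_mem_cofinite
  filter_upwards [this] with k hk
  have : (k : ℝ) ≠ 0 := by exact_mod_cast hk
  rw [Real.norm_of_nonneg (by positivity)]
  gcongr
  linarith

/-- A bound for the shifted masses that is uniform for bounded shifts. -/
theorem exists_abs_pow_mul_mass_sub_le {a : ℝ} (ha : 1 < a) (j : ℕ) (R : ℝ) :
    ∃ C, 0 ≤ C ∧ ∀ x, |x| ≤ R → ∀ k : ℤ,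
      |((k : ℝ) - x) ^ j * mass a (k - x)| ≤ C * (1 / (1 + (k : ℝ) ^ 2)) := by
  obtain ⟨C, hC, h⟩ := exists_abs_pow_mul_mass_le ha j
  refine ⟨C * (2 * (1 + R ^ 2)), by positivity, fun x hx k => (h _).trans ?_⟩
  rw [mul_one_div, div_le_div_iff₀ (by positivity) (by positivity), mul_assoc]
  gcongr
  have h1 : x ^ 2 ≤ R ^ 2 := by rw [← sq_abs]; gcongr
  have h2 : 1 + (k : ℝ) ^ 2 ≤ 2 * (1 + x ^ 2) * (1 + (k - x) ^ 2) := by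
    nlinarith [sq_nonneg (x * (k - x)), sq_nonneg ((k : ℝ) - 2 * x)]
  refine h2.trans ?_
  gcongr

theorem summable_pow_mul_mass {a : ℝ} (ha : 1 < a) (j : ℕ) (x : ℝ) :
    Summable fun k : ℤ => ((k : ℝ) - x) ^ j * mass a (k - x) := by
  obtain ⟨C, -, h⟩ := exists_abs_pow_mul_mass_sub_le ha j |x|
  exact Summable.of_norm_bounded (summable_one_div_one_add_sq.mul_left C) (h x le_rfl)

/-- The moments `∑ (k - x) ^ j p(k - x)`. -/
noncomputable def massMoment (a : ℝ) (j : ℕ) (x : ℝ) : ℝ :=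
  ∑' k : ℤ, ((k : ℝ) - x) ^ j * mass a (k - x)

open FourierTransform in
-- The substitution `t = a^(-u)` turns `mass` into `expDiff` and `-(log a) u` into `log t`, so this
-- Fourier transform is a Mellin transform on the imaginary axis.
theorem fourier_mass {a : ℝ} (ha : 1 < a) (j : ℕ) (n : ℤ) :
    𝓕 (fun u : ℝ => (((-(Real.log a * u)) ^ j * mass a u : ℝ) : ℂ)) n =
      (Real.log a : ℂ)⁻¹ * logMellin a j (fourierPoint a (-n)) := by
  have hL : 0 < Real.log a := Real.log_pos ha
  set f : ℝ → ℂ := fun t => ((Real.log t ^ j * expDiff a t : ℝ) : ℂ) with hf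
  have h1 := mellin_comp_rpow f (2 * Real.pi * Complex.I * n) (Real.log a)
  have h2 := mellin_eq_fourier (fun t => f (t ^ Real.log a)) (s := 2 * Real.pi * Complex.I * n)
  rw [h1] at h2
  have h3 : (2 * Real.pi * Complex.I * n : ℂ).im / (2 * Real.pi) = n := by
    have : (2 * Real.pi * Complex.I * n : ℂ) = ((2 * Real.pi * n : ℝ) : ℂ) * Complex.I := by
      push_cast; ring
    rw [this, Complex.im_ofReal_mul, Complex.I_im]
    field_simp
  have h4 : (2 * Real.pi * Complex.I * n : ℂ).re = 0 := by
    have : (2 * Real.pi * Complex.I * n : ℂ) = ((2 * Real.pi * n : ℝ) : ℂ) * Complex.I := by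
      push_cast; ring
    rw [this]; simp
  rw [h3, h4] at h2
  have h5 : (2 * Real.pi * Complex.I * n : ℂ) / (Real.log a : ℂ) = fourierPoint a (-n) := by
    rw [fourierPoint]; push_cast; ring
  rw [h5, abs_of_pos hL, Complex.real_smul] at h2
  have h6 : (fun u : ℝ => Real.exp (-0 * u) • f (Real.exp (-u) ^ Real.log a)) =
      fun u : ℝ => (((-(Real.log a * u)) ^ j * mass a u : ℝ) : ℂ) := by
    ext u
    simp only [neg_zero, zero_mul, Real.exp_zero, one_smul, hf, mass]
    rw [← Real.exp_mul, Real.log_exp]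
    ring_nf
  rw [h6] at h2
  rw [logMellin, ← Complex.ofReal_inv, ← h2]

/-- Poisson summation for the moments. -/
theorem hasSum_massMoment {a : ℝ} (ha : 1 < a) (j : ℕ)
    (hs : Summable fun n : ℤ => logMellin a j (fourierPoint a n)) (x : ℝ) :
    HasSum (fun n : ℤ => (Real.log a : ℂ)⁻¹ * logMellin a j (fourierPoint a n) *
      Complex.exp (2 * n * Real.pi * Complex.I * x))
      (((-Real.log a) ^ j * massMoment a j x : ℝ) : ℂ) := by
  have hL : 0 < Real.log a := Real.log_pos ha
  set f : ℝ → ℂ := fun u => (((-(Real.log a * u)) ^ j * mass a u : ℝ) : ℂ) with hf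
  have hc : Continuous f := by
    have := continuous_mass a
    fun_prop
  obtain ⟨C, hC, hbound⟩ := exists_abs_pow_mul_mass_le ha j
  have hO : f =O[cocompact ℝ] fun x : ℝ => |x| ^ (-2 : ℝ) := by
    refine IsBigO.of_bound (Real.log a ^ j * C) ?_
    have h0 : ∀ᶠ u : ℝ in cocompact ℝ, u ≠ 0 := by
      filter_upwards [(isCompact_singleton (x := (0 : ℝ))).compl_mem_cocompact] with u hu using hu
    filter_upwards [h0] with u hu
    have h1 := hbound u
    have hupos : 0 < |u| := abs_pos.2 hu
    rw [Complex.norm_real, Real.norm_eq_abs, ← mul_neg, mul_pow, mul_assoc, abs_mul,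
      abs_of_pos (pow_pos hL j), Real.norm_of_nonneg (by positivity), Real.rpow_neg hupos.le,
      Real.rpow_two, sq_abs, mul_assoc]
    gcongr
    have h2 : |(-u) ^ j * mass a u| = |u ^ j * mass a u| := by
      rw [abs_mul, abs_pow, abs_neg, ← abs_pow, ← abs_mul]
    rw [h2]
    refine h1.trans ?_
    rw [← div_eq_mul_inv]
    gcongr
    linarith
  have hFs : Summable fun n : ℤ => FourierTransform.fourier f n := by
    refine ((hs.mul_left (Real.log a : ℂ)⁻¹).comp_injective neg_injective).congr fun n => ?_
    rw [hf, fourier_mass ha]; rfl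
  -- Poisson summation is applied at `-x`, since the masses sit at `k - x`; the resulting
  -- frequencies are then reflected by `n ↦ -n`.
  have key := Real.tsum_eq_tsum_fourier_of_rpow_decay_of_summable hc one_lt_two hO hFs (-x)
  have hsum : ∑' n : ℤ, f (-x + n) = (((-Real.log a) ^ j * massMoment a j x : ℝ) : ℂ) := by
    rw [massMoment, ← tsum_mul_left, Complex.ofReal_tsum]
    refine tsum_congr fun k => ?_
    simp only [hf]
    rw [show -x + (k : ℝ) = k - x by ring, ← mul_assoc, ← mul_pow]
    ring_nf
  have hterm : ∀ n : ℤ, FourierTransform.fourier f (-n : ℤ) *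
      fourier (-n) ((-x : ℝ) : UnitAddCircle) =
      (Real.log a : ℂ)⁻¹ * logMellin a j (fourierPoint a n) *
        Complex.exp (2 * n * Real.pi * Complex.I * x) := fun n => by
    rw [hf, fourier_mass ha, fourier_coe_apply, neg_neg]
    congr 2
    push_cast
    ring
  rw [hsum] at key
  have hs' : Summable fun n : ℤ => (Real.log a : ℂ)⁻¹ * logMellin a j (fourierPoint a n) *
        Complex.exp (2 * n * Real.pi * Complex.I * x) := by
    refine Summable.of_norm_bounded (hs.norm.mul_left ‖(Real.log a : ℂ)⁻¹‖) fun n => ?_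
    rw [norm_mul, norm_mul]
    have : ‖Complex.exp (2 * n * Real.pi * Complex.I * x)‖ = 1 := by
      rw [show (2 * n * Real.pi * Complex.I * x : ℂ) = ((2 * n * Real.pi * x : ℝ) : ℂ) * Complex.I by
        push_cast; ring, Complex.norm_exp_ofReal_mul_I]
    rw [this, mul_one]
  rw [key, ← (Equiv.neg ℤ).tsum_eq]
  simp only [Equiv.neg_apply]
  rw [tsum_congr hterm]
  exact hs'.hasSum

theorem norm_cexp_two_pi (n : ℤ) (x : ℝ) :
    ‖Complex.exp (2 * n * Real.pi * Complex.I * x)‖ = 1 := by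
  rw [show (2 * n * Real.pi * Complex.I * x : ℂ) = ((2 * n * Real.pi * x : ℝ) : ℂ) * Complex.I by
    push_cast; ring, Complex.norm_exp_ofReal_mul_I]

/-- A sum of an absolutely convergent Fourier series without constant term is a fluctuation. -/
theorem isFluctuation_of_hasSum {t : ℝ → ℤ → ℂ} {Ψ : ℝ → ℝ} {c : ℤ → ℂ}
    (ht : ∀ x n, t x n = c n * Complex.exp (2 * n * Real.pi * Complex.I * x))
    (hc : Summable fun n : {n : ℤ // n ≠ 0} => ‖c n‖)
    (h : ∀ x, HasSum (fun n : {n : ℤ // n ≠ 0} => t x n) (Ψ x : ℂ)) : IsFluctuation t Ψ := by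
  have hnorm : ∀ x n, ‖t x n‖ = ‖c n‖ := fun x n => by
    rw [ht, norm_mul, norm_cexp_two_pi, mul_one]
  refine ⟨h, ?_, fun x => ?_, ?_⟩
  · have h1 : Continuous fun x => ∑' n : {n : ℤ // n ≠ 0}, t x n := by
      refine continuous_tsum (fun n => ?_) hc fun n x => (hnorm x n).le
      simp_rw [ht]
      fun_prop
    have h2 : Ψ = fun x => (∑' n : {n : ℤ // n ≠ 0}, t x n).re := by
      ext x; rw [(h x).tsum_eq, Complex.ofReal_re]
    rw [h2]
    exact Complex.continuous_re.comp h1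
  · have h1 : ∀ n, t (x + 1) n = t x n := fun n => by
      rw [ht, ht]
      congr 1
      rw [Complex.exp_eq_exp_iff_exists_int]
      exact ⟨n, by push_cast; ring⟩
    have h2 := h (x + 1)
    simp_rw [h1] at h2
    exact_mod_cast h2.unique (h x)
  · have h1 := intervalIntegral.hasSum_integral_of_dominated_convergence
      (μ := volume) (a := 0) (b := 1) (F := fun (n : {n : ℤ // n ≠ 0}) x => t x n)
      (f := fun x => (Ψ x : ℂ)) (fun n _ => ‖c n‖)
      (fun n => by
        simp_rw [ht]
        exact Continuous.aestronglyMeasurable (by fun_prop))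
      (fun n => Eventually.of_forall fun x _ => (hnorm x n).le)
      (Eventually.of_forall fun x _ => hc)
      (by simp) (Eventually.of_forall fun x _ => h x)
    have h2 : ∀ n : {n : ℤ // n ≠ 0}, ∫ x in (0 : ℝ)..1, t x n = 0 := fun n => by
      have hn : (2 * (n : ℤ) * Real.pi * Complex.I : ℂ) ≠ 0 := by
        have h0 : ((n : ℤ) : ℂ) ≠ 0 := by exact_mod_cast n.2
        have hpi : (Real.pi : ℂ) ≠ 0 := by exact_mod_cast Real.pi_ne_zero
        simp [h0, hpi]
      simp_rw [ht]
      rw [intervalIntegral.integral_const_mul, integral_exp_mul_complex hn]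
      have : Complex.exp (2 * (n : ℤ) * Real.pi * Complex.I * ((1 : ℝ) : ℂ)) = 1 := by
        rw [Complex.exp_eq_one_iff]
        exact ⟨n, by push_cast; ring⟩
      rw [this]
      simp
    simp_rw [h2] at h1
    have h3 := h1.unique hasSum_zero
    rw [intervalIntegral.integral_ofReal] at h3
    exact_mod_cast h3

theorem fourierPoint_eq (a : ℝ) (n : ℤ) :
    fourierPoint a n = ((-(2 * n * Real.pi / Real.log a) : ℝ) : ℂ) * Complex.I := by
  rw [fourierPoint]; push_cast; ring

theorem fourierPoint_im_ne_zero {a : ℝ} (ha : 1 < a) {n : ℤ} (hn : n ≠ 0) :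
    (fourierPoint a n).im ≠ 0 := by
  have hL : 0 < Real.log a := Real.log_pos ha
  have hn' : (n : ℝ) ≠ 0 := by exact_mod_cast hn
  rw [fourierPoint_eq, Complex.im_ofReal_mul, Complex.I_im, mul_one]
  exact neg_ne_zero.2 (div_ne_zero (mul_ne_zero (mul_ne_zero two_ne_zero hn') Real.pi_ne_zero)
    hL.ne')

theorem exp_log_mul_fourierPoint {a : ℝ} (ha : 1 < a) (n : ℤ) :
    Complex.exp (-(Real.log a) * fourierPoint a n) = 1 := by
  have hL : (Real.log a : ℂ) ≠ 0 := by exact_mod_cast (Real.log_pos ha).ne'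
  rw [Complex.exp_eq_one_iff]
  refine ⟨n, ?_⟩
  rw [fourierPoint]
  field_simp

theorem logMellin_fourierPoint {a : ℝ} (ha : 1 < a) {n : ℤ} (hn : n ≠ 0) :
    logMellin a 0 (fourierPoint a n) = 0 ∧
    logMellin a 1 (fourierPoint a n) = Real.log a * Complex.Gamma (fourierPoint a n) ∧
    logMellin a 2 (fourierPoint a n) = 2 * Real.log a * deriv Complex.Gamma (fourierPoint a n) -
      (Real.log a : ℂ) ^ 2 * Complex.Gamma (fourierPoint a n) := by
  refine logMellin_of_im_ne_zero ha.le ?_ (fourierPoint_im_ne_zero ha hn)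
    (exp_log_mul_fourierPoint ha n)
  rw [fourierPoint_eq]; simp

theorem fourierPoint_zero (a : ℝ) : fourierPoint a 0 = 0 := by simp [fourierPoint]

theorem summable_Gamma_fourierPoint {a : ℝ} (ha : 1 < a) :
    (Summable fun n : {n : ℤ // n ≠ 0} => ‖Complex.Gamma (fourierPoint a n)‖) ∧
    Summable fun n : {n : ℤ // n ≠ 0} => ‖deriv Complex.Gamma (fourierPoint a n)‖ := by
  have hL : 0 < Real.log a := Real.log_pos ha
  have hpi := Real.pi_pos
  have ht₀ : 0 < 2 * Real.pi / Real.log a := by positivity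
  obtain ⟨M, -, h⟩ := exists_norm_Gamma_imaginary_le ht₀
  have hs : Summable fun n : {n : ℤ // n ≠ 0} =>
      M / (2 * Real.pi / Real.log a) ^ 2 * (1 / ((n : ℤ) : ℝ) ^ 2) :=
    ((Real.summable_one_div_int_pow.2 one_lt_two).subtype _).mul_left _
  have hb : ∀ n : {n : ℤ // n ≠ 0}, _ := fun n => h (-(2 * (n : ℤ) * Real.pi / Real.log a)) (by
    have : (1 : ℝ) ≤ |((n : ℤ) : ℝ)| := by exact_mod_cast Int.one_le_abs n.2
    rw [abs_neg, abs_div, abs_mul, abs_mul, abs_of_pos hL, abs_of_pos hpi, abs_two]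
    gcongr
    nlinarith)
  have he : ∀ n : {n : ℤ // n ≠ 0}, M / (-(2 * ((n : ℤ) : ℝ) * Real.pi / Real.log a)) ^ 2 =
      M / (2 * Real.pi / Real.log a) ^ 2 * (1 / ((n : ℤ) : ℝ) ^ 2) := fun n => by
    have : ((n : ℤ) : ℝ) ≠ 0 := by exact_mod_cast n.2
    field_simp
  refine ⟨Summable.of_nonneg_of_le (fun _ => norm_nonneg _) (fun n => ?_) hs,
    Summable.of_nonneg_of_le (fun _ => norm_nonneg _) (fun n => ?_) hs⟩
  · rw [fourierPoint_eq, ← he n]; exact (hb n).1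
  · rw [fourierPoint_eq, ← he n]; exact (hb n).2

theorem summable_of_subtype_ne_zero {f : ℤ → ℂ} (h : Summable fun n : {n : ℤ // n ≠ 0} => f n) :
    Summable f := by
  have : Summable (Set.indicator {n : ℤ | n ≠ 0} f) := (summable_subtype_iff_indicator).1 h
  refine (this.add (hasSum_ite_eq (0 : ℤ) (f 0)).summable).congr fun n => ?_
  by_cases hn : n = 0 <;> simp [hn]

theorem hasSum_subtype_ne_zero {f : ℤ → ℂ} {s : ℂ} (h : HasSum f s) :
    HasSum (fun n : {n : ℤ // n ≠ 0} => f n) (s - f 0) := by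
  have h1 := h.sub (hasSum_ite_eq (0 : ℤ) (f 0))
  refine (hasSum_subtype_iff_indicator (s := {n : ℤ | n ≠ 0})).2 (h1.congr_fun ?_)
  intro n
  by_cases hn : n = 0 <;> simp [hn]

theorem summable_logMellin {a : ℝ} (ha : 1 < a) :
    (Summable fun n : ℤ => logMellin a 0 (fourierPoint a n)) ∧
    (Summable fun n : ℤ => logMellin a 1 (fourierPoint a n)) ∧
    Summable fun n : ℤ => logMellin a 2 (fourierPoint a n) := by
  obtain ⟨h1, h2⟩ := summable_Gamma_fourierPoint ha
  refine ⟨summable_of_subtype_ne_zero ?_, summable_of_subtype_ne_zero ?_,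
    summable_of_subtype_ne_zero ?_⟩
  · exact summable_zero.congr fun n => (logMellin_fourierPoint ha n.2).1.symm
  · exact (h1.of_norm.mul_left _).congr fun n => (logMellin_fourierPoint ha n.2).2.1.symm
  · exact ((h2.of_norm.mul_left _).sub (h1.of_norm.mul_left _)).congr
      fun n => (logMellin_fourierPoint ha n.2).2.2.symm

/-- Every nonzero frequency drops out because `1 - a^(-s)` vanishes there; the zero frequency
contributes `log a / log a`. -/
theorem massMoment_zero {a : ℝ} (ha : 1 < a) (x : ℝ) : massMoment a 0 x = 1 := by
  have hL : (Real.log a : ℂ) ≠ 0 := by exact_mod_cast (Real.log_pos ha).ne'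
  have h := hasSum_subtype_ne_zero (hasSum_massMoment ha 0 (summable_logMellin ha).1 x)
  have h2 := h.unique (hasSum_zero.congr_fun fun n => by
    rw [(logMellin_fourierPoint ha n.2).1]; simp)
  rw [fourierPoint_zero, (logMellin_at_zero ha.le).1] at h2
  simp [hL] at h2
  exact_mod_cast sub_eq_zero.1 h2

/-- The fluctuation of the mean. -/
noncomputable def fluct₀ (a x : ℝ) : ℝ :=
  massMoment a 1 x - (Real.eulerMascheroniConstant / Real.log a + 1 / 2)

/-- The fluctuation of the second moment. -/
noncomputable def fluct₁ (a x : ℝ) : ℝ :=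
  massMoment a 2 x - fluct₀ a x - (Real.pi ^ 2 / (6 * Real.log a ^ 2) +
    Real.eulerMascheroniConstant ^ 2 / Real.log a ^ 2 + Real.eulerMascheroniConstant / Real.log a +
    1 / 3)

theorem hasSum_psi₀Term {a : ℝ} (ha : 1 < a) (x : ℝ) :
    HasSum (fun n : {n : ℤ // n ≠ 0} => psi₀Term a x n) (fluct₀ a x : ℂ) := by
  have hL : (Real.log a : ℂ) ≠ 0 := by exact_mod_cast (Real.log_pos ha).ne'
  have h := hasSum_subtype_ne_zero (hasSum_massMoment ha 1 (summable_logMellin ha).2.1 x)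
  rw [fourierPoint_zero, (logMellin_at_zero ha.le).2.1] at h
  convert! (h.mul_left (-(1 / (Real.log a : ℂ)))) using 1
  · funext n
    rw [(logMellin_fourierPoint ha n.2).2.1, psi₀Term]
    field_simp
  · simp only [fluct₀]
    push_cast
    simp only [mul_zero, zero_mul, Complex.exp_zero]
    field_simp
    ring

/-- The second derivative of the Mellin transform contributes a `Γ'` part and a `Γ` part. The latter
is exactly the expansion of `fluct₀`, which is why `fluct₁` subtracts it. -/
theorem hasSum_psi₁Term {a : ℝ} (ha : 1 < a) (x : ℝ) :
    HasSum (fun n : {n : ℤ // n ≠ 0} => psi₁Term a x n) (fluct₁ a x : ℂ) := by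
  have hL : (Real.log a : ℂ) ≠ 0 := by exact_mod_cast (Real.log_pos ha).ne'
  have h := hasSum_subtype_ne_zero (hasSum_massMoment ha 2 (summable_logMellin ha).2.2 x)
  rw [fourierPoint_zero, (logMellin_at_zero ha.le).2.2] at h
  convert! (h.mul_left (1 / (Real.log a : ℂ) ^ 2)).sub (hasSum_psi₀Term ha x) using 1
  · funext n
    rw [(logMellin_fourierPoint ha n.2).2.2, psi₁Term, psi₀Term]
    field_simp
    ring
  · simp only [fluct₁]
    push_cast
    simp only [mul_zero, zero_mul, Complex.exp_zero]
    field_simp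
    ring

theorem isFluctuation_fluct₀ {a : ℝ} (ha : 1 < a) : IsFluctuation (psi₀Term a) (fluct₀ a) :=
  isFluctuation_of_hasSum
    (c := fun n => -(1 / (Real.log a : ℂ)) * Complex.Gamma (fourierPoint a n))
    (fun x n => by rw [psi₀Term]; ring)
    (((summable_Gamma_fourierPoint ha).1.mul_left ‖-(1 / (Real.log a : ℂ))‖).congr fun n =>
      (norm_mul _ _).symm)
    (hasSum_psi₀Term ha)

theorem isFluctuation_fluct₁ {a : ℝ} (ha : 1 < a) : IsFluctuation (psi₁Term a) (fluct₁ a) :=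
  isFluctuation_of_hasSum
    (c := fun n => 2 / (Real.log a : ℂ) ^ 2 * deriv Complex.Gamma (fourierPoint a n))
    (fun x n => by rw [psi₁Term]; ring)
    (((summable_Gamma_fourierPoint ha).2.mul_left ‖2 / (Real.log a : ℂ) ^ 2‖).congr fun n =>
      (norm_mul _ _).symm)
    (hasSum_psi₁Term ha)

/-! ### Laws on `ℕ` and comparison of their moments -/

/-- The mass at `k` of the distribution function `F` on `ℕ`. -/
noncomputable def pointMass (F : ℕ → ℝ) : ℕ → ℝ
  | 0 => F 0
  | k + 1 => F (k + 1) - F k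

theorem sum_pointMass (F : ℕ → ℝ) (n : ℕ) : ∑ k ∈ Finset.range (n + 1), pointMass F k = F n := by
  induction n with
  | zero => simp [pointMass]
  | succ n ih => rw [Finset.sum_range_succ, ih, pointMass]; ring

theorem pointMass_nonneg {F : ℕ → ℝ} (hF : Monotone F) (h0 : 0 ≤ F 0) (k : ℕ) :
    0 ≤ pointMass F k := by
  cases k with
  | zero => exact h0
  | succ k => exact sub_nonneg.2 (hF k.le_succ)

/-- A finitely supported distribution function on `ℕ` belongs to a law. -/
theorem exists_law {F : ℕ → ℝ} (hF : Monotone F) (h0 : 0 ≤ F 0) {N : ℕ}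
    (hone : ∀ k, N < k → F k = 1) :
    ∃ P : ProbabilityMeasure ℕ, (∀ k, (P : Measure ℕ).real (Set.Iic k) = F k) ∧
      ∀ f : ℕ → ℝ, Integrable f (P : Measure ℕ) ∧
        HasSum (fun k => f k * pointMass F k) (∫ k, f k ∂(P : Measure ℕ)) := by
  have hz : ∀ k ∉ Finset.range (N + 2), pointMass F k = 0 := fun k hk => by
    rw [Finset.mem_range, not_lt] at hk
    obtain ⟨k, rfl⟩ := Nat.exists_eq_succ_of_ne_zero (by omega : k ≠ 0)
    rw [pointMass, hone _ (by omega), hone _ (by omega), sub_self]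
  set μ : Measure ℕ := ∑ k ∈ Finset.range (N + 2), ENNReal.ofReal (pointMass F k) • Measure.dirac k
    with hμ
  have hμ1 : IsProbabilityMeasure μ := by
    constructor
    rw [hμ, Measure.finsetSum_apply]
    simp only [Measure.smul_apply, measure_univ, smul_eq_mul, mul_one]
    rw [← ENNReal.ofReal_sum_of_nonneg fun k _ => pointMass_nonneg hF h0 k, sum_pointMass,
      hone _ (by omega), ENNReal.ofReal_one]
  have hint : ∀ f : ℕ → ℝ, ∀ k ∈ Finset.range (N + 2),
      Integrable f (ENNReal.ofReal (pointMass F k) • Measure.dirac k) := fun f k _ =>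
    (integrable_dirac (by simp)).smul_measure ENNReal.ofReal_ne_top
  have hsum : ∀ f : ℕ → ℝ, HasSum (fun k => f k * pointMass F k) (∫ k, f k ∂μ) := fun f => by
    have : ∫ k, f k ∂μ = ∑ k ∈ Finset.range (N + 2), f k * pointMass F k := by
      rw [hμ, integral_finsetSum_measure (hint f)]
      refine Finset.sum_congr rfl fun k _ => ?_
      rw [integral_smul_measure, integral_dirac,
        ENNReal.toReal_ofReal (pointMass_nonneg hF h0 k), smul_eq_mul, mul_comm]
    rw [this]
    exact hasSum_sum_of_ne_finset_zero fun k hk => by rw [hz k hk, mul_zero]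
  refine ⟨⟨μ, hμ1⟩, fun k => ?_, fun f =>
    ⟨integrable_finsetSum_measure.2 (hint f), hsum f⟩⟩
  have h1 := hsum ((Set.Iic k).indicator 1)
  rw [integral_indicator_one (measurableSet_Iic)] at h1
  have h2 : HasSum (fun i => (Set.Iic k).indicator 1 i * pointMass F i)
      (∑ i ∈ Finset.range (k + 1), (Set.Iic k).indicator 1 i * pointMass F i) :=
    hasSum_sum_of_ne_finset_zero fun i hi => by
      rw [Finset.mem_range, not_lt] at hi
      rw [Set.indicator_of_notMem (by simp; omega), zero_mul]
  refine (h1.unique h2).trans ?_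
  rw [← sum_pointMass F k]
  refine Finset.sum_congr rfl fun i hi => ?_
  rw [Finset.mem_range] at hi
  rw [Set.indicator_of_mem (by simp; omega), Pi.one_apply, one_mul]

/-- The distribution function `exp (-a ^ (-u))`. -/
noncomputable def gumbel (a u : ℝ) : ℝ := Real.exp (-Real.exp (-(Real.log a * u)))

theorem mass_eq_sub {a : ℝ} (ha : 0 < a) (u : ℝ) : mass a u = gumbel a u - gumbel a (u - 1) := by
  have : a * Real.exp (-(Real.log a * u)) = Real.exp (-(Real.log a * (u - 1))) := by
    nth_rewrite 1 [← Real.exp_log ha]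
    rw [← Real.exp_add]
    ring_nf
  rw [mass, expDiff, this, gumbel, gumbel]

theorem gumbel_nonneg (a u : ℝ) : 0 ≤ gumbel a u := (Real.exp_pos _).le

/-- The bound for the masses at the negative integers. -/
theorem exists_negTail_le {a : ℝ} (ha : 1 < a) (j : ℕ) :
    ∃ C, 0 ≤ C ∧ ∀ x, 0 ≤ x →
      (Summable fun k : ℕ => ((k : ℝ) + 1) ^ j * mass a (-((k : ℝ) + 1) - x)) ∧
      ∑' k : ℕ, ((k : ℝ) + 1) ^ j * mass a (-((k : ℝ) + 1) - x) ≤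
        C * Real.exp (-(Real.log a * x)) := by
  have hL : 0 < Real.log a := Real.log_pos ha
  set g : ℕ → ℝ := fun k => ((k : ℝ) + 1) ^ j * Real.exp (-Real.log a) ^ (k + 1) with hg
  have hs : Summable g := by
    have h1 := summable_pow_mul_geometric_of_norm_lt_one (R := ℝ) j
      (r := Real.exp (-Real.log a)) (by
        rw [Real.norm_of_nonneg (Real.exp_pos _).le]
        exact Real.exp_zero ▸ Real.exp_lt_exp.2 (neg_lt_zero.2 hL))
    refine ((summable_nat_add_iff 1).2 h1).congr fun k => ?_
    simp [hg]
  have hle : ∀ x, 0 ≤ x → ∀ k : ℕ, ((k : ℝ) + 1) ^ j * mass a (-((k : ℝ) + 1) - x) ≤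
      a * Real.exp (-(Real.log a * x)) * g k := fun x hx k => by
    have h1 := mass_le ha (-((k : ℝ) + 1) - x)
    have h2 : Real.exp (-(Real.log a * |-((k : ℝ) + 1) - x|)) =
        Real.exp (-(Real.log a * x)) * Real.exp (-Real.log a) ^ (k + 1) := by
      rw [abs_of_nonpos (by linarith [Nat.cast_nonneg (α := ℝ) k]), ← Real.exp_nat_mul,
        ← Real.exp_add]
      push_cast
      ring_nf
    rw [h2] at h1
    calc ((k : ℝ) + 1) ^ j * mass a (-((k : ℝ) + 1) - x)
        ≤ ((k : ℝ) + 1) ^ j *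
          (a * (Real.exp (-(Real.log a * x)) * Real.exp (-Real.log a) ^ (k + 1))) := by gcongr
      _ = _ := by simp only [hg]; ring
  have h0 : ∀ k, 0 ≤ g k := fun k => by positivity
  refine ⟨a * ∑' k, g k, mul_nonneg (by linarith) (tsum_nonneg h0), fun x hx => ?_⟩
  have hsx : Summable fun k : ℕ => ((k : ℝ) + 1) ^ j * mass a (-((k : ℝ) + 1) - x) :=
    Summable.of_nonneg_of_le (fun k => mul_nonneg (by positivity) (mass_nonneg ha.le _))
      (hle x hx) (hs.mul_left _)
  refine ⟨hsx, (hsx.tsum_le_tsum (hle x hx) (hs.mul_left _)).trans_eq ?_⟩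
  rw [tsum_mul_left]
  ring

/-- Comparison of a sum over a law on `ℕ` with the corresponding sum over the masses. -/
theorem abs_sub_tsum_mass_le {a : ℝ} (ha : 1 < a) {F : ℕ → ℝ} {x I : ℝ} {j : ℕ} (hj : j ≠ 0)
    (hx : 0 ≤ x) (hI : HasSum (fun k : ℕ => (k : ℝ) ^ j * pointMass F k) I)
    (hd : Summable fun k : ℕ => ((k : ℝ) + 1) ^ j * |F k - gumbel a (k - x)|) :
    (Summable fun k : ℤ => (k : ℝ) ^ j * mass a (k - x)) ∧
    |I - ∑' k : ℤ, (k : ℝ) ^ j * mass a (k - x)| ≤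
      ∑' k : ℕ, (((k : ℝ) + 1) ^ j - (k : ℝ) ^ j) * |F k - gumbel a (k - x)| +
      ∑' k : ℕ, ((k : ℝ) + 1) ^ j * mass a (-((k : ℝ) + 1) - x) := by
  have ha0 : 0 < a := by linarith
  set d : ℕ → ℝ := fun k => F k - gumbel a (k - x) with hdd
  have hmono : ∀ k : ℕ, (k : ℝ) ^ j ≤ ((k : ℝ) + 1) ^ j := fun k => by gcongr; linarith
  have hs1 : Summable fun k : ℕ => ((k : ℝ) + 1) ^ j * d k :=
    hd.of_norm_bounded_eventually_nat (Eventually.of_forall fun k => by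
      rw [norm_mul, Real.norm_of_nonneg (by positivity), Real.norm_eq_abs])
  have hs2 : Summable fun k : ℕ => (k : ℝ) ^ j * d k :=
    hd.of_norm_bounded_eventually_nat (Eventually.of_forall fun k => by
      rw [norm_mul, Real.norm_of_nonneg (by positivity), Real.norm_eq_abs]
      exact mul_le_mul_of_nonneg_right (hmono k) (abs_nonneg _))
  have hs3 : Summable fun k : ℕ => ((k : ℝ) + 1) ^ j * d (k + 1) := by
    refine ((summable_nat_add_iff 1).2 hs2).congr fun k => by push_cast; rfl
  -- The term at `k = 0` vanishes because `j ≠ 0`, so the summation by parts has no boundary term.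
  have hshift : ∑' k : ℕ, (k : ℝ) ^ j * d k = ∑' k : ℕ, ((k : ℝ) + 1) ^ j * d (k + 1) := by
    rw [hs2.tsum_eq_zero_add]
    simp [hj]
  have hI' : HasSum (fun k : ℕ => ((k : ℝ) + 1) ^ j * (F (k + 1) - F k)) I := by
    have := (hasSum_nat_add_iff' 1).2 hI
    simp [hj] at this
    exact this
  have hpos : ∀ k : ℕ, ((k : ℝ) + 1) ^ j * mass a (((k + 1 : ℕ) : ℝ) - x) =
      ((k : ℝ) + 1) ^ j * (F (k + 1) - F k) -
        (((k : ℝ) + 1) ^ j * d (k + 1) - ((k : ℝ) + 1) ^ j * d k) := fun k => by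
    rw [mass_eq_sub ha0]
    simp only [hdd]
    push_cast
    ring_nf
  have hS1 : HasSum (fun k : ℕ => ((k : ℝ) + 1) ^ j * mass a (((k + 1 : ℕ) : ℝ) - x))
      (I - (∑' k : ℕ, (k : ℝ) ^ j * d k - ∑' k : ℕ, ((k : ℝ) + 1) ^ j * d k)) := by
    rw [hshift]
    simp_rw [hpos]
    exact hI'.sub (hs3.hasSum.sub hs1.hasSum)
  have hS2 : HasSum (fun k : ℕ => (((k : ℕ) : ℤ) : ℝ) ^ j * mass a (((k : ℕ) : ℤ) - x))
      (I - (∑' k : ℕ, (k : ℝ) ^ j * d k - ∑' k : ℕ, ((k : ℝ) + 1) ^ j * d k)) := by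
    refine (hasSum_nat_add_iff' 1).1 ?_
    simpa [hj] using hS1
  obtain ⟨C, -, htail⟩ := exists_negTail_le ha j
  have hS3 : Summable fun k : ℕ => (((-((k : ℤ) + 1) : ℤ)) : ℝ) ^ j *
      mass a ((-((k : ℤ) + 1) : ℤ) - x) := by
    refine ((htail x hx).1.mul_left ((-1) ^ j)).congr fun k => ?_
    push_cast
    rw [← mul_assoc, ← mul_pow]
    ring_nf
  have hS := HasSum.of_nat_of_neg_add_one (f := fun k : ℤ => (k : ℝ) ^ j * mass a (k - x))
    hS2 hS3.hasSum
  refine ⟨hS.summable, ?_⟩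
  rw [hS.tsum_eq]
  -- Increments of `d` against `k^j` have become `d` against the increments of `k^j`.
  have e1 : |∑' k : ℕ, (k : ℝ) ^ j * d k - ∑' k : ℕ, ((k : ℝ) + 1) ^ j * d k| ≤
      ∑' k : ℕ, (((k : ℝ) + 1) ^ j - (k : ℝ) ^ j) * |d k| := by
    rw [← hs2.tsum_sub hs1]
    have hs4 : Summable fun k : ℕ => (((k : ℝ) + 1) ^ j - (k : ℝ) ^ j) * |d k| := by
      refine (hs1.norm.sub hs2.norm).congr fun k => ?_
      have h1 : (0 : ℝ) ≤ (k : ℝ) ^ j := by positivity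
      rw [norm_mul, norm_mul, Real.norm_of_nonneg h1, Real.norm_of_nonneg (h1.trans (hmono k)),
        Real.norm_eq_abs]
      ring
    rw [← Real.norm_eq_abs]
    refine tsum_of_norm_bounded hs4.hasSum fun k => ?_
    rw [← sub_mul, norm_mul, Real.norm_eq_abs, Real.norm_eq_abs, abs_sub_comm,
      abs_of_nonneg (sub_nonneg.2 (hmono k))]
  have e2 : |∑' k : ℕ, (((-((k : ℤ) + 1) : ℤ)) : ℝ) ^ j * mass a ((-((k : ℤ) + 1) : ℤ) - x)| ≤
      ∑' k : ℕ, ((k : ℝ) + 1) ^ j * mass a (-((k : ℝ) + 1) - x) := by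
    rw [← Real.norm_eq_abs]
    refine tsum_of_norm_bounded (htail x hx).1.hasSum fun k => ?_
    push_cast
    rw [norm_mul, norm_pow, norm_neg, Real.norm_of_nonneg (mass_nonneg ha.le _),
      Real.norm_of_nonneg (by positivity)]
  rw [show ∀ A B T : ℝ, I - (I - (A - B) + T) = (A - B) - T by intros; ring]
  exact (abs_sub _ _).trans (add_le_add e1 e2)

theorem exp_neg_log_mul_logb_add {a δ y : ℝ} (ha : 1 < a) (hδ : 0 < δ) (hy : 0 < y) :
    Real.exp (-(Real.log a * (Real.logb a y + Real.logb a δ))) = (δ * y)⁻¹ := by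
  have hL : Real.log a ≠ 0 := (Real.log_pos ha).ne'
  have : Real.log a * (Real.logb a y + Real.logb a δ) = Real.log (δ * y) := by
    rw [Real.log_mul hδ.ne' hy.ne', Real.logb, Real.logb]
    field_simp
    ring
  rw [this, Real.exp_neg, Real.exp_log (by positivity)]

theorem gumbel_sub_logb {a δ y : ℝ} (ha : 1 < a) (hδ : 0 < δ) (hy : 0 < y) (k : ℕ) :
    gumbel a (k - (Real.logb a y + Real.logb a δ)) = Real.exp (-(δ * y / a ^ k)) := by
  have ha0 : 0 < a := by linarith
  have h := exp_neg_log_mul_logb_add ha hδ hy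
  have h2 : Real.exp (-(Real.log a * (k - (Real.logb a y + Real.logb a δ)))) = δ * y / a ^ k := by
    rw [show -(Real.log a * (k - (Real.logb a y + Real.logb a δ))) =
      -(-(Real.log a * (Real.logb a y + Real.logb a δ))) - k * Real.log a by ring, Real.exp_sub,
      Real.exp_neg, h, inv_inv, Real.exp_nat_mul, Real.exp_log ha0]
  rw [gumbel, h2]

/-- Differencing lowers the degree of the weight by one, so the moment of order `i + 1` needs only
the error sum with weight `i`. This fixes the log exponents `ρ + 3` for the mean and `ρ + 4` for the
second moment. -/
theorem add_one_pow_sub_pow_le (k i : ℕ) :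
    ((k : ℝ) + 1) ^ (i + 1) - (k : ℝ) ^ (i + 1) ≤ (i + 1) * ((k : ℝ) + 1) ^ i := by
  induction i with
  | zero => simp
  | succ i ih =>
    have h1 : (k : ℝ) ^ (i + 1) ≤ ((k : ℝ) + 1) ^ (i + 1) := by gcongr; linarith
    have h2 := mul_le_mul_of_nonneg_left ih (by positivity : (0 : ℝ) ≤ (k : ℝ) + 1)
    push_cast
    calc ((k : ℝ) + 1) ^ (i + 1 + 1) - (k : ℝ) ^ (i + 1 + 1)
        = (k + 1) * (((k : ℝ) + 1) ^ (i + 1) - (k : ℝ) ^ (i + 1)) + (k : ℝ) ^ (i + 1) := by ring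
      _ ≤ (k + 1) * ((i + 1) * ((k : ℝ) + 1) ^ i) + ((k : ℝ) + 1) ^ (i + 1) := add_le_add h2 h1
      _ = _ := by ring

/-- The distribution functions `F ℓ` are close to `exp (-δ ℓ / a ^ k)` in all weighted `ℓ¹`
norms. -/
def CloseToGumbel (a δ ρ : ℝ) (F : ℕ → ℕ → ℝ) : Prop :=
  ∀ j : ℕ, ∃ B, 0 ≤ B ∧ ∀ᶠ ℓ : ℕ in atTop,
    Summable (fun k : ℕ => (k + 1 : ℝ) ^ j * |F ℓ k - Real.exp (-(δ * ℓ / a ^ k))|) ∧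
    ∑' k : ℕ, (k + 1 : ℝ) ^ j * |F ℓ k - Real.exp (-(δ * ℓ / a ^ k))| ≤
      B * (Real.log ℓ ^ (ρ + 3 + j) / (ℓ : ℝ) ^ ρ)

theorem eventually_inv_le {ρ : ℝ} (hρ : 0 < ρ) (hρ1 : ρ ≤ 1) (j : ℕ) :
    ∀ᶠ ℓ : ℕ in atTop, (ℓ : ℝ)⁻¹ ≤ Real.log ℓ ^ (ρ + 3 + j) / (ℓ : ℝ) ^ ρ := by
  have h1 : ∀ᶠ ℓ : ℕ in atTop, 1 ≤ Real.log ℓ :=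
    (Real.tendsto_log_atTop.comp tendsto_natCast_atTop_atTop).eventually_ge_atTop 1
  filter_upwards [h1, eventually_ge_atTop 1] with ℓ hℓ hℓ1
  have hℓ' : (1 : ℝ) ≤ ℓ := by exact_mod_cast hℓ1
  rw [inv_eq_one_div]
  gcongr
  · exact Real.one_le_rpow hℓ (by positivity)
  · exact Real.rpow_le_self_of_one_le hℓ' hρ1

theorem eventually_logb_nonneg {a : ℝ} (ha : 1 < a) (c : ℝ) :
    ∀ᶠ ℓ : ℕ in atTop, 0 ≤ Real.logb a ℓ + c :=
  (tendsto_atTop_add_const_right _ c ((Real.tendsto_logb_atTop ha).comp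
    tendsto_natCast_atTop_atTop)).eventually_ge_atTop 0

/-- Besides the error sum there is the mass at negative integers. It is `O(a^(-x)) = O(1/ℓ)`, which
is absorbed because `ρ ≤ 1`. The error sum of weight `i + 1` enters only for summability. -/
theorem isBigO_sub_tsum_mass {a δ ρ : ℝ} (ha : 1 < a) (hδ : 0 < δ) (hρ : 0 < ρ) (hρ1 : ρ ≤ 1)
    {F : ℕ → ℕ → ℝ} (hF : CloseToGumbel a δ ρ F) (i : ℕ) {I : ℕ → ℝ}
    (hI : ∀ᶠ ℓ in atTop, HasSum (fun k : ℕ => (k : ℝ) ^ (i + 1) * pointMass (F ℓ) k) (I ℓ)) :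
    (fun ℓ : ℕ => I ℓ - ∑' k : ℤ, (k : ℝ) ^ (i + 1) *
      mass a (k - (Real.logb a ℓ + Real.logb a δ))) =O[atTop]
      fun ℓ : ℕ => Real.log ℓ ^ (ρ + 3 + i) / (ℓ : ℝ) ^ ρ := by
  obtain ⟨B, hB, hF0⟩ := hF i
  obtain ⟨_, _, hF1⟩ := hF (i + 1)
  obtain ⟨C, hC, htail⟩ := exists_negTail_le ha (i + 1)
  refine IsBigO.of_bound ((i + 1) * B + C * δ⁻¹) ?_
  filter_upwards [hI, hF0, hF1, eventually_inv_le hρ hρ1 i, eventually_logb_nonneg ha (Real.logb a δ),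
    eventually_ge_atTop 1] with ℓ h0 h1 h2 h3 h4 h5
  have hℓ' : (0 : ℝ) < ℓ := by exact_mod_cast h5
  obtain ⟨h1s, h1⟩ := h1
  have hnn : 0 ≤ Real.log ℓ ^ (ρ + 3 + i) / (ℓ : ℝ) ^ ρ := (inv_nonneg.2 hℓ'.le).trans h3
  set x := Real.logb a ℓ + Real.logb a δ with hx
  have hg : ∀ k : ℕ, Real.exp (-(δ * ℓ / a ^ k)) = gumbel a (k - x) := fun k =>
    (gumbel_sub_logb ha hδ hℓ' k).symm
  simp_rw [hg] at h1 h1s h2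
  obtain ⟨-, key⟩ := abs_sub_tsum_mass_le ha i.succ_ne_zero h4 h0 h2.1
  rw [Real.norm_eq_abs, Real.norm_of_nonneg hnn]
  refine key.trans ?_
  rw [add_mul]
  refine add_le_add ?_ ?_
  · have hle : ∀ k : ℕ, (((k : ℝ) + 1) ^ (i + 1) - (k : ℝ) ^ (i + 1)) * |F ℓ k - gumbel a (k - x)| ≤
        (i + 1) * (((k : ℝ) + 1) ^ i * |F ℓ k - gumbel a (k - x)|) := fun k => by
      rw [← mul_assoc]
      exact mul_le_mul_of_nonneg_right (add_one_pow_sub_pow_le k i) (abs_nonneg _)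
    have hs : Summable fun k : ℕ =>
        (((k : ℝ) + 1) ^ (i + 1) - (k : ℝ) ^ (i + 1)) * |F ℓ k - gumbel a (k - x)| :=
      Summable.of_nonneg_of_le (fun k => mul_nonneg (sub_nonneg.2 (by gcongr; linarith))
        (abs_nonneg _)) hle (h1s.mul_left _)
    refine (hs.tsum_le_tsum hle (h1s.mul_left _)).trans ?_
    rw [tsum_mul_left, mul_assoc]
    gcongr
  · refine (htail x h4).2.trans ?_
    rw [hx, exp_neg_log_mul_logb_add ha hδ hℓ', mul_inv, mul_assoc]
    gcongr

theorem tsum_mul_mass {a : ℝ} (ha : 1 < a) (x : ℝ) :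
    ∑' k : ℤ, (k : ℝ) ^ 1 * mass a (k - x) = massMoment a 1 x + x := by
  have h0 := (summable_pow_mul_mass ha 0 x).hasSum
  have h1 := (summable_pow_mul_mass ha 1 x).hasSum
  have h := h1.add (h0.mul_left x)
  change HasSum _ (massMoment a 1 x + x * massMoment a 0 x) at h
  rw [massMoment_zero ha, mul_one] at h
  rw [← h.tsum_eq]
  exact tsum_congr fun k => by ring

theorem tsum_sq_mul_mass {a : ℝ} (ha : 1 < a) (x : ℝ) :
    ∑' k : ℤ, (k : ℝ) ^ 2 * mass a (k - x) =
      massMoment a 2 x + 2 * x * massMoment a 1 x + x ^ 2 := by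
  have h0 := (summable_pow_mul_mass ha 0 x).hasSum
  have h1 := (summable_pow_mul_mass ha 1 x).hasSum
  have h2 := (summable_pow_mul_mass ha 2 x).hasSum
  have h := (h2.add (h1.mul_left (2 * x))).add (h0.mul_left (x ^ 2))
  change HasSum _ (massMoment a 2 x + 2 * x * massMoment a 1 x + x ^ 2 * massMoment a 0 x) at h
  rw [massMoment_zero ha, mul_one] at h
  rw [← h.tsum_eq]
  exact tsum_congr fun k => by ring

theorem isBigO_mean {a δ ρ : ℝ} (ha : 1 < a) (hδ : 0 < δ) (hρ : 0 < ρ) (hρ1 : ρ ≤ 1)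
    {F : ℕ → ℕ → ℝ} (hF : CloseToGumbel a δ ρ F) {I : ℕ → ℝ}
    (hI : ∀ᶠ ℓ in atTop, HasSum (fun k : ℕ => (k : ℝ) * pointMass (F ℓ) k) (I ℓ)) :
    (fun ℓ : ℕ => I ℓ - (Real.logb a ℓ + Real.logb a δ +
      Real.eulerMascheroniConstant / Real.log a + 1 / 2 +
      fluct₀ a (Real.logb a ℓ + Real.logb a δ))) =O[atTop]
      fun ℓ : ℕ => Real.log ℓ ^ (ρ + 3) / (ℓ : ℝ) ^ ρ := by
  have h := isBigO_sub_tsum_mass ha hδ hρ hρ1 hF 0 (I := I) (by simpa using hI)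
  simp only [zero_add, Nat.cast_zero, add_zero] at h
  refine h.congr_left fun ℓ => ?_
  rw [tsum_mul_mass ha, fluct₀]
  ring

theorem exists_abs_le_of_periodic {f : ℝ → ℝ} (hf : Continuous f) (hp : Function.Periodic f 1) :
    ∃ C, ∀ x, |f x| ≤ C := by
  obtain ⟨C, hC⟩ := (hp.compact_of_continuous one_ne_zero hf).isBounded.exists_norm_le
  exact ⟨C, fun x => hC _ ⟨x, rfl⟩⟩

theorem tendsto_log_rpow_div_rpow {ρ : ℝ} (hρ : 0 < ρ) (c : ℝ) :
    Tendsto (fun ℓ : ℕ => Real.log ℓ ^ c / (ℓ : ℝ) ^ ρ) atTop (𝓝 0) :=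
  (isLittleO_log_rpow_rpow_atTop c hρ).tendsto_div_nhds_zero.comp tendsto_natCast_atTop_atTop

/-- The mean is `x + g + ψ(x) + ε` with constant `g` and periodic `ψ`. In its square the cross term
`2(x + g + ψ) ε` costs one extra `log ℓ`, matching the error of the second moment; all terms growing
with `x` cancel, leaving `M₂ - M₁²` for the mass moments. -/
theorem isBigO_variance {a δ ρ : ℝ} (ha : 1 < a) (hδ : 0 < δ) (hρ : 0 < ρ) (hρ1 : ρ ≤ 1)
    {F : ℕ → ℕ → ℝ} (hF : CloseToGumbel a δ ρ F) {I J : ℕ → ℝ}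
    (hI : ∀ᶠ ℓ in atTop, HasSum (fun k : ℕ => (k : ℝ) * pointMass (F ℓ) k) (I ℓ))
    (hJ : ∀ᶠ ℓ in atTop, HasSum (fun k : ℕ => (k : ℝ) ^ 2 * pointMass (F ℓ) k) (J ℓ)) :
    (fun ℓ : ℕ => (J ℓ - I ℓ ^ 2) - (Real.pi ^ 2 / (6 * Real.log a ^ 2) + 1 / 12 +
      fluct₁ a (Real.logb a ℓ + Real.logb a δ) -
      2 * Real.eulerMascheroniConstant / Real.log a *
        fluct₀ a (Real.logb a ℓ + Real.logb a δ) -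
      fluct₀ a (Real.logb a ℓ + Real.logb a δ) ^ 2)) =O[atTop]
      fun ℓ : ℕ => Real.log ℓ ^ (ρ + 4) / (ℓ : ℝ) ^ ρ := by
  have hL : 0 < Real.log a := Real.log_pos ha
  have h1 := isBigO_mean ha hδ hρ hρ1 hF hI
  have h2 := isBigO_sub_tsum_mass ha hδ hρ hρ1 hF 1 hJ
  set ψ := fluct₀ a with hψ
  set ψ₁ := fluct₁ a with hψ₁
  set x : ℕ → ℝ := fun ℓ => Real.logb a ℓ + Real.logb a δ with hx
  set g : ℝ := Real.eulerMascheroniConstant / Real.log a + 1 / 2 with hg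
  set ε : ℕ → ℝ := fun ℓ => I ℓ - (Real.logb a ℓ + Real.logb a δ +
      Real.eulerMascheroniConstant / Real.log a + 1 / 2 +
      ψ (Real.logb a ℓ + Real.logb a δ)) with hε
  have e4 : (fun ℓ : ℕ => Real.log ℓ ^ (ρ + 3 + (1 : ℕ)) / (ℓ : ℝ) ^ ρ) =
      fun ℓ : ℕ => Real.log ℓ ^ (ρ + 4) / (ℓ : ℝ) ^ ρ := by
    ext ℓ; rw [Nat.cast_one, add_assoc]; norm_num
  rw [e4] at h2
  have hlog : Tendsto (fun ℓ : ℕ => Real.log ℓ) atTop atTop :=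
    Real.tendsto_log_atTop.comp tendsto_natCast_atTop_atTop
  have hone : (fun _ : ℕ => (1 : ℝ)) =O[atTop] fun ℓ : ℕ => Real.log ℓ :=
    (isLittleO_const_left.2 (Or.inr (tendsto_norm_atTop_atTop.comp hlog))).isBigO
  have hbd : (fun ℓ => ψ (x ℓ)) =O[atTop] fun _ : ℕ => (1 : ℝ) := by
    obtain ⟨-, hc, hp, -⟩ := isFluctuation_fluct₀ ha
    obtain ⟨C, hC⟩ := exists_abs_le_of_periodic hc hp
    exact IsBigO.of_bound C (Eventually.of_forall fun ℓ => by simpa using hC (x ℓ))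
  have hxO : x =O[atTop] fun ℓ : ℕ => Real.log ℓ := by
    refine IsBigO.add ?_ ((isBigO_const_const _ one_ne_zero _).trans hone)
    refine (isBigO_refl (fun ℓ : ℕ => Real.log ℓ) atTop).const_mul_left (Real.log a)⁻¹ |>.congr_left
      fun ℓ => ?_
    rw [Real.logb, div_eq_inv_mul]
  have hm : (fun ℓ => 2 * (x ℓ + (g + ψ (x ℓ)))) =O[atTop] fun ℓ : ℕ => Real.log ℓ :=
    (hxO.add (((isBigO_const_const g one_ne_zero _).add hbd).trans hone)).const_mul_left 2
  have hmul : ∀ᶠ ℓ : ℕ in atTop, Real.log ℓ * (Real.log ℓ ^ (ρ + 3) / (ℓ : ℝ) ^ ρ) =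
      Real.log ℓ ^ (ρ + 4) / (ℓ : ℝ) ^ ρ := by
    filter_upwards [hlog.eventually_gt_atTop 0] with ℓ hℓ
    rw [show ρ + 4 = 1 + (ρ + 3) by ring, Real.rpow_add hℓ 1, Real.rpow_one, mul_div_assoc]
  have hε2 : (fun ℓ => 2 * (x ℓ + (g + ψ (x ℓ))) * ε ℓ) =O[atTop]
      fun ℓ : ℕ => Real.log ℓ ^ (ρ + 4) / (ℓ : ℝ) ^ ρ :=
    (hm.mul h1).trans_eventuallyEq hmul
  have hε1 : ε =O[atTop] fun _ : ℕ => (1 : ℝ) :=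
    h1.trans ((tendsto_log_rpow_div_rpow hρ _).isBigO_one ℝ)
  have hεsq : (fun ℓ => ε ℓ * ε ℓ) =O[atTop]
      fun ℓ : ℕ => Real.log ℓ ^ (ρ + 4) / (ℓ : ℝ) ^ ρ :=
    ((hε1.trans hone).mul h1).trans_eventuallyEq hmul
  refine ((h2.sub hε2).sub hεsq).congr_left fun ℓ => ?_
  rw [tsum_sq_mul_mass ha]
  have hI' : I ℓ = x ℓ + g + ψ (x ℓ) + ε ℓ := by simp only [hε, hx, hg]; ring
  have hM1 : massMoment a 1 (x ℓ) = g + ψ (x ℓ) := by rw [hψ, fluct₀]; ring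
  have hM2 : massMoment a 2 (x ℓ) = ψ₁ (x ℓ) + ψ (x ℓ) + (Real.pi ^ 2 / (6 * Real.log a ^ 2) +
      Real.eulerMascheroniConstant ^ 2 / Real.log a ^ 2 +
      Real.eulerMascheroniConstant / Real.log a + 1 / 3) := by
    rw [hψ₁, fluct₁]; ring
  change J ℓ - (massMoment a 2 (x ℓ) + 2 * x ℓ * massMoment a 1 (x ℓ) + x ℓ ^ 2) -
    2 * (x ℓ + (g + ψ (x ℓ))) * ε ℓ - ε ℓ * ε ℓ = J ℓ - I ℓ ^ 2 - (Real.pi ^ 2 /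
    (6 * Real.log a ^ 2) + 1 / 12 + ψ₁ (x ℓ) - 2 * Real.eulerMascheroniConstant / Real.log a *
    ψ (x ℓ) - ψ (x ℓ) ^ 2)
  rw [hM1, hM2, hI', hg]
  field_simp
  ring

/-! ### Limit laws and weak convergence -/

theorem hasSum_mass {a : ℝ} (ha : 1 < a) (x : ℝ) : HasSum (fun k : ℤ => mass a (k - x)) 1 := by
  have h := (summable_pow_mul_mass ha 0 x).hasSum
  change HasSum _ (massMoment a 0 x) at h
  rw [massMoment_zero ha] at h
  simpa using h

/-- Comparison of the expectation of a bounded function with the sum over the masses. -/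
theorem abs_sub_tsum_bounded_mul_mass_le {a : ℝ} (ha : 1 < a) {F : ℕ → ℝ} {x I M : ℝ} {g : ℤ → ℝ}
    (hx : 0 ≤ x) (hM : 0 ≤ M) (hg : ∀ k, |g k| ≤ M)
    (hI : HasSum (fun k : ℕ => g k * pointMass F k) I)
    (hd : Summable fun k : ℕ => |F k - gumbel a (k - x)|) :
    |I - ∑' k : ℤ, g k * mass a (k - x)| ≤
      M * (2 * ∑' k : ℕ, |F k - gumbel a (k - x)| + gumbel a (-1 - x) +
        ∑' k : ℕ, mass a (-((k : ℝ) + 1) - x)) := by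
  have ha0 : 0 < a := by linarith
  set d : ℕ → ℝ := fun k => F k - gumbel a (k - x) with hdd
  have hs : Summable fun k : ℤ => g k * mass a (k - x) :=
    Summable.of_norm_bounded ((hasSum_mass ha x).summable.mul_left M) fun k => by
      rw [norm_mul, Real.norm_of_nonneg (mass_nonneg ha.le _), Real.norm_eq_abs]
      exact mul_le_mul_of_nonneg_right (hg k) (mass_nonneg ha.le _)
  have hs1 : Summable fun k : ℕ => g k * mass a ((k : ℤ) - x) :=
    hs.comp_injective Nat.cast_injective
  have hs2 : Summable fun k : ℕ => g (-((k : ℤ) + 1)) * mass a ((-((k : ℤ) + 1) : ℤ) - x) :=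
    hs.comp_injective (i := fun k : ℕ => -((k : ℤ) + 1)) fun k k' h => by simpa using h
  obtain ⟨C, -, htail⟩ := exists_negTail_le ha 0
  have ht : Summable fun k : ℕ => mass a (-((k : ℝ) + 1) - x) := by simpa using (htail x hx).1
  rw [(HasSum.of_nat_of_neg_add_one (f := fun k : ℤ => g k * mass a (k - x))
    hs1.hasSum hs2.hasSum).tsum_eq, ← hI.tsum_eq, ← sub_sub, ← hI.summable.tsum_sub hs1]
  -- `c k` stands for the previous error `|d (k - 1)|`. At `k = 0` the distribution function before
  -- `0` is zero, so the error there is `gumbel a (-1 - x)` itself.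
  set c : ℕ → ℝ := fun k => Nat.casesOn k (gumbel a (-1 - x)) fun k => |d k| with hc
  have hcs : HasSum c (∑' k, |d k| + gumbel a (-1 - x)) := by
    refine (hasSum_nat_add_iff' 1).1 ?_
    simpa [hc] using hd.hasSum
  have hdc : HasSum (fun k => M * (|d k| + c k))
      (M * (∑' k, |d k| + (∑' k, |d k| + gumbel a (-1 - x)))) :=
    (hd.hasSum.add hcs).mul_left M
  have hterm : ∀ k : ℕ, |pointMass F k - mass a ((k : ℤ) - x)| ≤ |d k| + c k := fun k => by
    cases k with
    | zero =>
      have : pointMass F 0 - mass a (((0 : ℕ) : ℤ) - x) = d 0 + gumbel a (-1 - x) := by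
        rw [mass_eq_sub ha0]
        simp only [pointMass, hdd]
        push_cast
        ring_nf
      rw [this]
      refine (abs_add_le _ _).trans_eq ?_
      rw [abs_of_nonneg (gumbel_nonneg a _)]
      rfl
    | succ k =>
      have : pointMass F (k + 1) - mass a (((k + 1 : ℕ) : ℤ) - x) = d (k + 1) - d k := by
        rw [mass_eq_sub ha0]
        simp only [pointMass, hdd]
        push_cast
        ring_nf
      rw [this]
      exact abs_sub _ _
  have e1 : |∑' k : ℕ, (g k * pointMass F k - g k * mass a ((k : ℤ) - x))| ≤
      M * (∑' k, |d k| + (∑' k, |d k| + gumbel a (-1 - x))) := by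
    rw [← Real.norm_eq_abs]
    refine tsum_of_norm_bounded hdc fun k => ?_
    rw [← mul_sub, norm_mul, Real.norm_eq_abs, Real.norm_eq_abs]
    exact mul_le_mul (hg k) (hterm k) (abs_nonneg _) hM
  have e2 : |∑' k : ℕ, g (-((k : ℤ) + 1)) * mass a ((-((k : ℤ) + 1) : ℤ) - x)| ≤
      M * ∑' k : ℕ, mass a (-((k : ℝ) + 1) - x) := by
    rw [← Real.norm_eq_abs, ← tsum_mul_left]
    refine tsum_of_norm_bounded (ht.mul_left M).hasSum fun k => ?_
    rw [norm_mul, Real.norm_of_nonneg (mass_nonneg ha.le _), Real.norm_eq_abs]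
    push_cast
    exact mul_le_mul_of_nonneg_right (hg _) (mass_nonneg ha.le _)
  refine (abs_sub _ _).trans ((add_le_add e1 e2).trans_eq ?_)
  ring

/-- The limit laws, as sums of point masses. -/
theorem exists_limitLaw {a : ℝ} (ha : 1 < a) (θ β : ℝ) :
    ∃ μ : ProbabilityMeasure ℝ, ∀ g : BoundedContinuousFunction ℝ ℝ,
      ∫ y, g y ∂(μ : Measure ℝ) = ∑' k : ℤ, g (k - θ) * mass a (k - (θ + β)) := by
  set m : ℤ → Measure ℝ := fun k =>
    ENNReal.ofReal (mass a (k - (θ + β))) • Measure.dirac ((k : ℝ) - θ) with hm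
  have h1 : IsProbabilityMeasure (Measure.sum m) := by
    constructor
    rw [Measure.sum_apply _ MeasurableSet.univ]
    simp only [hm, Measure.smul_apply, measure_univ, smul_eq_mul, mul_one]
    rw [← ENNReal.ofReal_tsum_of_nonneg (fun k => mass_nonneg ha.le _)
      (hasSum_mass ha _).summable, (hasSum_mass ha _).tsum_eq, ENNReal.ofReal_one]
  refine ⟨⟨Measure.sum m, h1⟩, fun g => ?_⟩
  have h2 := hasSum_integral_measure (g.integrable (Measure.sum m))
  refine h2.tsum_eq.symm.trans (tsum_congr fun k => ?_)
  simp only [hm]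
  rw [integral_smul_measure, integral_dirac, ENNReal.toReal_ofReal (mass_nonneg ha.le _),
    smul_eq_mul, mul_comm]

/-- Shifting the summation index by `⌊y⌋` leaves the sum over all integers unchanged. -/
theorem tsum_mass_fract (a β : ℝ) (g : ℝ → ℝ) (y : ℝ) :
    ∑' k : ℤ, g (k - y) * mass a (k - (y + β)) =
      ∑' k : ℤ, g (k - Int.fract y) * mass a (k - (Int.fract y + β)) := by
  rw [← (Equiv.addRight ⌊y⌋).tsum_eq]
  refine tsum_congr fun k => ?_
  have : ((Equiv.addRight ⌊y⌋ k : ℤ) : ℝ) - y = k - Int.fract y := by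
    rw [Equiv.coe_addRight, Int.cast_add, Int.fract]; ring
  rw [← sub_sub, ← sub_sub, this]

/-- Once `y` is replaced by its fractional part the shifts are bounded, so one summable majorant
serves all terms and dominated convergence applies. -/
theorem tendsto_tsum_mass {a : ℝ} (ha : 1 < a) {β θ : ℝ} (g : BoundedContinuousFunction ℝ ℝ)
    {ι : Type*} {L : Filter ι} {y : ι → ℝ} (hy : Tendsto (fun i => Int.fract (y i)) L (𝓝 θ)) :
    Tendsto (fun i => ∑' k : ℤ, g (k - y i) * mass a (k - (y i + β))) L
      (𝓝 (∑' k : ℤ, g (k - θ) * mass a (k - (θ + β)))) := by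
  simp_rw [fun i => tsum_mass_fract a β g (y i)]
  obtain ⟨C, hC, hb⟩ := exists_abs_pow_mul_mass_sub_le ha 0 (1 + |β|)
  refine tendsto_tsum_of_dominated_convergence
    ((summable_one_div_one_add_sq.mul_left C).mul_left ‖g‖) (fun k => ?_)
    (Eventually.of_forall fun i k => ?_)
  · have h1 : Continuous fun t : ℝ => g (k - t) * mass a (k - (t + β)) := by
      have := continuous_mass a
      fun_prop
    exact (h1.tendsto θ).comp hy
  · rw [norm_mul]
    refine mul_le_mul (g.norm_coe_le_norm _) ?_ (norm_nonneg _) (norm_nonneg _)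
    have h2 := hb (Int.fract (y i) + β) ((abs_add_le _ _).trans (by
      rw [Int.abs_fract]
      linarith [(Int.fract_lt_one (y i)).le])) k
    simpa using h2

/-- Weak convergence along the sequences for which the fractional parts converge. -/
theorem tendsto_shiftedLaw {a δ ρ : ℝ} (ha : 1 < a) (hδ : 0 < δ) (hρ : 0 < ρ) (hρ1 : ρ ≤ 1)
    {F : ℕ → ℕ → ℝ} (hF : CloseToGumbel a δ ρ F) {P : ℕ → ProbabilityMeasure ℕ}
    (hP : ∀ᶠ ℓ in atTop, ∀ f : ℕ → ℝ,
      HasSum (fun k : ℕ => f k * pointMass (F ℓ) k) (∫ k, f k ∂(P ℓ : Measure ℕ))) (θ : ℝ) :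
    ∃ μ : ProbabilityMeasure ℝ, ∀ A : Set ℕ,
      Tendsto (fun ℓ : ℕ => Int.fract (Real.logb a ℓ)) (atTop ⊓ 𝓟 A) (𝓝 θ) →
      Tendsto (fun ℓ : ℕ => shiftedLaw (P ℓ) (Real.logb a ℓ)) (atTop ⊓ 𝓟 A) (𝓝 μ) := by
  set β := Real.logb a δ with hβ
  obtain ⟨μ, hμ⟩ := exists_limitLaw ha θ β
  refine ⟨μ, fun A hA => ?_⟩
  rw [ProbabilityMeasure.tendsto_iff_forall_integral_tendsto]
  intro g
  rw [hμ]
  -- The distance between the law and the masses tends to zero along all `ℓ`; convergence of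
  -- fractional parts matters only for the mass sums.
  refine (tendsto_tsum_mass ha (β := β) g hA).congr_dist (Tendsto.mono_left ?_ inf_le_left)
  obtain ⟨B, hB, hF0⟩ := hF 0
  obtain ⟨C, hC, htail⟩ := exists_negTail_le ha 0
  have hbound : ∀ᶠ ℓ : ℕ in atTop,
      dist (∑' k : ℤ, g (k - Real.logb a ℓ) * mass a (k - (Real.logb a ℓ + β)))
        (∫ y, g y ∂(shiftedLaw (P ℓ) (Real.logb a ℓ) : Measure ℝ)) ≤
      ‖g‖ * ((2 * B + δ⁻¹ + C * δ⁻¹) * (Real.log ℓ ^ (ρ + 3 + (0 : ℕ)) / (ℓ : ℝ) ^ ρ)) := by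
    filter_upwards [hP, hF0, eventually_inv_le hρ hρ1 0, eventually_logb_nonneg ha β,
      eventually_ge_atTop 1] with ℓ h0 h1 h3 h4 h5
    have hℓ' : (0 : ℝ) < ℓ := by exact_mod_cast h5
    have hg : ∀ k : ℕ, Real.exp (-(δ * ℓ / a ^ k)) = gumbel a (k - (Real.logb a ℓ + β)) :=
      fun k => (gumbel_sub_logb ha hδ hℓ' k).symm
    simp_rw [hg, pow_zero, one_mul] at h1
    have hI : ∫ y, g y ∂(shiftedLaw (P ℓ) (Real.logb a ℓ) : Measure ℝ) =
        ∫ k : ℕ, g (k - Real.logb a ℓ) ∂(P ℓ : Measure ℕ) := by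
      rw [shiftedLaw, ProbabilityMeasure.toMeasure_map,
        integral_map (measurable_of_countable _).aemeasurable
          g.continuous.aestronglyMeasurable]
    have h6 := abs_sub_tsum_bounded_mul_mass_le ha (g := fun k : ℤ => g (k - Real.logb a ℓ))
      h4 (norm_nonneg g) (fun k => g.norm_coe_le_norm _)
      (by simpa using h0 fun k : ℕ => g (k - Real.logb a ℓ)) h1.1
    rw [dist_comm, Real.dist_eq, hI]
    refine h6.trans (mul_le_mul_of_nonneg_left ?_ (norm_nonneg g))
    have hexp : Real.exp (-(Real.log a * (Real.logb a ℓ + β))) = δ⁻¹ * (ℓ : ℝ)⁻¹ := by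
      rw [hβ, exp_neg_log_mul_logb_add ha hδ hℓ', mul_inv]
    have h7 : gumbel a (-1 - (Real.logb a ℓ + β)) ≤ δ⁻¹ * (ℓ : ℝ)⁻¹ := by
      rw [← hexp, gumbel]
      apply Real.exp_le_exp.2
      have h8 := Real.add_one_le_exp (-(Real.log a * (-1 - (Real.logb a ℓ + β))))
      have h9 := Real.log_pos ha
      nlinarith
    have h10 := (htail _ h4).2
    simp only [pow_zero, one_mul] at h10
    rw [hexp] at h10
    have h11 := mul_le_mul_of_nonneg_left h3 (inv_nonneg.2 hδ.le)
    have h12 := mul_le_mul_of_nonneg_left h11 hC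
    have h13 := h1.2
    linarith
  refine squeeze_zero' (Eventually.of_forall fun _ => dist_nonneg) hbound ?_
  have := ((tendsto_log_rpow_div_rpow hρ (ρ + 3 + (0 : ℕ))).const_mul
    (2 * B + δ⁻¹ + C * δ⁻¹)).const_mul ‖g‖
  simpa only [mul_zero] using this

/-! ### The exponent `ρ` and the pointwise limit of `G_k` -/

section rho

variable {n : ℕ} {a : Fin (n + 2) → ℝ}

theorem rho_pos (ha_one : 1 < a 0) (ha_lt : a 0 < |a 1|) : 0 < rho a := by
  have hL : 0 < Real.log (a 0) := Real.log_pos ha_one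
  have h : 1 < Real.log |a 1| / Real.log (a 0) := by
    rw [one_lt_div hL]
    exact Real.log_lt_log (by linarith) ha_lt
  exact sub_pos.2 (lt_min h one_lt_two)

theorem rho_le_one (a : Fin (n + 2) → ℝ) : rho a ≤ 1 := by
  have := min_le_right (Real.log |a 1| / Real.log (a 0)) 2
  rw [rho]
  linarith

theorem min_eq_rpow_rho (ha_one : 1 < a 0) (ha_lt : a 0 < |a 1|) :
    min |a 1| (a 0 ^ 2) = a 0 ^ (1 + rho a) := by
  have h1 : |a 1| = a 0 ^ (Real.log |a 1| / Real.log (a 0)) :=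
    (Real.rpow_logb (by linarith) ha_one.ne' (by linarith)).symm
  have h2 : a 0 ^ 2 = a 0 ^ (2 : ℝ) := by norm_cast
  rw [rho, add_sub_cancel, (Real.monotone_rpow_of_base_ge_one ha_one.le).map_min, ← h1, h2]

/-- The weighted norm at radius `‖z‖ < a` bounds every perturbing term by a multiple of `(‖z‖/a)^k`.
-/
theorem tendsto_numer_div_denom {r₀ s₀ s₁ : ℝ[X]} {r₁ s₂ : MvPolynomial (Fin (n + 2)) ℝ[X]}
    (ha_one : 1 < a 0) (ha_lt : a 0 < |a 1|)
    (ha_mono : ∀ i j, 1 ≤ i → i ≤ j → |a i| ≤ |a j|)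
    (hr₁ : SummandsDivisible₁ r₁) (hs₂ : SummandsDivisible₂ s₂) {z : ℂ} (hz : ‖z‖ < a 0)
    (hz' : (1 - z) * aeval z s₀ ≠ 0) :
    Tendsto (fun k => aeval z (numer a r₀ r₁ k) / aeval z (denom a s₀ s₁ s₂ k)) atTop
      (𝓝 (limitGF r₀ s₀ z)) := by
  have ha0 : 0 < a 0 := by linarith
  have haj := fun j => (le_abs_of_mono ha_lt ha_mono j).1
  have hq : ‖z‖ / a 0 < 1 := (div_lt_one ha0).2 hz
  have hq0 : 0 ≤ ‖z‖ / a 0 := by positivity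
  have hpow := tendsto_pow_atTop_nhds_zero_of_lt_one hq0 hq
  have hmv : ∀ p : MvPolynomial (Fin (n + 2)) ℝ[X], SummandsDivisible₁ p →
      Tendsto (fun k => aeval z (MvPolynomial.eval (perturb a k) p)) atTop (𝓝 0) := fun p hp => by
    obtain ⟨A, -, hA⟩ := exists_wNormLE_of_summandsDivisible₁ (norm_nonneg z) ha0 hz.le haj hp
    refine squeeze_zero_norm (fun k =>
      (hA ‖z‖ (norm_nonneg z) le_rfl k).norm_aeval_le le_rfl) ?_
    simpa using hpow.const_mul A
  have hpert : Tendsto (fun k => aeval z (perturb a k 0)) atTop (𝓝 0) := by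
    refine squeeze_zero_norm (fun k => ?_) hpow
    rw [perturb, map_pow, map_mul, aeval_C, aeval_X, norm_pow, norm_mul, Complex.coe_algebraMap,
      Complex.norm_real, Real.norm_of_nonneg (by positivity), inv_mul_eq_div]
  refine Tendsto.div ?_ ?_ hz'
  · simpa [numer] using (hmv r₁ hr₁).const_add (aeval z r₀)
  · have h := ((hpert.mul_const (aeval z s₁)).const_add ((1 - z) * aeval z s₀)).add
      (hmv s₂ hs₂.summandsDivisible₁)
    simpa [denom] using h

end rho

/-! ### Relative error, normalisation and assembly -/

theorem gumbel_mono {a : ℝ} (ha : 1 ≤ a) : Monotone (gumbel a) := fun u v huv => by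
  have := Real.log_nonneg ha
  unfold gumbel
  gcongr

/-- Relative error in the range `k = log_a ℓ + O(1)`. -/
theorem CloseToGumbel.eventually_abs_sub_le {a δ ρ : ℝ} (ha : 1 < a) (hδ : 0 < δ) (hρ : 0 < ρ)
    {F : ℕ → ℕ → ℝ} (hF : CloseToGumbel a δ ρ F) (K : ℝ) {ε : ℝ} (hε : 0 < ε) :
    ∀ᶠ ℓ : ℕ in atTop, ∀ k : ℕ, |(k : ℝ) - Real.logb a ℓ| ≤ K →
      |F ℓ k - Real.exp (-(δ * ℓ / a ^ k))| ≤ ε * Real.exp (-(δ * ℓ / a ^ k)) := by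
  obtain ⟨B, -, hB⟩ := hF 0
  have h0 := (tendsto_log_rpow_div_rpow hρ (ρ + 3 + (0 : ℕ))).const_mul B
  rw [mul_zero] at h0
  -- In the window `k ≥ log_a ℓ - K` the limit function is bounded below by this value of `gumbel`,
  -- so a vanishing absolute error is a vanishing relative error. Each single error is at most the
  -- whole error sum.
  have hpos : 0 < ε * gumbel a (-K - Real.logb a δ) := mul_pos hε (Real.exp_pos _)
  filter_upwards [hB, h0.eventually_lt_const hpos, eventually_ge_atTop 1] with ℓ h1 h2 h3 k hk
  have hℓ' : (0 : ℝ) < ℓ := by exact_mod_cast h3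
  simp_rw [pow_zero, one_mul] at h1
  refine (h1.1.le_tsum k fun _ _ => abs_nonneg _).trans (h1.2.trans (h2.le.trans ?_))
  rw [← gumbel_sub_logb ha hδ hℓ']
  refine mul_le_mul_of_nonneg_left (gumbel_mono ha.le ?_) hε.le
  linarith [(abs_le.1 hk).1]

/-- Replacing `c` by `v ℓ` costs only `O(r₂^(-ℓ))`, and `v ℓ ≥ c/2` turns the division into the
factor `2/c`. -/
theorem closeToGumbel_div {a b ρ δ c r₁ r₂ A₁ A₂ : ℝ} (ha : 1 < a) (hρ : 0 < ρ) (hρ1 : ρ ≤ 1)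
    (hb : b = a ^ (1 + ρ)) (hδ : 0 < δ) (hc : 0 < c) (hr₁ : 1 < r₁) (hr₂ : 1 < r₂)
    (hA₁ : 0 ≤ A₁) (hA₂ : 0 ≤ A₂) {w : ℕ → ℕ → ℝ} {v : ℕ → ℝ} {ℓ₀ : ℕ}
    (hw_nonneg : ∀ ℓ k, 0 ≤ w ℓ k) (hw_mono : ∀ ℓ, Monotone (w ℓ))
    (hv : ∀ ℓ k, ℓ < k → w ℓ k = v ℓ) (hvc : ∀ ℓ, ℓ₀ ≤ ℓ → c / 2 ≤ v ℓ)
    (hw : ∀ᶠ k : ℕ in atTop, ∀ ℓ : ℕ, |w ℓ k - c * Real.exp (-(δ * ℓ / a ^ k))| ≤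
      A₁ * ((ℓ + 1) * (k / b ^ k) + k / a ^ k + (r₁ ^ ℓ)⁻¹))
    (hvA : ∀ ℓ, |v ℓ - c| ≤ A₂ * (r₂ ^ ℓ)⁻¹) :
    CloseToGumbel a δ ρ fun ℓ k => w ℓ k / v ℓ := by
  have hb0 : 0 < b := hb ▸ Real.rpow_pos_of_pos (by linarith) _
  have ha0 : 0 < a := by linarith
  have hvpos : ∀ ℓ, ℓ₀ ≤ ℓ → 0 < v ℓ := fun ℓ hℓ => by linarith [hvc ℓ hℓ]
  refine exists_error_sum_le (r := min r₁ r₂) (C := 2 / c * (A₁ + A₂)) (ℓ₀ := ℓ₀) ha hρ hρ1 hb hδ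
    (lt_min hr₁ hr₂) (by positivity)
    (fun ℓ hℓ k k' h => div_le_div_of_nonneg_right (hw_mono ℓ h) (hvpos ℓ hℓ).le)
    (fun ℓ hℓ k => div_nonneg (hw_nonneg ℓ k) (hvpos ℓ hℓ).le)
    (fun ℓ hℓ k h => by rw [hv ℓ k h, div_self (hvpos ℓ hℓ).ne']) ?_
  have hr : 0 < min r₁ r₂ := by linarith [lt_min hr₁ hr₂]
  filter_upwards [hw] with k hk ℓ hℓ
  have hv0 := hvpos ℓ hℓ
  set E := Real.exp (-(δ * ℓ / a ^ k)) with hE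
  have hE0 : 0 ≤ E := (Real.exp_pos _).le
  have hE1 : E ≤ 1 := Real.exp_le_one_iff.2 (neg_nonpos.2 (by positivity))
  have hR₁ : (r₁ ^ ℓ)⁻¹ ≤ (min r₁ r₂ ^ ℓ)⁻¹ := by gcongr; exact min_le_left _ _
  have hR₂ : (r₂ ^ ℓ)⁻¹ ≤ (min r₁ r₂ ^ ℓ)⁻¹ := by gcongr; exact min_le_right _ _
  set T := ((ℓ : ℝ) + 1) * (k / b ^ k) + k / a ^ k with hT
  have hT0 : 0 ≤ T := by positivity
  have h1 : |w ℓ k - v ℓ * E| ≤ (A₁ + A₂) * (T + (min r₁ r₂ ^ ℓ)⁻¹) := by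
    have e1 : |w ℓ k - c * E| ≤ A₁ * (T + (min r₁ r₂ ^ ℓ)⁻¹) :=
      (hk ℓ).trans (by gcongr)
    have e2 : |v ℓ - c| * E ≤ A₂ * (T + (min r₁ r₂ ^ ℓ)⁻¹) := by
      refine (mul_le_of_le_one_right (abs_nonneg _) hE1).trans ((hvA ℓ).trans ?_)
      gcongr
      linarith
    calc |w ℓ k - v ℓ * E| = |(w ℓ k - c * E) - (v ℓ - c) * E| := by ring_nf
      _ ≤ |w ℓ k - c * E| + |v ℓ - c| * E := by
        refine (abs_sub _ _).trans_eq ?_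
        rw [abs_mul, abs_of_nonneg hE0]
      _ ≤ _ := by rw [add_mul]; exact add_le_add e1 e2
  have h2 : w ℓ k / v ℓ - E = (w ℓ k - v ℓ * E) / v ℓ := by field_simp
  rw [h2, abs_div, abs_of_pos hv0, div_le_iff₀ hv0]
  refine h1.trans ?_
  have h3 : 1 ≤ 2 / c * v ℓ := by
    have := hvc ℓ hℓ
    rw [div_mul_eq_mul_div, one_le_div hc]
    linarith
  have h4 : 0 ≤ (A₁ + A₂) * (T + (min r₁ r₂ ^ ℓ)⁻¹) := by positivity
  nlinarith [mul_le_mul_of_nonneg_left h3 h4]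

end CarryGF

theorem mainTheorem3 {n : ℕ} (w : ℕ → ℕ → ℝ) (a : Fin (n + 2) → ℝ)
    (r₀ s₀ s₁ : ℝ[X]) (r₁ s₂ : MvPolynomial (Fin (n + 2)) ℝ[X])
    (hw_nonneg : ∀ ℓ k, 0 ≤ w ℓ k)
    (hw_mono : ∀ ℓ, Monotone (w ℓ))
    (ha_one : 1 < a 0) (ha_lt : a 0 < |a 1|)
    (ha_mono : ∀ i j, 1 ≤ i → i ≤ j → |a i| ≤ |a j|)
    (hr₁ : CarryGF.SummandsDivisible₁ r₁) (hs₂ : CarryGF.SummandsDivisible₂ s₂)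
    (hS : ∀ k, CarryGF.denom a s₀ s₁ s₂ k ≠ 0)
    (hG : ∀ k, PowerSeries.mk (fun ℓ => w ℓ k) * (CarryGF.denom a s₀ s₁ s₂ k : PowerSeries ℝ) =
      (CarryGF.numer a r₀ r₁ k : PowerSeries ℝ))
    (hr₀ : r₀.eval 1 ≠ 0)
    (hs₀ : ∀ z : ℂ, ‖z‖ ≤ 1 → aeval z s₀ ≠ 0)
    (hδ : 0 < CarryGF.delta s₀ s₁) :
    -- the limit `G` of the rational functions `G_k`
    (∀ z : ℂ, ‖z‖ < a 0 → (1 - z) * aeval z s₀ ≠ 0 →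
      Tendsto (fun k => aeval z (CarryGF.numer a r₀ r₁ k) /
        aeval z (CarryGF.denom a s₀ s₁ s₂ k)) atTop (𝓝 (CarryGF.limitGF r₀ s₀ z))) ∧
    -- its coefficients `w_ℓ`
    ∃ v : ℕ → ℝ,
      (∀ z : ℂ, ‖z‖ < 1 → HasSum (fun ℓ => (v ℓ : ℂ) * z ^ ℓ) (CarryGF.limitGF r₀ s₀ z)) ∧
      (∀ ℓ k, ℓ < k → w ℓ k = v ℓ) ∧
    ∃ ℓ₀ : ℕ, (∀ ℓ, ℓ₀ ≤ ℓ → v ℓ ≠ 0) ∧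
    -- the laws of the random variables `X_ℓ`
    ∃ P : ℕ → ProbabilityMeasure ℕ,
      (∀ ℓ, ℓ₀ ≤ ℓ → ∀ k, (P ℓ : Measure ℕ).real (Set.Iic k) = w ℓ k / v ℓ) ∧
      -- `w_{ℓk} / w_ℓ = exp (-δℓ / a^k) (1 + o(1))` for `k = log_a ℓ + O(1)`
      (∀ K : ℝ, ∀ ε > 0, ∀ᶠ ℓ : ℕ in atTop, ∀ k : ℕ, |(k : ℝ) - Real.logb (a 0) ℓ| ≤ K →
        |w ℓ k / v ℓ - Real.exp (-(CarryGF.delta s₀ s₁ * ℓ / a 0 ^ k))| ≤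
          ε * Real.exp (-(CarryGF.delta s₀ s₁ * ℓ / a 0 ^ k))) ∧
      -- weak convergence of `X_ℓ - log_a ℓ` when the fractional parts of `log_a ℓ` converge
      (∀ θ : ℝ, ∃ μ : ProbabilityMeasure ℝ, ∀ A : Set ℕ, A.Infinite →
        Tendsto (fun ℓ : ℕ => Int.fract (Real.logb (a 0) ℓ)) (atTop ⊓ 𝓟 A) (𝓝 θ) →
        Tendsto (fun ℓ : ℕ => CarryGF.shiftedLaw (P ℓ) (Real.logb (a 0) ℓ))
          (atTop ⊓ 𝓟 A) (𝓝 μ)) ∧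
      -- the first two moments
      (∀ ℓ, ℓ₀ ≤ ℓ → MemLp (fun j : ℕ => (j : ℝ)) 2 (P ℓ : Measure ℕ)) ∧
      ∃ Ψ₀ Ψ₁ : ℝ → ℝ,
        CarryGF.IsFluctuation (CarryGF.psi₀Term (a 0)) Ψ₀ ∧
        CarryGF.IsFluctuation (CarryGF.psi₁Term (a 0)) Ψ₁ ∧
        (fun ℓ : ℕ => (∫ j : ℕ, (j : ℝ) ∂(P ℓ : Measure ℕ)) -
            (Real.logb (a 0) ℓ + Real.logb (a 0) (CarryGF.delta s₀ s₁) +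
              Real.eulerMascheroniConstant / Real.log (a 0) + 1 / 2 +
              Ψ₀ (Real.logb (a 0) ℓ + Real.logb (a 0) (CarryGF.delta s₀ s₁))))
          =O[atTop] (fun ℓ : ℕ =>
            Real.log ℓ ^ (CarryGF.rho a + 3) / (ℓ : ℝ) ^ CarryGF.rho a) ∧
        (fun ℓ : ℕ => variance (fun j : ℕ => (j : ℝ)) (P ℓ : Measure ℕ) -
            (Real.pi ^ 2 / (6 * Real.log (a 0) ^ 2) + 1 / 12 +
              Ψ₁ (Real.logb (a 0) ℓ + Real.logb (a 0) (CarryGF.delta s₀ s₁)) -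
              2 * Real.eulerMascheroniConstant / Real.log (a 0) *
                Ψ₀ (Real.logb (a 0) ℓ + Real.logb (a 0) (CarryGF.delta s₀ s₁)) -
              Ψ₀ (Real.logb (a 0) ℓ + Real.logb (a 0) (CarryGF.delta s₀ s₁)) ^ 2))
          =O[atTop] (fun ℓ : ℕ =>
            Real.log ℓ ^ (CarryGF.rho a + 4) / (ℓ : ℝ) ^ CarryGF.rho a) := by
  have hs₀1 : s₀.eval 1 ≠ 0 := fun h => hs₀ 1 (by simp) (by
    have := Polynomial.aeval_algebraMap_apply ℂ (1 : ℝ) s₀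
    rw [map_one] at this
    rw [this, Polynomial.coe_aeval_eq_eval, h, map_zero])
  obtain ⟨u, hu, R, hR, U, hU⟩ := CarryGF.exists_inverse_wNormLE hs₀
  set v : ℕ → ℝ := fun ℓ => PowerSeries.coeff ℓ (CarryGF.limitSeries r₀ u) with hv
  set c : ℝ := r₀.eval 1 / s₀.eval 1 with hc
  have hwv : ∀ ℓ k, ℓ < k → w ℓ k = v ℓ := fun ℓ k h => by
    have := CarryGF.coeff_eq_of_lt hr₁ hs₂ hu (hG k) h
    rwa [PowerSeries.coeff_mk] at this
  obtain ⟨A₂, hA₂, hvA⟩ := CarryGF.exists_abs_coeff_limitSeries_sub_le (r₀ := r₀) hR hU hu hs₀1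
  obtain ⟨r, hr, A₁, hA₁, hw⟩ := CarryGF.exists_coeff_asymptotics ha_one ha_lt ha_mono hr₁ hs₂ hu
    hR hU hs₀1 hδ (fun k => PowerSeries.mk fun ℓ => w ℓ k) hG
  simp only [PowerSeries.coeff_mk] at hw
  have hvlim : Tendsto v atTop (𝓝 c) := by
    rw [tendsto_iff_dist_tendsto_zero]
    refine squeeze_zero (fun _ => dist_nonneg) (fun ℓ => (Real.dist_eq _ _).trans_le (hvA ℓ)) ?_
    simpa using (tendsto_inv_atTop_zero.comp (tendsto_pow_atTop_atTop_of_one_lt hR)).const_mul A₂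
  -- Nonnegativity of the coefficients passes to their limit `c`, and `r₀(1) ≠ 0` excludes zero.
  have hcpos : 0 < c := by
    refine lt_of_le_of_ne (ge_of_tendsto' hvlim fun ℓ => ?_) (div_ne_zero hr₀ hs₀1).symm
    rw [← hwv ℓ _ ℓ.lt_succ_self]
    exact hw_nonneg _ _
  obtain ⟨ℓ₀, hℓ₀⟩ := eventually_atTop.1 (hvlim.eventually_const_le (half_lt_self hcpos))
  have hvpos : ∀ ℓ, ℓ₀ ≤ ℓ → 0 < v ℓ := fun ℓ hℓ => by linarith [hℓ₀ ℓ hℓ]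
  have hρ := CarryGF.rho_pos ha_one ha_lt
  have hρ1 := CarryGF.rho_le_one a
  have hclose : CarryGF.CloseToGumbel (a 0) (CarryGF.delta s₀ s₁) (CarryGF.rho a)
      fun ℓ k => w ℓ k / v ℓ :=
    CarryGF.closeToGumbel_div ha_one hρ hρ1 (CarryGF.min_eq_rpow_rho ha_one ha_lt) hδ hcpos hr hR
      hA₁ hA₂ hw_nonneg hw_mono hwv hℓ₀ hw hvA
  have hlaw : ∀ ℓ, ∃ P : ProbabilityMeasure ℕ, ℓ₀ ≤ ℓ →
      (∀ k, (P : Measure ℕ).real (Set.Iic k) = w ℓ k / v ℓ) ∧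
      ∀ f : ℕ → ℝ, Integrable f (P : Measure ℕ) ∧
        HasSum (fun k => f k * CarryGF.pointMass (fun k => w ℓ k / v ℓ) k)
          (∫ k, f k ∂(P : Measure ℕ)) := fun ℓ => by
    by_cases hℓ : ℓ₀ ≤ ℓ
    · obtain ⟨P, hP⟩ := CarryGF.exists_law (F := fun k => w ℓ k / v ℓ) (N := ℓ)
        (fun k k' h => div_le_div_of_nonneg_right (hw_mono ℓ h) (hvpos ℓ hℓ).le)
        (div_nonneg (hw_nonneg ℓ 0) (hvpos ℓ hℓ).le)
        (fun k h => by rw [hwv ℓ k h, div_self (hvpos ℓ hℓ).ne'])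
      exact ⟨P, fun _ => hP⟩
    -- An arbitrary law for small `ℓ`, about which nothing is claimed.
    · exact ⟨⟨Measure.dirac 0, inferInstance⟩, fun h => absurd h hℓ⟩
  choose P hP using hlaw
  have hMem : ∀ ℓ, ℓ₀ ≤ ℓ → MemLp (fun j : ℕ => (j : ℝ)) 2 (P ℓ : Measure ℕ) := fun ℓ hℓ =>
    (memLp_two_iff_integrable_sq (measurable_of_countable _).aestronglyMeasurable).2
      ((hP ℓ hℓ).2 _).1
  have hsum : ∀ᶠ ℓ in atTop, ∀ f : ℕ → ℝ,
      HasSum (fun k => f k * CarryGF.pointMass (fun k => w ℓ k / v ℓ) k)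
        (∫ k, f k ∂(P ℓ : Measure ℕ)) := by
    filter_upwards [eventually_ge_atTop ℓ₀] with ℓ hℓ f using ((hP ℓ hℓ).2 f).2
  refine ⟨fun z hz hz' => CarryGF.tendsto_numer_div_denom ha_one ha_lt ha_mono hr₁ hs₂ hz hz',
    v, fun z hz => CarryGF.hasSum_limitSeries hR hU hu hs₀ hz, hwv, ℓ₀,
    fun ℓ hℓ => (hvpos ℓ hℓ).ne', P, fun ℓ hℓ => (hP ℓ hℓ).1,
    fun K ε hε => hclose.eventually_abs_sub_le ha_one hδ hρ K hε, fun θ => ?_, hMem,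
    CarryGF.fluct₀ (a 0), CarryGF.fluct₁ (a 0), CarryGF.isFluctuation_fluct₀ ha_one,
    CarryGF.isFluctuation_fluct₁ ha_one, ?_, ?_⟩
  · obtain ⟨μ, hμ⟩ := CarryGF.tendsto_shiftedLaw ha_one hδ hρ hρ1 hclose hsum θ
    exact ⟨μ, fun A _ => hμ A⟩
  · exact CarryGF.isBigO_mean ha_one hδ hρ hρ1 hclose (hsum.mono fun ℓ h => h _)
  · refine (CarryGF.isBigO_variance ha_one hδ hρ hρ1 hclose (hsum.mono fun ℓ h => h _)
      (hsum.mono fun ℓ h => h _)).congr' ?_ EventuallyEq.rfl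
    filter_upwards [eventually_ge_atTop ℓ₀] with ℓ hℓ
    rw [variance_eq_sub (hMem ℓ hℓ)]
    rfl
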